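/- Let $W\subseteq\mathbb R^2\times\mathbb R^m$ be open, let $C^\alpha_{\beta\gamma},A^\alpha_\gamma,B^\alpha_\gamma,E^\alpha\in C^\infty(W)$ be functions of $(x,y,u)$, and consider the system in normal form $$u^\alpha_{xy}=f^\alpha:=-\bigl(C^\alpha_{\beta\gamma}u^\beta_xu^\gamma_y+A^\alpha_\gamma u^\gamma_x+B^\alpha_\gamma u^\gamma_y+E^\alpha\bigr),\qquad \alpha=1,\dots,m$$ (repeated indices are summed). Let $D_x,D_y$ denote total derivatives and put, with $u^\beta_{xy}$ replaced by $f^\beta$ in $D_x,D_y$, $$H^\gamma_\alpha=\frac{\partial f^\gamma}{\partial u^\alpha}+\frac{\partial f^\gamma}{\partial u^\sigma_y}\frac{\partial f^\sigma}{\partial u^\alpha_x}-D_x\frac{\partial f^\gamma}{\partial u^\alpha_x},\qquad K^\gamma_\alpha=\frac{\partial f^\gamma}{\partial u^\alpha}+\frac{\partial f^\gamma}{\partial u^\sigma_x}\frac{\partial f^\sigma}{\partial u^\alpha_y}-D_y\frac{\partial f^\gamma}{\partial u^\alpha_y},$$ $$S^\gamma_{\alpha\beta}=\frac{\partial^2f^\gamma}{\partial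 u^\beta_x\partial u^\alpha_y}-\frac{\partial^2f^\gamma}{\partial u^\alpha_x\partial u^\beta_y}=C^\gamma_{\alpha\beta}-C^\gamma_{\beta\alpha},\qquad \Omega^\sigma_\alpha=C^\sigma_{\alpha\tau}\,du^\tau+A^\sigma_\alpha\,dy+B^\sigma_\alpha\,dx .$$ For a matrix function $M_{\alpha\beta}=M_{\alpha\beta}(x,y,u)$ on $W$ consider the conditions, at all points and jets over $W$, $$(\ast)\qquad M_{\alpha\beta}=M_{\beta\alpha},\quad M_{\alpha\sigma}H^\sigma_\beta=M_{\beta\sigma}K^\sigma_\alpha,\quad M_{\alpha\sigma}S^\sigma_{\beta\gamma}=-M_{\beta\sigma}S^\sigma_{\alpha\gamma},\quad dM_{\alpha\beta}=M_{\alpha\sigma}\Omega^\sigma_\beta+M_{\beta\sigma}\Omega^\sigma_\alpha .$$ (1) Let $M_{\alpha\beta}(x,y,u,u_x,u_y)$ be functions of the first-order jets over $W$. The system is multiplier-variational with multiplier $M$, that is, $\det M\neq0$ everywhere and every point of $W$ has an open neighbourhood $V\subseteq W$ over which there is a smooth first-order Lagrangian $L(x,y,u,u_x,u_y)$ with $$\frac{\partial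 L}{\partial u^\alpha}-D_x\frac{\partial L}{\partial u^\alpha_x}-D_y\frac{\partial L}{\partial u^\alpha_y}=M_{\alpha\beta}\,(u^\beta_{xy}-f^\beta)$$ identically in the second-order jets over $V$, if and only if $\det M\ne0$ everywhere, $M$ depends on $(x,y,u)$ only, and $M$ satisfies $(\ast)$. If $W$ is convex and these conditions hold, one such $L$ exists over all of $W$. (2) Let $\mathcal R^\infty$ be the infinitely prolonged equation manifold of the system over $W$, with coordinates $x,y,u^\alpha,u^\alpha_x,u^\alpha_y,u^\alpha_{xx},u^\alpha_{yy},\dots$, and put $\theta^\alpha=du^\alpha-u^\alpha_xdx-u^\alpha_ydy$, $\theta^\alpha_x=du^\alpha_x-u^\alpha_{xx}dx-f^\alpha dy$, $\theta^\alpha_y=du^\alpha_y-f^\alpha dx-u^\alpha_{yy}dy$. Let $M_{\alpha\beta}$ be functions of finite order on $\mathcal R^\infty$. Every point of $W$ has an open neighbourhood $V\subseteq W$ over which there is a form $$\omega=(T_{\alpha\beta}\,dx+P_{\alpha\beta}\,dy)\wedge\theta^\alpha\wedge\theta^\beta+R_{\alpha\beta}\bigl(\theta^\alpha\wedge\theta^\beta_x\wedge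 dx-\theta^\beta\wedge\theta^\alpha_y\wedge dy\bigr)$$ with smooth coefficients of finite order on $\mathcal R^\infty$, with $d\omega=0$ and $\tfrac12(R_{\alpha\beta}+R_{\beta\alpha})=M_{\alpha\beta}$, if and only if $M$ depends on $(x,y,u)$ only and satisfies $(\ast)$. If $W$ is convex and these conditions hold, one such $\omega$ exists over all of $W$. -/

import Mathlib

open scoped ContDiff

noncomputable section

namespace FGordon

/-! ### Jet coordinates -/

/-- Points `(x, y, u)` of the trivial bundle `ℝ² × ℝᵐ`. -/
abbrev J0 (m : ℕ) := ℝ × ℝ × (Fin m → ℝ)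

/-- First-order jets `((x, y, u), u_x, u_y)`. -/
abbrev J1 (m : ℕ) := J0 m × (Fin m → ℝ) × (Fin m → ℝ)

variable {m : ℕ}

/-- All first-order jets over `W ⊆ ℝ² × ℝᵐ`. -/
def over1 (W : Set (J0 m)) : Set (J1 m) := {j | j.1 ∈ W}

/-- The coordinate vector `∂/∂u^α` on first-order jets. -/
def eU (α : Fin m) : J1 m := ((0, 0, Pi.single α 1), 0, 0)

/-- The coordinate vector `∂/∂u^α_x` on first-order jets. -/
def eUx (α : Fin m) : J1 m := (0, Pi.single α 1, 0)

/-- The coordinate vector `∂/∂u^α_y` on first-order jets. -/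
def eUy (α : Fin m) : J1 m := (0, 0, Pi.single α 1)

/-- Partial derivative of a first-order function along a coordinate vector. -/
def pd (e : J1 m) (g : J1 m → ℝ) (j : J1 m) : ℝ := fderiv ℝ g j e

/-- Total derivative `D_x g = g_x + g_{u^β} u^β_x + g_{u^β_x} u^β_{xx} + g_{u^β_y} u^β_{xy}`. -/
def Dx (g : J1 m → ℝ) (j : J1 m) (uxx uxy : Fin m → ℝ) : ℝ :=
  fderiv ℝ g j ((1, 0, j.2.1), uxx, uxy)

/-- Total derivative `D_y g = g_y + g_{u^β} u^β_y + g_{u^β_x} u^β_{xy} + g_{u^β_y} u^β_{yy}`. -/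
def Dy (g : J1 m → ℝ) (j : J1 m) (uxy uyy : Fin m → ℝ) : ℝ :=
  fderiv ℝ g j ((0, 1, j.2.2), uxy, uyy)

/-- The Euler–Lagrange expression
`E_α(L) = ∂L/∂u^α - D_x (∂L/∂u^α_x) - D_y (∂L/∂u^α_y)` of a first-order Lagrangian,
at the second-order jet `(j, u_xx, u_xy, u_yy)`. -/
def eulerLagrange (L : J1 m → ℝ) (α : Fin m) (j : J1 m) (uxx uxy uyy : Fin m → ℝ) : ℝ :=
  pd (eU α) L j - Dx (pd (eUx α) L) j uxx uxy - Dy (pd (eUy α) L) j uxy uyy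

/-! ### Systems in normal form -/

/-- Coefficients of the system
`u^α_xy + C^α_{βγ} u^β_x u^γ_y + A^α_γ u^γ_x + B^α_γ u^γ_y + E^α = 0`;
`C α β γ` is `C^α_{βγ}`, and `A α γ` is `A^α_γ`. -/
structure System (m : ℕ) where
  C : Fin m → Fin m → Fin m → J0 m → ℝ
  A : Fin m → Fin m → J0 m → ℝ
  B : Fin m → Fin m → J0 m → ℝ
  E : Fin m → J0 m → ℝ

namespace System

variable (s : System m)

/-- The coefficients are `C^∞` on `W`. -/
def SmoothOn (W : Set (J0 m)) : Prop :=
  (∀ α β γ, ContDiffOn ℝ ∞ (s.C α β γ) W) ∧ (∀ α γ, ContDiffOn ℝ ∞ (s.A α γ) W) ∧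
    (∀ α γ, ContDiffOn ℝ ∞ (s.B α γ) W) ∧ ∀ α, ContDiffOn ℝ ∞ (s.E α) W

/-- The right-hand side `f^α(x, y, u, u_x, u_y)` of the system written as `u^α_xy = f^α`. -/
def f (α : Fin m) (j : J1 m) : ℝ :=
  -((∑ β, ∑ γ, s.C α β γ j.1 * j.2.1 β * j.2.2 γ) + (∑ γ, s.A α γ j.1 * j.2.1 γ) +
    (∑ γ, s.B α γ j.1 * j.2.2 γ) + s.E α j.1)

/-- `H^γ_α = ∂f^γ/∂u^α + (∂f^γ/∂u^σ_y)(∂f^σ/∂u^α_x) - D_x (∂f^γ/∂u^α_x)`, where `u_xy = f` in the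
total derivative; a function of `(x, y, u, u_x, u_y, u_xx)`. -/
def H (γ α : Fin m) (j : J1 m) (uxx : Fin m → ℝ) : ℝ :=
  pd (eU α) (s.f γ) j + (∑ σ, pd (eUy σ) (s.f γ) j * pd (eUx α) (s.f σ) j) -
    Dx (pd (eUx α) (s.f γ)) j uxx (fun β => s.f β j)

/-- `K^γ_α = ∂f^γ/∂u^α + (∂f^γ/∂u^σ_x)(∂f^σ/∂u^α_y) - D_y (∂f^γ/∂u^α_y)`, where `u_xy = f` in the
total derivative; a function of `(x, y, u, u_x, u_y, u_yy)`. -/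
def K (γ α : Fin m) (j : J1 m) (uyy : Fin m → ℝ) : ℝ :=
  pd (eU α) (s.f γ) j + (∑ σ, pd (eUx σ) (s.f γ) j * pd (eUy α) (s.f σ) j) -
    Dy (pd (eUy α) (s.f γ)) j (fun β => s.f β j) uyy

/-- `S^γ_{αβ} = ∂²f^γ/∂u^β_x∂u^α_y - ∂²f^γ/∂u^α_x∂u^β_y`, which is `C^γ_{αβ} - C^γ_{βα}`. -/
def S (γ α β : Fin m) (j : J1 m) : ℝ :=
  pd (eUx β) (pd (eUy α) (s.f γ)) j - pd (eUx α) (pd (eUy β) (s.f γ)) j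

/-- The 1-form `Ω^σ_α = C^σ_{ατ} du^τ + A^σ_α dy + B^σ_α dx` on `ℝ² × ℝᵐ` at the point `z`. -/
def Ω (σ α : Fin m) (z : J0 m) : J0 m →L[ℝ] ℝ :=
  (∑ τ, s.C σ α τ z •
      (ContinuousLinearMap.proj (R := ℝ) (φ := fun _ : Fin m => ℝ) τ ∘L
        ContinuousLinearMap.snd ℝ ℝ (Fin m → ℝ) ∘L ContinuousLinearMap.snd ℝ ℝ _)) +
    s.A σ α z • (ContinuousLinearMap.fst ℝ ℝ (Fin m → ℝ) ∘L ContinuousLinearMap.snd ℝ ℝ _) +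
    s.B σ α z • ContinuousLinearMap.fst ℝ ℝ (ℝ × (Fin m → ℝ))

/-- The algebraic and differential conditions on a symmetric matrix function `N(x, y, u)` on `W`:
`N_{ασ} H^σ_β = N_{βσ} K^σ_α`, `N_{ασ} S^σ_{βγ} = - N_{βσ} S^σ_{αγ}` and
`dN_{αβ} = N_{ασ} Ω^σ_β + N_{βσ} Ω^σ_α`. -/
structure Conditions (W : Set (J0 m)) (N : J0 m → Matrix (Fin m) (Fin m) ℝ) : Prop where
  symm : ∀ z ∈ W, (N z).IsSymm
  HK : ∀ j ∈ over1 W, ∀ (uxx uyy : Fin m → ℝ) (α β : Fin m),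
    ∑ σ, N j.1 α σ * s.H σ β j uxx = ∑ σ, N j.1 β σ * s.K σ α j uyy
  skew : ∀ j ∈ over1 W, ∀ α β γ : Fin m,
    ∑ σ, N j.1 α σ * s.S σ β γ j = -∑ σ, N j.1 β σ * s.S σ α γ j
  deriv : ∀ z ∈ W, ∀ α β : Fin m, HasFDerivAt (fun w => N w α β)
    (∑ σ, (N z α σ • s.Ω σ β z + N z β σ • s.Ω σ α z)) z

/-! ### Multipliers -/

/-- There is a first-order Lagrangian `L` over `V` with
`E_α(L) = M_{αβ} (u^β_xy - f^β)` on all second-order jets over `V`. -/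
def HasLagrangian (V : Set (J0 m)) (M : J1 m → Matrix (Fin m) (Fin m) ℝ) : Prop :=
  ∃ L : J1 m → ℝ, ContDiffOn ℝ ∞ L (over1 V) ∧
    ∀ j ∈ over1 V, ∀ (uxx uxy uyy : Fin m → ℝ) (α : Fin m),
      eulerLagrange L α j uxx uxy uyy = ∑ β, M j α β * (uxy β - s.f β j)

/-- The system is multiplier-variational on `W` with the multiplier `M(x, y, u, u_x, u_y)`:
`det M ≠ 0`, and near every point of `W` the functions `M_{αβ} (u^β_xy - f^β)` are the
Euler–Lagrange expressions of a first-order Lagrangian. -/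
def MultiplierVariational (W : Set (J0 m)) (M : J1 m → Matrix (Fin m) (Fin m) ℝ) : Prop :=
  (∀ j ∈ over1 W, (M j).det ≠ 0) ∧
    ∀ p ∈ W, ∃ V, IsOpen V ∧ p ∈ V ∧ V ⊆ W ∧ s.HasLagrangian V M

end System

/-! ### Differential forms on the prolonged equation manifold -/

/-- The prolonged equation manifold `R^n` of a system `u_xy = f`, in its coordinates
`(x, y, u, u_x, u_xx, …, u_y, u_yy, …)` up to order `n`: for `q : EqJet m n`, the vector
`q.2.1 i` is the derivative of `u` of order `i + 1` in `x`, and `q.2.2 i` the one in `y`.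
A function on the infinite prolongation is a function on `EqJet m n` for some `n`, and the
projections `R^l → R^n` being submersions, a form on it vanishes iff it vanishes on `EqJet m n`. -/
abbrev EqJet (m n : ℕ) := J0 m × (Fin n → Fin m → ℝ) × (Fin n → Fin m → ℝ)

/-- All points of `R^n` over `W`. -/
def overEq (n : ℕ) (W : Set (J0 m)) : Set (EqJet m n) := {q | q.1 ∈ W}

/-- The projection `R^n → R^k` for `k ≤ n`. -/
def EqJet.trunc {k n : ℕ} (h : k ≤ n) (q : EqJet m n) : EqJet m k :=
  (q.1, fun i => q.2.1 (Fin.castLE h i), fun i => q.2.2 (Fin.castLE h i))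

/-- The first-order jet of a point of `R^{n+2}`. -/
def EqJet.toJ1 {n : ℕ} (q : EqJet m (n + 2)) : J1 m := (q.1, q.2.1 0, q.2.2 0)

section forms

variable {n : ℕ}

/-- `dx` -/
def dX : EqJet m n →L[ℝ] ℝ :=
  ContinuousLinearMap.fst ℝ ℝ (ℝ × (Fin m → ℝ)) ∘L ContinuousLinearMap.fst ℝ (J0 m) _

/-- `dy` -/
def dY : EqJet m n →L[ℝ] ℝ :=
  ContinuousLinearMap.fst ℝ ℝ (Fin m → ℝ) ∘L ContinuousLinearMap.snd ℝ ℝ _ ∘L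
    ContinuousLinearMap.fst ℝ (J0 m) _

/-- `du^α` -/
def dU (α : Fin m) : EqJet m n →L[ℝ] ℝ :=
  ContinuousLinearMap.proj (R := ℝ) (φ := fun _ : Fin m => ℝ) α ∘L
    ContinuousLinearMap.snd ℝ ℝ (Fin m → ℝ) ∘L ContinuousLinearMap.snd ℝ ℝ _ ∘L
    ContinuousLinearMap.fst ℝ (J0 m) _

/-- The differential of the `α`-th component of the `x`-derivative of `u` of order `i + 1`. -/
def dUX (i : Fin n) (α : Fin m) : EqJet m n →L[ℝ] ℝ :=
  ContinuousLinearMap.proj (R := ℝ) (φ := fun _ : Fin m => ℝ) α ∘L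
    ContinuousLinearMap.proj (R := ℝ) (φ := fun _ : Fin n => Fin m → ℝ) i ∘L
    ContinuousLinearMap.fst ℝ (Fin n → Fin m → ℝ) (Fin n → Fin m → ℝ) ∘L
    ContinuousLinearMap.snd ℝ (J0 m) _

/-- The differential of the `α`-th component of the `y`-derivative of `u` of order `i + 1`. -/
def dUY (i : Fin n) (α : Fin m) : EqJet m n →L[ℝ] ℝ :=
  ContinuousLinearMap.proj (R := ℝ) (φ := fun _ : Fin m => ℝ) α ∘L
    ContinuousLinearMap.proj (R := ℝ) (φ := fun _ : Fin n => Fin m → ℝ) i ∘L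
    ContinuousLinearMap.snd ℝ (Fin n → Fin m → ℝ) (Fin n → Fin m → ℝ) ∘L
    ContinuousLinearMap.snd ℝ (J0 m) _

/-- The contact form `θ^α = du^α - u^α_x dx - u^α_y dy`. -/
def θ (α : Fin m) (q : EqJet m (n + 2)) : EqJet m (n + 2) →L[ℝ] ℝ :=
  dU α - q.2.1 0 α • dX - q.2.2 0 α • dY

/-- The contact form `θ^α_x = du^α_x - u^α_xx dx - f^α dy`. -/
def θx (s : System m) (α : Fin m) (q : EqJet m (n + 2)) : EqJet m (n + 2) →L[ℝ] ℝ :=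
  dUX 0 α - q.2.1 1 α • dX - s.f α q.toJ1 • dY

/-- The contact form `θ^α_y = du^α_y - f^α dx - u^α_yy dy`. -/
def θy (s : System m) (α : Fin m) (q : EqJet m (n + 2)) : EqJet m (n + 2) →L[ℝ] ℝ :=
  dUY 0 α - s.f α q.toJ1 • dX - q.2.2 1 α • dY

end forms

/-- The exterior product `a ∧ b ∧ c` of three covectors, `det (a_i(v_j))` on `(v_1, v_2, v_3)`. -/
def wedge3 {F : Type*} [NormedAddCommGroup F] [NormedSpace ℝ F] (a b c : F →L[ℝ] ℝ) :
    F [⋀^Fin 3]→L[ℝ] ℝ :=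
  ContinuousMultilinearMap.alternatization
    ((ContinuousMultilinearMap.mkPiAlgebra ℝ (Fin 3) ℝ).compContinuousLinearMap ![a, b, c])

/-- The type `(1, 2)` form
`ω = (T_{αβ} dx + P_{αβ} dy) ∧ θ^α ∧ θ^β + R_{αβ} (θ^α ∧ θ^β_x ∧ dx - θ^β ∧ θ^α_y ∧ dy)`. -/
def omega {n : ℕ} (s : System m) (T P R : EqJet m (n + 2) → Matrix (Fin m) (Fin m) ℝ)
    (q : EqJet m (n + 2)) : EqJet m (n + 2) [⋀^Fin 3]→L[ℝ] ℝ :=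
  ∑ α, ∑ β, (T q α β • wedge3 dX (θ α q) (θ β q) + P q α β • wedge3 dY (θ α q) (θ β q) +
    R q α β • (wedge3 (θ α q) (θx s β q) dX - wedge3 (θ β q) (θy s α q) dY))

/-- Over `V` there is a form `ω` as above, with smooth coefficients of some finite order, such
that `dω = 0` and `(R_{αβ} + R_{βα}) / 2 = M_{αβ}`. -/
def System.HasClosedForm (s : System m) (V : Set (J0 m)) {k : ℕ}
    (M : EqJet m k → Matrix (Fin m) (Fin m) ℝ) : Prop :=
  ∃ (n : ℕ) (hk : k ≤ n + 2) (T P R : EqJet m (n + 2) → Matrix (Fin m) (Fin m) ℝ),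
    (∀ α β, ContDiffOn ℝ ∞ (fun q => T q α β) (overEq (n + 2) V)) ∧
    (∀ α β, ContDiffOn ℝ ∞ (fun q => P q α β) (overEq (n + 2) V)) ∧
    (∀ α β, ContDiffOn ℝ ∞ (fun q => R q α β) (overEq (n + 2) V)) ∧
    (∀ q ∈ overEq (n + 2) V, ∀ α β, (R q α β + R q β α) / 2 = M (q.trunc hk) α β) ∧
    ∀ q ∈ overEq (n + 2) V, extDeriv (omega s T P R) q = 0

/-- Near every point of `W` there is a closed form `ω` as above with symmetric part `M`. -/
def System.LocallyHasClosedForm (s : System m) (W : Set (J0 m)) {k : ℕ}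
    (M : EqJet m k → Matrix (Fin m) (Fin m) ℝ) : Prop :=
  ∀ p ∈ W, ∃ V, IsOpen V ∧ p ∈ V ∧ V ⊆ W ∧ s.HasClosedForm V M

end FGordon

end

open scoped ContDiff

noncomputable section

set_option maxSynthPendingDepth 3

/-! ### Parametric integrals and the homotopy operator on differential forms -/

section Homotopy

universe u

open Set MeasureTheory intervalIntegral

variable {E F : Type u} [NormedAddCommGroup E] [NormedSpace ℝ E]
  [NormedAddCommGroup F] [NormedSpace ℝ F]

/-! The proof goes round a triangle: a Lagrangian yields a closed form, a closed form yields (∗),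
and over a convex open set (∗) yields a Lagrangian. Both equivalences and both global statements
follow, because (∗) is a local condition and every point of `W` has a convex neighbourhood. The
condition det M ≠ 0 is only carried along.

Lagrangian to closed form (`exists_isClosedOmega_of_hasLagrangian`). The Euler–Lagrange expressions
are affine in the second derivatives. Comparing coefficients gives L_{u_x u_x} = 0, L_{u_y u_y} = 0
and M_{αβ} = -(L_{u^α_x u^β_y} + L_{u^α_y u^β_x}). On the equation manifold the Euler–Lagrange
expressions vanish, so the exterior derivative of the Poincaré–Cartan form of L has exactly the
shape of `omega`. It is closed because d² = 0, and -2 times it has symmetric part M.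

Closed form to conditions (`IsClosedOmega.conditions`). Evaluate dω = 0 on suitable vectors.
Coordinate vectors show that R does not depend on any derivative of u. The vectors D_x, D_y, ∂/∂u^α
together with ∂/∂u^β_x or ∂/∂u^β_y express the antisymmetric parts of P and T through R and the
first derivatives of f. Symmetrizing these formulas in α, β leaves equations for D_y M and D_x M.
Finally (D_x, D_y, ∂/∂u^α, ∂/∂u^β) gives a Helmholtz equation. The equations for D_x M and D_y M are
polynomial in u_x and u_y, and their coefficients give the formula for dM. The derivatives of M in u
are obtained twice, and the agreement of the two answers is the condition on S. Given these
equations, the Helmholtz equation is the condition on H and K (`sum_H_sub_sum_K`).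

Conditions to Lagrangian (`Conditions.hasLagrangian`). Regard M as a metric and C as a connection
preserving it. The condition on S says that the torsion, lowered by M, is totally skew. The
Lagrangian -M_{βγ} u^β_x u^γ_y / 2 produces the term M u_xy and the part of M f governed by dM. What
remains is the value on (∂/∂u^α, D_x, D_y) of a three-form on the base (`multiplierForm`), built
from the torsion, A, B and E. Its exterior derivative on (∂/∂u^β, ∂/∂u^α, D_x, D_y) vanishes by the
Helmholtz equation. The Poincaré lemma (`extDeriv_homotopyOperator_apply`) then provides a two-form
Λ, and adding the Wess–Zumino term Λ(D_x, D_y) to the quadratic Lagrangian accounts for the rest,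
since its Euler–Lagrange expression is dΛ(∂/∂u^α, D_x, D_y). -/

theorem ContDiffOn.hasFDerivAt_parametric_integral [ProperSpace E]
    {g : ℝ × E → F} {O : Set (ℝ × E)} (hO : IsOpen O)
    (hg : ContDiffOn ℝ 1 g O) {x₀ : E} (h : ∀ t ∈ Icc (0 : ℝ) 1, (t, x₀) ∈ O) :
    HasFDerivAt (fun x => ∫ t in (0 : ℝ)..1, g (t, x))
      (∫ t in (0 : ℝ)..1, fderiv ℝ g (t, x₀) ∘L ContinuousLinearMap.inr ℝ ℝ E) x₀ := by
  -- The tube lemma gives one ball around `x₀` that works for all t. Halving its radius makes the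
  -- closed ball times [0, 1] a compact subset of `O`, on which the continuous derivative has a
  -- constant bound; this is the dominating function.
  obtain ⟨U, V, hU, hV, hIU, hxV, hUV⟩ := generalized_tube_lemma (s := Icc (0 : ℝ) 1)
    isCompact_Icc (t := {x₀}) isCompact_singleton hO (by rintro ⟨t, x⟩ ⟨ht, rfl⟩; exact h t ht)
  obtain ⟨ε, hε, hball⟩ := Metric.isOpen_iff.1 hV x₀ (hxV rfl)
  have hsub : Icc (0 : ℝ) 1 ×ˢ Metric.closedBall x₀ (ε / 2) ⊆ O := by
    rintro ⟨t, x⟩ ⟨ht, hx⟩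
    exact hUV ⟨hIU ht, hball (Metric.closedBall_subset_ball (by linarith) hx)⟩
  have hcont : ContinuousOn (fderiv ℝ g) O := hg.continuousOn_fderiv_of_isOpen hO le_rfl
  have hF' : ContinuousOn (fun z => fderiv ℝ g z ∘L ContinuousLinearMap.inr ℝ ℝ E) O :=
    hcont.clm_comp continuousOn_const
  obtain ⟨B, hB⟩ := (isCompact_Icc.prod (isCompact_closedBall x₀ (ε / 2))).exists_bound_of_continuousOn
    (hF'.mono hsub)
  have hslice : ∀ x ∈ Metric.closedBall x₀ (ε / 2), ∀ {G : Type u} [NormedAddCommGroup G]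
      {k : ℝ × E → G}, ContinuousOn k O → ContinuousOn (fun t => k (t, x)) (uIcc (0 : ℝ) 1) := by
    intro x hx G _ k hk
    refine hk.comp (by fun_prop) fun t ht => hsub ⟨?_, hx⟩
    rwa [uIcc_of_le zero_le_one] at ht
  have hx₀ : x₀ ∈ Metric.closedBall x₀ (ε / 2) := Metric.mem_closedBall_self (by linarith)
  have hIoc : uIoc (0 : ℝ) 1 ⊆ uIcc 0 1 := uIoc_subset_uIcc
  refine hasFDerivAt_integral_of_dominated_of_fderiv_le (𝕜 := ℝ) (bound := fun _ => B)
    (F := fun x t => g (t, x)) (μ := volume)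
    (F' := fun x t => fderiv ℝ g (t, x) ∘L ContinuousLinearMap.inr ℝ ℝ E)
    (s := Metric.closedBall x₀ (ε / 2)) (Metric.closedBall_mem_nhds _ (by linarith)) ?_ ?_ ?_ ?_ ?_ ?_
  · filter_upwards [Metric.closedBall_mem_nhds x₀ (by linarith : 0 < ε / 2)] with x hx
    exact ((hslice x hx hg.continuousOn).mono hIoc).aestronglyMeasurable measurableSet_uIoc
  · exact (hslice x₀ hx₀ hg.continuousOn).intervalIntegrable
  · exact ((hslice x₀ hx₀ hF').mono hIoc).aestronglyMeasurable measurableSet_uIoc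
  · refine Filter.Eventually.of_forall fun t ht x hx => hB (t, x) ⟨?_, hx⟩
    have := hIoc ht
    rwa [uIcc_of_le zero_le_one] at this
  · exact intervalIntegrable_const
  · refine Filter.Eventually.of_forall fun t ht x hx => ?_
    have ht' := hIoc ht
    rw [uIcc_of_le zero_le_one] at ht'
    have hd : DifferentiableAt ℝ g (t, x) :=
      (hg.contDiffAt (hO.mem_nhds (hsub ⟨ht', hx⟩))).differentiableAt (by simp)
    exact hd.hasFDerivAt.comp x (hasFDerivAt_prodMk_right t x)

/-- Induction on the order: the derivative is again a parametric integral, with values in `E →L[ℝ]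
F`. The induction therefore varies `F`, and this is why `E` and `F` share a universe. -/
theorem ContDiffOn.parametric_integral [ProperSpace E] {O : Set (ℝ × E)} (hO : IsOpen O)
    {W : Set E} (hW : IsOpen W) (h : ∀ x ∈ W, ∀ t ∈ Icc (0 : ℝ) 1, (t, x) ∈ O)
    {g : ℝ × E → F} (hg : ContDiffOn ℝ ∞ g O) :
    ContDiffOn ℝ ∞ (fun x => ∫ t in (0 : ℝ)..1, g (t, x)) W := by
  rw [contDiffOn_infty]
  intro n
  induction n generalizing F with
  | zero =>
    have hd : DifferentiableOn ℝ (fun x => ∫ t in (0 : ℝ)..1, g (t, x)) W := fun x hx =>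
      (ContDiffOn.hasFDerivAt_parametric_integral hO (hg.of_le (by simp))
        (h x hx)).differentiableAt.differentiableWithinAt
    simpa using hd.continuousOn
  | succ n ih =>
    have hd : ∀ x ∈ W, _ := fun x hx =>
      ContDiffOn.hasFDerivAt_parametric_integral hO (hg.of_le (by simp)) (h x hx)
    rw [Nat.cast_add, Nat.cast_one, contDiffOn_succ_iff_fderiv_of_isOpen hW]
    refine ⟨fun x hx => (hd x hx).differentiableAt.differentiableWithinAt, by simp, ?_⟩
    refine ContDiffOn.congr (ih (g := fun z => fderiv ℝ g z ∘L ContinuousLinearMap.inr ℝ ℝ E) ?_)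
      fun x hx => (hd x hx).fderiv
    exact (hg.fderiv_of_isOpen hO (by simp)).clm_comp contDiffOn_const

variable {n : ℕ}

variable (E F n) in
/-- `ContinuousAlternatingMap.curryLeft` as a continuous linear map. -/
def curryLeftL : (E [⋀^Fin (n + 1)]→L[ℝ] F) →L[ℝ] E →L[ℝ] E [⋀^Fin n]→L[ℝ] F :=
  ContinuousAlternatingMap.curryLeftLI.toContinuousLinearMap

@[simp]
theorem curryLeftL_apply (f : E [⋀^Fin (n + 1)]→L[ℝ] F) : curryLeftL E F n f = f.curryLeft := rfl

theorem contDiff_curryLeft {k : WithTop ℕ∞} :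
    ContDiff ℝ k (fun f : E [⋀^Fin (n + 1)]→L[ℝ] F => f.curryLeft) := by
  exact (curryLeftL E F n).contDiff

theorem hasFDerivAt_curryLeft (f : E [⋀^Fin (n + 1)]→L[ℝ] F) :
    HasFDerivAt (fun f : E [⋀^Fin (n + 1)]→L[ℝ] F => f.curryLeft) (curryLeftL E F n) f := by
  exact (curryLeftL E F n).hasFDerivAt

theorem alternatizeUncurryFin_intervalIntegral [CompleteSpace F] {a b : ℝ}
    {f : ℝ → E →L[ℝ] E [⋀^Fin n]→L[ℝ] F} (hf : IntervalIntegrable f volume a b) :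
    ContinuousAlternatingMap.alternatizeUncurryFin (∫ t in a..b, f t) =
      ∫ t in a..b, ContinuousAlternatingMap.alternatizeUncurryFin (f t) := by
  have := (ContinuousAlternatingMap.alternatizeUncurryFinCLM ℝ E F).intervalIntegral_comp_comm hf
  exact this.symm

/-- The homotopy operator with base point `z₀`, lowering the degree of a differential form. -/
def homotopyOperator (z₀ : E) (Φ : E → E [⋀^Fin (n + 1)]→L[ℝ] F) (z : E) : E [⋀^Fin n]→L[ℝ] F :=
  ∫ t in (0 : ℝ)..1, t ^ n • (Φ (z₀ + t • (z - z₀))).curryLeft (z - z₀)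

variable {W : Set E} {z₀ : E} {Φ : E → E [⋀^Fin (n + 1)]→L[ℝ] F}

theorem Convex.segment_point_mem (hc : Convex ℝ W) (hz₀ : z₀ ∈ W) {z : E} (hz : z ∈ W) {t : ℝ}
    (ht : t ∈ Icc (0 : ℝ) 1) : z₀ + t • (z - z₀) ∈ W :=
  hc.add_smul_sub_mem hz₀ hz ht

theorem contDiffOn_homotopyIntegrand (hΦ : ContDiffOn ℝ ∞ Φ W) :
    ContDiffOn ℝ ∞ (fun p : ℝ × E => p.1 ^ n • (Φ (z₀ + p.1 • (p.2 - z₀))).curryLeft (p.2 - z₀))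
      {p : ℝ × E | z₀ + p.1 • (p.2 - z₀) ∈ W} := by
  have h1 : ContDiffOn ℝ ∞ (fun p : ℝ × E => Φ (z₀ + p.1 • (p.2 - z₀)))
      {p : ℝ × E | z₀ + p.1 • (p.2 - z₀) ∈ W} :=
    hΦ.comp (by fun_prop) fun p hp => hp
  have h2 : ContDiffOn ℝ ∞ (fun p : ℝ × E => (Φ (z₀ + p.1 • (p.2 - z₀))).curryLeft)
      {p : ℝ × E | z₀ + p.1 • (p.2 - z₀) ∈ W} :=
    contDiff_curryLeft.comp_contDiffOn h1
  have h3 : ContDiffOn ℝ ∞ (fun p : ℝ × E => p.2 - z₀) {p : ℝ × E | z₀ + p.1 • (p.2 - z₀) ∈ W} := by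
    fun_prop
  have h4 : ContDiffOn ℝ ∞ (fun p : ℝ × E => p.1 ^ n) {p : ℝ × E | z₀ + p.1 • (p.2 - z₀) ∈ W} := by
    fun_prop
  exact h4.smul (h2.clm_apply h3)

theorem ContDiffOn.homotopyOperator [ProperSpace E] (hW : IsOpen W) (hc : Convex ℝ W)
    (hz₀ : z₀ ∈ W) (hΦ : ContDiffOn ℝ ∞ Φ W) : ContDiffOn ℝ ∞ (homotopyOperator z₀ Φ) W :=
  ContDiffOn.parametric_integral
    (hW.preimage (f := fun p : ℝ × E => z₀ + p.1 • (p.2 - z₀)) (by fun_prop)) hW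
    (fun _ hz _ ht => hc.segment_point_mem hz₀ hz ht) (contDiffOn_homotopyIntegrand hΦ)

/-- Cartan's formula along the dilations towards `z₀`: the first bracket is the derivative in t of
t^(n+1) Φ(z₀ + t(z - z₀)), and the last term is the contraction of dΦ with the radial vector. -/
theorem alternatizeUncurryFin_fderiv_homotopyIntegrand {t : ℝ} {z : E}
    (hΦ : DifferentiableAt ℝ Φ (z₀ + t • (z - z₀))) :
    ContinuousAlternatingMap.alternatizeUncurryFin
        (fderiv ℝ (fun x => t ^ n • (Φ (z₀ + t • (x - z₀))).curryLeft (x - z₀)) z) =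
      (t ^ (n + 1) • fderiv ℝ Φ (z₀ + t • (z - z₀)) (z - z₀) +
        ((n + 1 : ℕ) * t ^ n) • Φ (z₀ + t • (z - z₀))) -
      t ^ (n + 1) • (extDeriv Φ (z₀ + t • (z - z₀))).curryLeft (z - z₀) := by
  have hinner : HasFDerivAt (fun x : E => z₀ + t • (x - z₀))
      (t • ContinuousLinearMap.id ℝ E) z :=
    (((hasFDerivAt_id z).sub_const z₀).const_smul t).const_add z₀
  have h2 : HasFDerivAt (fun x => (Φ (z₀ + t • (x - z₀))).curryLeft)
      (curryLeftL E F n ∘L (fderiv ℝ Φ (z₀ + t • (z - z₀)) ∘L (t • ContinuousLinearMap.id ℝ E))) z :=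
    HasFDerivAt.comp (g := fun f : E [⋀^Fin (n + 1)]→L[ℝ] F => f.curryLeft)
      (f := fun x => Φ (z₀ + t • (x - z₀))) z (hasFDerivAt_curryLeft _)
      (HasFDerivAt.comp (f := fun x : E => z₀ + t • (x - z₀)) z (hΦ.hasFDerivAt) hinner)
  have h3 := (h2.clm_apply ((hasFDerivAt_id z).sub_const z₀)).const_smul (t ^ n)
  rw [show fderiv ℝ (fun x => t ^ n • (Φ (z₀ + t • (x - z₀))).curryLeft (x - z₀)) z = _ from
    h3.fderiv]
  ext v
  -- These terms come from differentiating the inserted vector x - z₀. Moving `v i` back to its slot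
  -- absorbs the sign, so all n + 1 of them equal Φ v and produce the factor n + 1.
  have hsum : ∀ i : Fin (n + 1), (-1 : ℤ) ^ (i : ℕ) •
      (Φ (z₀ + t • (z - z₀))) (Matrix.vecCons (v i) (i.removeNth v)) =
      Φ (z₀ + t • (z - z₀)) v := by
    intro i
    rw [← ContinuousAlternatingMap.map_insertNth, Fin.insertNth_self_removeNth]
  have hext : extDeriv Φ (z₀ + t • (z - z₀)) (Matrix.vecCons (z - z₀) v) =
      fderiv ℝ Φ (z₀ + t • (z - z₀)) (z - z₀) v -
        ∑ i : Fin (n + 1), (-1 : ℤ) ^ (i : ℕ) •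
          fderiv ℝ Φ (z₀ + t • (z - z₀)) (v i) (Matrix.vecCons (z - z₀) (i.removeNth v)) := by
    rw [extDeriv, ContinuousAlternatingMap.alternatizeUncurryFin_apply, Fin.sum_univ_succ]
    have : ∀ i : Fin (n + 1), Fin.removeNth (α := fun _ => E) i.succ (Matrix.vecCons (z - z₀) v) =
        Matrix.vecCons (z - z₀) (i.removeNth v) := fun i => by
      cases n with
      | zero =>
        ext j
        fin_cases j
        fin_cases i
        rfl
      | succ n =>
        ext j
        refine Fin.cases ?_ (fun j => ?_) j
        · simp [Fin.removeNth]
        · simp [Fin.removeNth]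
    simp only [this]
    simp [pow_succ, sub_eq_add_neg, Fin.removeNth_zero]
  simp only [ContinuousAlternatingMap.alternatizeUncurryFin_apply, ContinuousAlternatingMap.sub_apply,
    ContinuousAlternatingMap.add_apply, ContinuousAlternatingMap.smul_apply,
    ContinuousAlternatingMap.curryLeft_apply_apply, hext]
  simp only [id_eq]
  generalize z - z₀ = w at *
  simp [smul_comm _ (t ^ n), Finset.sum_add_distrib, ← Finset.smul_sum, hsum]
  simp only [smul_comm _ t, ← Finset.smul_sum]
  module

theorem ContinuousOn.curryLeft_alternatizeUncurryFin {s : Set ℝ} {z : E}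
    {D : ℝ → E →L[ℝ] E [⋀^Fin n]→L[ℝ] F} (hD : ContinuousOn D s) : ContinuousOn
      (fun t => (ContinuousAlternatingMap.alternatizeUncurryFin (D t)).curryLeft z) s := by
  have h1 : ContinuousOn (fun t => ContinuousAlternatingMap.alternatizeUncurryFin (D t)) s :=
    (ContinuousAlternatingMap.alternatizeUncurryFinCLM ℝ E F).continuous.comp_continuousOn hD
  have h2 := (contDiff_curryLeft (E := E) (F := F) (n := n) (k := 0)).continuous.comp_continuousOn h1
  exact h2.clm_apply continuousOn_const

theorem intervalIntegrable_pow_smul_add_smul {G : Type*} [NormedAddCommGroup G] [NormedSpace ℝ G]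
    {a b : ℝ → G} {r s c : ℝ} {k l : ℕ} (ha : ContinuousOn a (uIcc r s))
    (hb : ContinuousOn b (uIcc r s)) :
    IntervalIntegrable (fun t => t ^ k • a t + (c * t ^ l) • b t) volume r s := by
  refine ContinuousOn.intervalIntegrable ?_
  have h1 : ContinuousOn (fun t : ℝ => t ^ k) (uIcc r s) := by fun_prop
  have h2 : ContinuousOn (fun t : ℝ => c * t ^ l) (uIcc r s) := by fun_prop
  exact (h1.smul ha).add (h2.smul hb)

/-- Differentiate under the integral and apply the pointwise Cartan formula. The derivative in t
integrates to the boundary values of t^(n+1) Φ(z₀ + t(z - z₀)), of which only the value at t = 1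
survives. -/
theorem extDeriv_homotopyOperator [ProperSpace E] [CompleteSpace F] (hW : IsOpen W)
    (hc : Convex ℝ W) (hz₀ : z₀ ∈ W) (hΦ : ContDiffOn ℝ ∞ Φ W) {z : E} (hz : z ∈ W) :
    extDeriv (homotopyOperator z₀ Φ) z = Φ z - ∫ t in (0 : ℝ)..1,
      t ^ (n + 1) • (extDeriv Φ (z₀ + t • (z - z₀))).curryLeft (z - z₀) := by
  set O := {p : ℝ × E | z₀ + p.1 • (p.2 - z₀) ∈ W} with hOdef
  have hO : IsOpen O :=
    hW.preimage (f := fun p : ℝ × E => z₀ + p.1 • (p.2 - z₀)) (by fun_prop)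
  have hmem : ∀ t ∈ Icc (0 : ℝ) 1, (t, z) ∈ O := fun t ht => hc.segment_point_mem hz₀ hz ht
  set g : ℝ × E → E [⋀^Fin n]→L[ℝ] F :=
    fun p => p.1 ^ n • (Φ (z₀ + p.1 • (p.2 - z₀))).curryLeft (p.2 - z₀) with hg
  have hgs : ContDiffOn ℝ ∞ g O := contDiffOn_homotopyIntegrand hΦ
  have hdΦ : ∀ t ∈ Icc (0 : ℝ) 1, HasFDerivAt Φ (fderiv ℝ Φ (z₀ + t • (z - z₀)))
      (z₀ + t • (z - z₀)) := fun t ht =>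
    ((hΦ.contDiffAt (hW.mem_nhds (hmem t ht))).differentiableAt (by simp)).hasFDerivAt
  have hderiv := ContDiffOn.hasFDerivAt_parametric_integral hO (hgs.of_le (by simp)) hmem
  have hcontΦ : ContinuousOn (fun t : ℝ => Φ (z₀ + t • (z - z₀))) (uIcc 0 1) := by
    rw [uIcc_of_le zero_le_one]
    exact hΦ.continuousOn.comp (by fun_prop) hmem
  have hcontdΦ : ContinuousOn (fun t : ℝ => fderiv ℝ Φ (z₀ + t • (z - z₀))) (uIcc 0 1) := by
    rw [uIcc_of_le zero_le_one]
    exact (hΦ.continuousOn_fderiv_of_isOpen hW (by simp)).comp (by fun_prop) hmem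
  have hcontext : ContinuousOn
      (fun t : ℝ => (extDeriv Φ (z₀ + t • (z - z₀))).curryLeft (z - z₀)) (uIcc 0 1) :=
    hcontdΦ.curryLeft_alternatizeUncurryFin
  have hpow : ∀ k : ℕ, ContinuousOn (fun t : ℝ => t ^ k) (uIcc 0 1) := fun k => by fun_prop
  have hint2 : IntervalIntegrable (fun t => t ^ (n + 1) •
      (extDeriv Φ (z₀ + t • (z - z₀))).curryLeft (z - z₀)) volume 0 1 :=
    ((hpow (n + 1)).smul hcontext).intervalIntegrable
  have hd0 : ContinuousOn (fun t : ℝ => fderiv ℝ Φ (z₀ + t • (z - z₀)) (z - z₀)) (uIcc 0 1) :=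
    hcontdΦ.clm_apply continuousOn_const
  have hint1 : IntervalIntegrable (fun t => t ^ (n + 1) • fderiv ℝ Φ (z₀ + t • (z - z₀)) (z - z₀) +
      ((n + 1 : ℕ) * t ^ n) • Φ (z₀ + t • (z - z₀))) volume 0 1 :=
    intervalIntegrable_pow_smul_add_smul hd0 hcontΦ
  have hpoint : ∀ t ∈ Icc (0 : ℝ) 1,
      ContinuousAlternatingMap.alternatizeUncurryFin
        (fderiv ℝ g (t, z) ∘L ContinuousLinearMap.inr ℝ ℝ E) =
      (t ^ (n + 1) • fderiv ℝ Φ (z₀ + t • (z - z₀)) (z - z₀) +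
        ((n + 1 : ℕ) * t ^ n) • Φ (z₀ + t • (z - z₀))) -
      t ^ (n + 1) • (extDeriv Φ (z₀ + t • (z - z₀))).curryLeft (z - z₀) := by
    intro t ht
    have hd : DifferentiableAt ℝ g (t, z) :=
      (hgs.contDiffAt (hO.mem_nhds (hmem t ht))).differentiableAt (by simp)
    rw [← alternatizeUncurryFin_fderiv_homotopyIntegrand (hdΦ t ht).differentiableAt]
    congr 1
    exact (hd.hasFDerivAt.comp z (hasFDerivAt_prodMk_right t z)).fderiv.symm
  rw [extDeriv, show fderiv ℝ (homotopyOperator z₀ Φ) z = _ from hderiv.fderiv,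
    alternatizeUncurryFin_intervalIntegral]
  · rw [integral_congr (g := fun t => (t ^ (n + 1) • fderiv ℝ Φ (z₀ + t • (z - z₀)) (z - z₀) +
        ((n + 1 : ℕ) * t ^ n) • Φ (z₀ + t • (z - z₀))) -
      t ^ (n + 1) • (extDeriv Φ (z₀ + t • (z - z₀))).curryLeft (z - z₀)), intervalIntegral.integral_sub]
    · congr 1
      have := intervalIntegral.integral_eq_sub_of_hasDerivAt (a := 0) (b := 1)
        (f := fun t : ℝ => t ^ (n + 1) • Φ (z₀ + t • (z - z₀)))
        (f' := fun t => t ^ (n + 1) • fderiv ℝ Φ (z₀ + t • (z - z₀)) (z - z₀) +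
          ((n + 1 : ℕ) * t ^ n) • Φ (z₀ + t • (z - z₀))) ?_ ?_
      · rw [this]; simp
      · intro t ht
        rw [uIcc_of_le zero_le_one] at ht
        have hl : HasDerivAt (fun t : ℝ => z₀ + t • (z - z₀)) (z - z₀) t := by
          simpa using ((hasDerivAt_id t).smul_const (z - z₀)).const_add z₀
        exact (hasDerivAt_pow (n + 1) t).smul ((hdΦ t ht).comp_hasDerivAt t hl)
      · exact hint1
    · exact hint1
    · exact hint2
    · intro t ht
      rw [uIcc_of_le zero_le_one] at ht
      exact hpoint t ht
  · refine ContinuousOn.intervalIntegrable ?_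
    rw [uIcc_of_le zero_le_one]
    exact ((hgs.continuousOn_fderiv_of_isOpen hO (by simp)).comp
      (f := fun t => (t, z)) (by fun_prop) hmem).clm_comp continuousOn_const

/-- A Poincaré lemma for a single tuple of vectors: dΦ has to vanish only after insertion of the
fixed vectors z - z₀ and `v`. This fits the application, where the tuples consist of a coordinate
vector and two total derivatives. -/
theorem extDeriv_homotopyOperator_apply [ProperSpace E] [CompleteSpace F] (hW : IsOpen W)
    (hc : Convex ℝ W) (hz₀ : z₀ ∈ W) (hΦ : ContDiffOn ℝ ∞ Φ W) {z : E} (hz : z ∈ W)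
    {v : Fin (n + 1) → E}
    (hv : ∀ w ∈ W, extDeriv Φ w (Matrix.vecCons (z - z₀) v) = 0) :
    extDeriv (homotopyOperator z₀ Φ) z v = Φ z v := by
  have hcont : ContinuousOn (fun t : ℝ => t ^ (n + 1) •
      (extDeriv Φ (z₀ + t • (z - z₀))).curryLeft (z - z₀)) (uIcc 0 1) := by
    have hpow : ContinuousOn (fun t : ℝ => t ^ (n + 1)) (uIcc 0 1) := by fun_prop
    refine hpow.smul (ContinuousOn.curryLeft_alternatizeUncurryFin ?_)
    rw [uIcc_of_le zero_le_one]
    exact (hΦ.continuousOn_fderiv_of_isOpen hW (by simp)).comp (by fun_prop)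
      fun t ht => hc.segment_point_mem hz₀ hz ht
  have happ := (ContinuousAlternatingMap.apply ℝ E F v).intervalIntegral_comp_comm
    (hcont.intervalIntegrable (μ := volume))
  rw [extDeriv_homotopyOperator hW hc hz₀ hΦ hz, ContinuousAlternatingMap.sub_apply,
    sub_eq_self]
  refine happ.symm.trans ?_
  rw [← integral_zero (E := F) (μ := volume) (a := (0 : ℝ)) (b := 1)]
  refine integral_congr fun t ht => ?_
  rw [uIcc_of_le zero_le_one] at ht
  simp only [ContinuousAlternatingMap.apply_apply, ContinuousAlternatingMap.smul_apply,
    ContinuousAlternatingMap.curryLeft_apply_apply, hv _ (hc.segment_point_mem hz₀ hz ht),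
    smul_zero]

end Homotopy

/-! ### Exterior products of covectors -/

namespace FGordon

section Wedge

variable {E X : Type*} [NormedAddCommGroup E] [NormedSpace ℝ E]
  [NormedAddCommGroup X] [NormedSpace ℝ X] {n : ℕ}

/-- The exterior product of `n` covectors. -/
def wedgeProd (a : Fin n → E →L[ℝ] ℝ) : E [⋀^Fin n]→L[ℝ] ℝ :=
  ContinuousMultilinearMap.alternatization
    ((ContinuousMultilinearMap.mkPiAlgebra ℝ (Fin n) ℝ).compContinuousLinearMap a)

theorem wedge3_eq_wedgeProd (a b c : E →L[ℝ] ℝ) : wedge3 a b c = wedgeProd ![a, b, c] := rfl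

theorem wedgeProd_apply (a : Fin n → E →L[ℝ] ℝ) (v : Fin n → E) :
    wedgeProd a v = (Matrix.of fun i j => a j (v i)).det := by
  rw [wedgeProd, ContinuousMultilinearMap.alternatization_apply_apply, Matrix.det_apply]
  simp

theorem wedge3_apply (a b c : E →L[ℝ] ℝ) (v : Fin 3 → E) :
    wedge3 a b c v = a (v 0) * (b (v 1) * c (v 2) - b (v 2) * c (v 1)) -
      a (v 1) * (b (v 0) * c (v 2) - b (v 2) * c (v 0)) +
      a (v 2) * (b (v 0) * c (v 1) - b (v 1) * c (v 0)) := by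
  rw [wedge3_eq_wedgeProd, wedgeProd_apply, Matrix.det_fin_three]
  simp
  ring

theorem wedgeProd_two_apply (a b : E →L[ℝ] ℝ) (v : Fin 2 → E) :
    wedgeProd ![a, b] v = a (v 0) * b (v 1) - a (v 1) * b (v 0) := by
  rw [wedgeProd_apply, Matrix.det_fin_two]
  simp
  ring

variable (E n) in
/-- Alternatization of multilinear forms as a continuous linear map. -/
def alternatizationL :
    ContinuousMultilinearMap ℝ (fun _ : Fin n => E) ℝ →L[ℝ] E [⋀^Fin n]→L[ℝ] ℝ :=
  LinearMap.mkContinuous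
    { toFun := fun f => ContinuousMultilinearMap.alternatization f
      map_add' := fun f g => map_add _ f g
      map_smul' := fun c f => by
        ext v
        simp [ContinuousMultilinearMap.alternatization_apply_apply, Finset.mul_sum,
          mul_left_comm, Units.smul_def] }
    (Fintype.card (Equiv.Perm (Fin n))) fun f => by
      refine ContinuousAlternatingMap.opNorm_le_bound _ (by positivity) fun v => ?_
      simp only [LinearMap.coe_mk, AddHom.coe_mk,
        ContinuousMultilinearMap.alternatization_apply_apply]
      refine (norm_sum_le _ _).trans ?_
      rw [← Finset.card_univ, mul_assoc, ← nsmul_eq_mul]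
      refine Finset.sum_le_card_nsmul _ _ _ fun σ _ => ?_
      rw [norm_units_zsmul]
      refine (f.le_opNorm _).trans_eq ?_
      congr 1
      exact Equiv.prod_comp σ fun i => ‖v i‖

/-- The product of covectors is continuous multilinear in the covectors, and alternatization is
continuous linear. -/
theorem contDiff_wedgeProd {k : WithTop ℕ∞} :
    ContDiff ℝ k (wedgeProd : (Fin n → E →L[ℝ] ℝ) → E [⋀^Fin n]→L[ℝ] ℝ) := by
  have h1 : ContDiff ℝ k (fun a : Fin n → E →L[ℝ] ℝ =>
      (ContinuousMultilinearMap.mkPiAlgebra ℝ (Fin n) ℝ).compContinuousLinearMap a) :=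
    ((ContinuousLinearMap.apply ℝ _ (ContinuousMultilinearMap.mkPiAlgebra ℝ (Fin n)
      ℝ)).contDiff).comp (ContinuousMultilinearMap.contDiff
      (ContinuousMultilinearMap.compContinuousLinearMapContinuousMultilinear ℝ
      (fun _ : Fin n => E) (fun _ : Fin n => ℝ) ℝ))
  exact (alternatizationL E n).contDiff.comp h1

theorem ContDiffOn.wedge3 {k : WithTop ℕ∞} {a b c : X → E →L[ℝ] ℝ} {s : Set X}
    (ha : ContDiffOn ℝ k a s) (hb : ContDiffOn ℝ k b s) (hc : ContDiffOn ℝ k c s) :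
    ContDiffOn ℝ k (fun x => wedge3 (a x) (b x) (c x)) s := by
  refine contDiff_wedgeProd.comp_contDiffOn (f := fun x => ![a x, b x, c x]) ?_
  rw [contDiffOn_pi]
  intro i
  fin_cases i
  exacts [ha, hb, hc]

theorem ContDiffOn.wedge2 {k : WithTop ℕ∞} {a b : X → E →L[ℝ] ℝ} {s : Set X}
    (ha : ContDiffOn ℝ k a s) (hb : ContDiffOn ℝ k b s) :
    ContDiffOn ℝ k (fun x => wedgeProd ![a x, b x]) s := by
  refine contDiff_wedgeProd.comp_contDiffOn (f := fun x => ![a x, b x]) ?_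
  rw [contDiffOn_pi]
  intro i
  fin_cases i
  exacts [ha, hb]

theorem extDeriv_two_apply {η : E → E [⋀^Fin 2]→L[ℝ] ℝ} {q : E} (h : DifferentiableAt ℝ η q)
    (u v w : E) : extDeriv η q ![u, v, w] =
      fderiv ℝ (fun q => η q ![v, w]) q u - fderiv ℝ (fun q => η q ![u, w]) q v +
        fderiv ℝ (fun q => η q ![u, v]) q w := by
  rw [extDeriv_apply h, Fin.sum_univ_three]
  have h0 : Fin.removeNth (α := fun _ => E) 0 ![u, v, w] = ![v, w] := by
    ext i; fin_cases i <;> rfl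
  have h1 : Fin.removeNth (α := fun _ => E) 1 ![u, v, w] = ![u, w] := by
    ext i; fin_cases i <;> rfl
  have h2 : Fin.removeNth (α := fun _ => E) 2 ![u, v, w] = ![u, v] := by
    ext i; fin_cases i <;> rfl
  rw [h0, h1, h2]
  simp [sub_eq_add_neg]

theorem extDeriv_three_apply {η : E → E [⋀^Fin 3]→L[ℝ] ℝ} {q : E} (h : DifferentiableAt ℝ η q)
    (u v w z : E) : extDeriv η q ![u, v, w, z] =
      fderiv ℝ (fun q => η q ![v, w, z]) q u - fderiv ℝ (fun q => η q ![u, w, z]) q v +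
        fderiv ℝ (fun q => η q ![u, v, z]) q w - fderiv ℝ (fun q => η q ![u, v, w]) q z := by
  rw [extDeriv_apply h, Fin.sum_univ_four]
  have h0 : Fin.removeNth (α := fun _ => E) 0 ![u, v, w, z] = ![v, w, z] := by
    ext i; fin_cases i <;> rfl
  have h1 : Fin.removeNth (α := fun _ => E) 1 ![u, v, w, z] = ![u, w, z] := by
    ext i; fin_cases i <;> rfl
  have h2 : Fin.removeNth (α := fun _ => E) 2 ![u, v, w, z] = ![u, v, z] := by
    ext i; fin_cases i <;> rfl
  have h3 : Fin.removeNth (α := fun _ => E) 3 ![u, v, w, z] = ![u, v, w] := by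
    ext i; fin_cases i <;> rfl
  rw [h0, h1, h2, h3]
  simp [sub_eq_add_neg, pow_succ]

end Wedge

end FGordon

/-! ### Jets over an open set and derivatives of the right-hand side -/

namespace FGordon

open Filter Topology

variable {m : ℕ}

theorem isOpen_over1 {W : Set (J0 m)} (hW : IsOpen W) : IsOpen (over1 W) :=
  hW.preimage continuous_fst

theorem isOpen_overEq {W : Set (J0 m)} (hW : IsOpen W) (n : ℕ) : IsOpen (overEq n W) :=
  hW.preimage continuous_fst

theorem ContDiffOn.differentiableAt_of_isOpen {E F : Type*} [NormedAddCommGroup E] [NormedSpace ℝ E]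
    [NormedAddCommGroup F] [NormedSpace ℝ F] {g : E → F} {s : Set E} (hg : ContDiffOn ℝ ∞ g s)
    (hs : IsOpen s) {x : E} (hx : x ∈ s) : DifferentiableAt ℝ g x :=
  (hg.contDiffAt (hs.mem_nhds hx)).differentiableAt (by simp)

theorem ContDiffOn.fderiv_apply {E F : Type*} [NormedAddCommGroup E] [NormedSpace ℝ E]
    [NormedAddCommGroup F] [NormedSpace ℝ F] {g : E → F} {s : Set E} (hg : ContDiffOn ℝ ∞ g s)
    (hs : IsOpen s) {v : E → E} (hv : ContDiffOn ℝ ∞ v s) :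
    ContDiffOn ℝ ∞ (fun x => fderiv ℝ g x (v x)) s :=
  (hg.fderiv_of_isOpen hs (by simp)).clm_apply hv

theorem ContDiffOn.pd {g : J1 m → ℝ} {s : Set (J1 m)} (hg : ContDiffOn ℝ ∞ g s)
    (hs : IsOpen s) (e : J1 m) : ContDiffOn ℝ ∞ (pd e g) s :=
  ContDiffOn.fderiv_apply hg hs contDiffOn_const

theorem eventuallyEq_of_eqOn_open {E F : Type*} [TopologicalSpace E] {g h : E → F} {s : Set E}
    (hs : IsOpen s) (hgh : Set.EqOn g h s) {x : E} (hx : x ∈ s) : g =ᶠ[𝓝 x] h :=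
  hgh.eventuallyEq_of_mem (hs.mem_nhds hx)

theorem fderiv_eq_of_eqOn_open {E F : Type*} [NormedAddCommGroup E] [NormedSpace ℝ E]
    [NormedAddCommGroup F] [NormedSpace ℝ F] {g h : E → F} {s : Set E}
    (hs : IsOpen s) (hgh : Set.EqOn g h s) {x : E} (hx : x ∈ s) : fderiv ℝ g x = fderiv ℝ h x :=
  (eventuallyEq_of_eqOn_open hs hgh hx).fderiv_eq

/-- Second derivatives along constant vectors commute. -/
theorem fderiv_fderiv_comm {E : Type*} [NormedAddCommGroup E] [NormedSpace ℝ E] {g : E → ℝ}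
    {s : Set E} (hg : ContDiffOn ℝ ∞ g s) (hs : IsOpen s) {x : E} (hx : x ∈ s) (v w : E) :
    fderiv ℝ (fun y => fderiv ℝ g y v) x w = fderiv ℝ (fun y => fderiv ℝ g y w) x v := by
  have hc := hg.contDiffAt (hs.mem_nhds hx)
  have hd : DifferentiableAt ℝ (fderiv ℝ g) x :=
    (hg.fderiv_of_isOpen hs (m := ∞) (by simp)).contDiffAt (hs.mem_nhds hx) |>.differentiableAt
      (by simp)
  rw [fderiv_clm_apply hd (by fun_prop), fderiv_clm_apply hd (by fun_prop)]
  simpa using (hc.isSymmSndFDerivAt (by simp; exact WithTop.coe_le_coe.2 le_top)).eq w v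

/-- This reduces derivatives of f and of its partials in fibre directions to one-variable
polynomials: on a line in a fibre the coefficients of the system are constant. -/
theorem fderiv_apply_of_hasDerivAt {E : Type*} [NormedAddCommGroup E] [NormedSpace ℝ E] {g : E → ℝ}
    {x v : E} {d : ℝ} (hg : DifferentiableAt ℝ g x)
    (h : HasDerivAt (fun t : ℝ => g (x + t • v)) d 0) : fderiv ℝ g x v = d := by
  have h1 : HasLineDerivAt ℝ g d x v := h
  rw [← hg.lineDeriv_eq_fderiv, h1.lineDeriv]

/-- The derivative of a function of a first jet with the fibre variables frozen. -/
theorem fderiv_base_slice {F : Type*} [NormedAddCommGroup F] [NormedSpace ℝ F] {g : J1 m → F}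
    {j : J1 m} (hg : DifferentiableAt ℝ g j) (v : J0 m) :
    fderiv ℝ (fun z => g (z, j.2)) j.1 v = fderiv ℝ g j (v, 0) := by
  have h := HasFDerivAt.comp (g := g) (f := fun z => (z, j.2)) j.1 hg.hasFDerivAt
    (hasFDerivAt_prodMk_left j.1 j.2)
  rw [show (fun z => g (z, j.2)) = g ∘ fun z => (z, j.2) from rfl, h.fderiv]
  simp

theorem sum_mul_single {m : ℕ} (a : Fin m → ℝ) (β : Fin m) :
    ∑ ν, a ν * (Pi.single β (1 : ℝ) : Fin m → ℝ) ν = a β := by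
  simp [Pi.single_apply]

namespace System

variable (s : System m)

/-- The partial derivative `∂f^α/∂u^β_x`. -/
def fUx (α β : Fin m) (j : J1 m) : ℝ := -((∑ ν, s.C α β ν j.1 * j.2.2 ν) + s.A α β j.1)

/-- The partial derivative `∂f^α/∂u^β_y`. -/
def fUy (α β : Fin m) (j : J1 m) : ℝ := -((∑ ν, s.C α ν β j.1 * j.2.1 ν) + s.B α β j.1)

variable {s} {W : Set (J0 m)}

theorem SmoothOn.mono (hs : s.SmoothOn W) {V : Set (J0 m)} (h : V ⊆ W) : s.SmoothOn V :=
  ⟨fun _ _ _ => (hs.1 _ _ _).mono h, fun _ _ => (hs.2.1 _ _).mono h,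
    fun _ _ => (hs.2.2.1 _ _).mono h, fun _ => (hs.2.2.2 _).mono h⟩

theorem contDiffOn_comp_fst {g : J0 m → ℝ} (hg : ContDiffOn ℝ ∞ g W) :
    ContDiffOn ℝ ∞ (fun j : J1 m => g j.1) (over1 W) :=
  hg.comp contDiffOn_fst fun _ h => h

theorem SmoothOn.f (hs : s.SmoothOn W) (α : Fin m) : ContDiffOn ℝ ∞ (s.f α) (over1 W) := by
  have hp : ∀ β, ContDiffOn ℝ ∞ (fun j : J1 m => j.2.1 β) (over1 W) := fun β => by fun_prop
  have hq : ∀ β, ContDiffOn ℝ ∞ (fun j : J1 m => j.2.2 β) (over1 W) := fun β => by fun_prop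
  refine ContDiffOn.neg (((ContDiffOn.add ?_ ?_).add ?_).add (contDiffOn_comp_fst (hs.2.2.2 α)))
  · exact ContDiffOn.sum fun β _ => ContDiffOn.sum fun γ _ =>
      ((contDiffOn_comp_fst (hs.1 α β γ)).mul (hp β)).mul (hq γ)
  · exact ContDiffOn.sum fun β _ => (contDiffOn_comp_fst (hs.2.1 α β)).mul (hp β)
  · exact ContDiffOn.sum fun β _ => (contDiffOn_comp_fst (hs.2.2.1 α β)).mul (hq β)

theorem SmoothOn.fUx (hs : s.SmoothOn W) (α β : Fin m) :
    ContDiffOn ℝ ∞ (s.fUx α β) (over1 W) := by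
  have hq : ∀ β, ContDiffOn ℝ ∞ (fun j : J1 m => j.2.2 β) (over1 W) := fun β => by fun_prop
  exact ContDiffOn.neg ((ContDiffOn.sum fun ν _ => (contDiffOn_comp_fst (hs.1 α β ν)).mul
    (hq ν)).add (contDiffOn_comp_fst (hs.2.1 α β)))

theorem SmoothOn.fUy (hs : s.SmoothOn W) (α β : Fin m) :
    ContDiffOn ℝ ∞ (s.fUy α β) (over1 W) := by
  have hp : ∀ β, ContDiffOn ℝ ∞ (fun j : J1 m => j.2.1 β) (over1 W) := fun β => by fun_prop
  exact ContDiffOn.neg ((ContDiffOn.sum fun ν _ => (contDiffOn_comp_fst (hs.1 α ν β)).mul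
    (hp ν)).add (contDiffOn_comp_fst (hs.2.2.1 α β)))

theorem hasDerivAt_add_mul_const (a b : ℝ) : HasDerivAt (fun t : ℝ => a + t * b) b 0 := by
  simpa using ((hasDerivAt_id (0 : ℝ)).mul_const b).const_add a

theorem fderiv_f_vertical (hs : s.SmoothOn W) (hW : IsOpen W) {j : J1 m} (hj : j ∈ over1 W)
    (α : Fin m) (a b : Fin m → ℝ) :
    fderiv ℝ (s.f α) j (0, a, b) = (∑ β, s.fUx α β j * a β) + ∑ γ, s.fUy α γ j * b γ := by
  refine fderiv_apply_of_hasDerivAt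
    (ContDiffOn.differentiableAt_of_isOpen (hs.f α) (isOpen_over1 hW) hj) ?_
  have h1 : ∀ β, HasDerivAt (fun t : ℝ => j.2.1 β + t * a β) (a β) 0 := fun β =>
    hasDerivAt_add_mul_const _ _
  have h2 : ∀ β, HasDerivAt (fun t : ℝ => j.2.2 β + t * b β) (b β) 0 := fun β =>
    hasDerivAt_add_mul_const _ _
  have h3 := ((((HasDerivAt.fun_sum (u := Finset.univ) fun β _ => HasDerivAt.fun_sum
    (u := Finset.univ) fun γ _ => (((h1 β).const_mul (s.C α β γ j.1)).mul (h2 γ))).add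
    (HasDerivAt.fun_sum (u := Finset.univ) fun γ _ => (h1 γ).const_mul (s.A α γ j.1))).add
    (HasDerivAt.fun_sum (u := Finset.univ) fun γ _ => (h2 γ).const_mul (s.B α γ j.1))).add
    (hasDerivAt_const (0 : ℝ) (s.E α j.1))).neg
  refine (h3.congr_deriv ?_).congr_of_eventuallyEq (Eventually.of_forall fun t => ?_)
  swap
  · simp [System.f]
  · simp only [System.fUx, System.fUy, zero_mul, add_zero, Finset.sum_add_distrib, neg_mul, add_mul,
      Finset.sum_mul, Finset.sum_neg_distrib]
    rw [Finset.sum_comm (f := fun x i => s.C α i x j.1 * j.2.1 i * b x)]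
    have : ∀ x i, s.C α x i j.1 * j.2.2 i * a x = s.C α x i j.1 * a x * j.2.2 i := fun x i => by
      ring
    simp only [this]
    ring

theorem pd_eUx_f (hs : s.SmoothOn W) (hW : IsOpen W) (α β : Fin m) :
    Set.EqOn (pd (eUx β) (s.f α)) (s.fUx α β) (over1 W) := fun j hj => by
  rw [pd, eUx, fderiv_f_vertical hs hW hj]
  simp [sum_mul_single]

theorem pd_eUy_f (hs : s.SmoothOn W) (hW : IsOpen W) (α β : Fin m) :
    Set.EqOn (pd (eUy β) (s.f α)) (s.fUy α β) (over1 W) := fun j hj => by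
  rw [pd, eUy, fderiv_f_vertical hs hW hj]
  simp [sum_mul_single]

theorem fderiv_fUx_vertical (hs : s.SmoothOn W) (hW : IsOpen W) {j : J1 m} (hj : j ∈ over1 W)
    (α β : Fin m) (a b : Fin m → ℝ) :
    fderiv ℝ (s.fUx α β) j (0, a, b) = -∑ ν, s.C α β ν j.1 * b ν := by
  refine fderiv_apply_of_hasDerivAt
    (ContDiffOn.differentiableAt_of_isOpen (hs.fUx α β) (isOpen_over1 hW) hj) ?_
  have h := ((HasDerivAt.fun_sum (u := Finset.univ) fun γ _ =>
    (hasDerivAt_add_mul_const (j.2.2 γ) (b γ)).const_mul (s.C α β γ j.1)).add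
    (hasDerivAt_const (0 : ℝ) (s.A α β j.1))).neg
  refine (h.congr_deriv ?_).congr_of_eventuallyEq (Eventually.of_forall fun t => ?_)
  swap
  · simp [System.fUx]
  · simp

theorem fderiv_fUy_vertical (hs : s.SmoothOn W) (hW : IsOpen W) {j : J1 m} (hj : j ∈ over1 W)
    (α β : Fin m) (a b : Fin m → ℝ) :
    fderiv ℝ (s.fUy α β) j (0, a, b) = -∑ ν, s.C α ν β j.1 * a ν := by
  refine fderiv_apply_of_hasDerivAt
    (ContDiffOn.differentiableAt_of_isOpen (hs.fUy α β) (isOpen_over1 hW) hj) ?_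
  have h := ((HasDerivAt.fun_sum (u := Finset.univ) fun γ _ =>
    (hasDerivAt_add_mul_const (j.2.1 γ) (a γ)).const_mul (s.C α γ β j.1)).add
    (hasDerivAt_const (0 : ℝ) (s.B α β j.1))).neg
  refine (h.congr_deriv ?_).congr_of_eventuallyEq (Eventually.of_forall fun t => ?_)
  swap
  · simp [System.fUy]
  · simp

theorem S_eq (hs : s.SmoothOn W) (hW : IsOpen W) {j : J1 m} (hj : j ∈ over1 W) (γ α β : Fin m) :
    s.S γ α β j = s.C γ α β j.1 - s.C γ β α j.1 := by
  have hO := isOpen_over1 hW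
  rw [S, pd, pd, fderiv_eq_of_eqOn_open hO (pd_eUy_f hs hW γ α) hj,
    fderiv_eq_of_eqOn_open hO (pd_eUy_f hs hW γ β) hj, eUx, eUx, fderiv_fUy_vertical hs hW hj,
    fderiv_fUy_vertical hs hW hj, sum_mul_single, sum_mul_single]
  ring

/-- Since f is affine in u_x, its derivative in u_x no longer contains u_x. Hence u_xx drops out of
the total derivative, and u_xy enters only through C. -/
theorem H_eq (hs : s.SmoothOn W) (hW : IsOpen W) {j : J1 m} (hj : j ∈ over1 W) (γ α : Fin m)
    (uxx : Fin m → ℝ) :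
    s.H γ α j uxx = pd (eU α) (s.f γ) j + (∑ σ, s.fUy γ σ j * s.fUx σ α j) -
      (fderiv ℝ (s.fUx γ α) j ((1, 0, j.2.1), 0) - ∑ ν, s.C γ α ν j.1 * s.f ν j) := by
  rw [H, Dx, fderiv_eq_of_eqOn_open (isOpen_over1 hW) (pd_eUx_f hs hW γ α) hj]
  have : (((1, 0, j.2.1), uxx, fun β => s.f β j) : J1 m) =
      ((1, 0, j.2.1), 0) + (0, uxx, fun β => s.f β j) := by simp
  rw [this, map_add, fderiv_fUx_vertical hs hW hj]
  simp only [pd_eUx_f hs hW _ _ hj, pd_eUy_f hs hW _ _ hj]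
  ring

theorem K_eq (hs : s.SmoothOn W) (hW : IsOpen W) {j : J1 m} (hj : j ∈ over1 W) (γ α : Fin m)
    (uyy : Fin m → ℝ) :
    s.K γ α j uyy = pd (eU α) (s.f γ) j + (∑ σ, s.fUx γ σ j * s.fUy σ α j) -
      (fderiv ℝ (s.fUy γ α) j ((0, 1, j.2.2), 0) - ∑ ν, s.C γ ν α j.1 * s.f ν j) := by
  rw [K, Dy, fderiv_eq_of_eqOn_open (isOpen_over1 hW) (pd_eUy_f hs hW γ α) hj]
  have : (((0, 1, j.2.2), (fun β => s.f β j), uyy) : J1 m) =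
      ((0, 1, j.2.2), 0) + (0, (fun β => s.f β j), uyy) := by simp
  rw [this, map_add, fderiv_fUy_vertical hs hW hj]
  simp only [pd_eUx_f hs hW _ _ hj, pd_eUy_f hs hW _ _ hj]
  ring

end System

end FGordon

/-! ### The compatibility conditions on a multiplier -/

namespace FGordon

namespace System

variable {m : ℕ} {s : System m} {W : Set (J0 m)} {N : J0 m → Matrix (Fin m) (Fin m) ℝ}

variable (s N) in
/-- The antisymmetrized Helmholtz expression
`D_x (N_{ασ} ∂f^σ/∂u^β_x) - D_y (N_{βσ} ∂f^σ/∂u^α_y) + N_{βσ} ∂f^σ/∂u^α - N_{ασ} ∂f^σ/∂u^β`,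
with `u_xy = f` in the total derivatives. -/
def helmholtz (α β : Fin m) (j : J1 m) : ℝ :=
  (∑ σ, (fderiv ℝ (fun z => N z α σ) j.1 (1, 0, j.2.1) * s.fUx σ β j +
      N j.1 α σ * (fderiv ℝ (s.fUx σ β) j ((1, 0, j.2.1), 0) - ∑ ν, s.C σ β ν j.1 * s.f ν j))) -
    (∑ σ, (fderiv ℝ (fun z => N z β σ) j.1 (0, 1, j.2.2) * s.fUy σ α j +
      N j.1 β σ * (fderiv ℝ (s.fUy σ α) j ((0, 1, j.2.2), 0) - ∑ ν, s.C σ ν α j.1 * s.f ν j))) +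
    (∑ σ, N j.1 β σ * pd (eU α) (s.f σ) j) - ∑ σ, N j.1 α σ * pd (eU β) (s.f σ) j

/-- Replace the total derivatives of N in the Helmholtz expression by the given formulas. Each of
the two sums then splits into the quadratic term belonging to H or K and the double sum of N_{στ}
(∂f^τ/∂u^α_y)(∂f^σ/∂u^β_x). By symmetry of N this double sum is the same in both, and it cancels. -/
theorem sum_H_sub_sum_K (hs : s.SmoothOn W) (hW : IsOpen W) {j : J1 m} (hj : j ∈ over1 W)
    (hsymm : (N j.1).IsSymm)
    (hx : ∀ α β, fderiv ℝ (fun z => N z α β) j.1 (1, 0, j.2.1) =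
      -((∑ σ, N j.1 α σ * s.fUy σ β j) + ∑ σ, N j.1 β σ * s.fUy σ α j))
    (hy : ∀ α β, fderiv ℝ (fun z => N z α β) j.1 (0, 1, j.2.2) =
      -((∑ σ, N j.1 α σ * s.fUx σ β j) + ∑ σ, N j.1 β σ * s.fUx σ α j))
    (α β : Fin m) (uxx uyy : Fin m → ℝ) :
    (∑ σ, N j.1 α σ * s.H σ β j uxx) - ∑ σ, N j.1 β σ * s.K σ α j uyy =
      -s.helmholtz N α β j := by
  have hxx : ∑ σ, fderiv ℝ (fun z => N z α σ) j.1 (1, 0, j.2.1) * s.fUx σ β j =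
      -((∑ σ, N j.1 α σ * ∑ τ, s.fUy σ τ j * s.fUx τ β j) +
        ∑ σ, ∑ τ, N j.1 σ τ * s.fUy τ α j * s.fUx σ β j) := by
    simp only [hx, neg_mul, add_mul, Finset.sum_neg_distrib, Finset.sum_add_distrib,
      Finset.sum_mul, Finset.mul_sum]
    rw [Finset.sum_comm (f := fun x i => N j.1 α i * s.fUy i x j * s.fUx x β j)]
    simp only [mul_assoc]
  have hyy : ∑ σ, fderiv ℝ (fun z => N z β σ) j.1 (0, 1, j.2.2) * s.fUy σ α j =
      -((∑ σ, N j.1 β σ * ∑ τ, s.fUx σ τ j * s.fUy τ α j) +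
        ∑ σ, ∑ τ, N j.1 σ τ * s.fUy τ α j * s.fUx σ β j) := by
    simp only [hy, neg_mul, add_mul, Finset.sum_neg_distrib, Finset.sum_add_distrib,
      Finset.sum_mul, Finset.mul_sum]
    rw [Finset.sum_comm (f := fun x i => N j.1 β i * s.fUx i x j * s.fUy x α j),
      Finset.sum_comm (f := fun x i => N j.1 x i * s.fUx i β j * s.fUy x α j)]
    simp only [mul_assoc]
    congr 3 with σ
    refine Finset.sum_congr rfl fun τ _ => ?_
    rw [hsymm.apply σ τ]
    ring
  simp only [helmholtz, H_eq hs hW hj, K_eq hs hW hj, Finset.sum_add_distrib, hxx, hyy, mul_sub,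
    mul_add, Finset.sum_sub_distrib]
  ring

end System

end FGordon

/-! ### Evaluation of the form `omega` on coordinate vectors -/

namespace FGordon

variable {m n : ℕ} {s : System m}

/-- The projection to first-order jets as a continuous linear map. -/
def toJ1L : EqJet m (n + 2) →L[ℝ] J1 m :=
  (ContinuousLinearMap.fst ℝ (J0 m) _).prod
    (((ContinuousLinearMap.proj (R := ℝ) (φ := fun _ : Fin (n + 2) => Fin m → ℝ) 0) ∘L
      ContinuousLinearMap.fst ℝ _ _ ∘L ContinuousLinearMap.snd ℝ (J0 m) _).prod
    ((ContinuousLinearMap.proj (R := ℝ) (φ := fun _ : Fin (n + 2) => Fin m → ℝ) 0) ∘L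
      ContinuousLinearMap.snd ℝ _ _ ∘L ContinuousLinearMap.snd ℝ (J0 m) _))

theorem toJ1L_apply (q : EqJet m (n + 2)) : toJ1L q = q.toJ1 := rfl

theorem contDiff_toJ1 {k : WithTop ℕ∞} :
    ContDiff ℝ k (EqJet.toJ1 : EqJet m (n + 2) → J1 m) :=
  (toJ1L (m := m) (n := n)).contDiff

theorem ContDiffOn.comp_toJ1 {F : Type*} [NormedAddCommGroup F] [NormedSpace ℝ F] {g : J1 m → F}
    {V : Set (J0 m)} (hg : ContDiffOn ℝ ∞ g (over1 V)) :
    ContDiffOn ℝ ∞ (fun q : EqJet m (n + 2) => g q.toJ1) (overEq (n + 2) V) :=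
  hg.comp contDiff_toJ1.contDiffOn fun _ h => h

theorem fderiv_comp_toJ1 {F : Type*} [NormedAddCommGroup F] [NormedSpace ℝ F] {g : J1 m → F}
    {q : EqJet m (n + 2)} (hg : DifferentiableAt ℝ g q.toJ1) (v : EqJet m (n + 2)) :
    fderiv ℝ (fun q : EqJet m (n + 2) => g q.toJ1) q v = fderiv ℝ g q.toJ1 v.toJ1 := by
  have h := HasFDerivAt.comp (g := g) (f := toJ1L) q hg.hasFDerivAt toJ1L.hasFDerivAt
  rw [show (fun q : EqJet m (n + 2) => g q.toJ1) = g ∘ toJ1L from rfl, h.fderiv]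
  rfl

theorem dX_apply (v : EqJet m n) : dX v = v.1.1 := rfl

theorem dY_apply (v : EqJet m n) : dY v = v.1.2.1 := rfl

theorem θ_apply (α : Fin m) (q v : EqJet m (n + 2)) :
    θ α q v = v.1.2.2 α - q.2.1 0 α * v.1.1 - q.2.2 0 α * v.1.2.1 := rfl

theorem θx_apply (α : Fin m) (q v : EqJet m (n + 2)) :
    θx s α q v = v.2.1 0 α - q.2.1 1 α * v.1.1 - s.f α q.toJ1 * v.1.2.1 := rfl

theorem θy_apply (α : Fin m) (q v : EqJet m (n + 2)) :
    θy s α q v = v.2.2 0 α - s.f α q.toJ1 * v.1.1 - q.2.2 1 α * v.1.2.1 := rfl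

/-- The coordinate vector `∂/∂u^α`. -/
def vU (α : Fin m) : EqJet m n := ((0, 0, Pi.single α 1), 0, 0)

/-- The coordinate vector `∂/∂u^α_x`. -/
def vUx (α : Fin m) : EqJet m (n + 2) := (0, Pi.single 0 (Pi.single α 1), 0)

/-- The coordinate vector `∂/∂u^α_y`. -/
def vUy (α : Fin m) : EqJet m (n + 2) := (0, 0, Pi.single 0 (Pi.single α 1))

theorem toJ1_vU (α : Fin m) : (vU α : EqJet m (n + 2)).toJ1 = eU α := rfl

theorem toJ1_vUx (α : Fin m) : (vUx α : EqJet m (n + 2)).toJ1 = eUx α := by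
  simp [EqJet.toJ1, vUx, eUx]

theorem toJ1_vUy (α : Fin m) : (vUy α : EqJet m (n + 2)).toJ1 = eUy α := by
  simp [EqJet.toJ1, vUy, eUy]

theorem omega_apply (T P R : EqJet m (n + 2) → Matrix (Fin m) (Fin m) ℝ) (q : EqJet m (n + 2))
    (v : Fin 3 → EqJet m (n + 2)) : omega s T P R q v =
      ∑ α, ∑ β, (T q α β * wedge3 dX (θ α q) (θ β q) v + P q α β * wedge3 dY (θ α q) (θ β q) v +
        R q α β * (wedge3 (θ α q) (θx s β q) dX v - wedge3 (θ β q) (θy s α q) dY v)) := by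
  simp [omega]

section Evaluate

variable (T P R : EqJet m (n + 2) → Matrix (Fin m) (Fin m) ℝ) (q : EqJet m (n + 2))
  {X Y V : EqJet m (n + 2)}

theorem sum_sum_mul_single_single (M : Matrix (Fin m) (Fin m) ℝ) (α β : Fin m) :
    ∑ a, ∑ b, M a b * ((Pi.single α (1 : ℝ) : Fin m → ℝ) a *
      (Pi.single β (1 : ℝ) : Fin m → ℝ) b) = M α β := by
  simp [Pi.single_apply]

theorem sum_sum_mul_single_left (M : Matrix (Fin m) (Fin m) ℝ) (α : Fin m) (c : Fin m → ℝ) :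
    ∑ a, ∑ b, M a b * ((Pi.single α (1 : ℝ) : Fin m → ℝ) a * c b) = ∑ b, M α b * c b := by
  simp [Pi.single_apply]

theorem sum_sum_mul_single_right (M : Matrix (Fin m) (Fin m) ℝ) (α : Fin m) (c : Fin m → ℝ) :
    ∑ a, ∑ b, M a b * (c a * (Pi.single α (1 : ℝ) : Fin m → ℝ) b) = ∑ a, M a α * c a := by
  simp [Pi.single_apply]

/-- Only the dx and dy components of the first vector are prescribed here and in the similar
evaluations below. They thus apply both to the coordinate vectors ∂/∂x, ∂/∂y and to total
derivatives frozen at another point. -/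
theorem omega_X_U_Ux (hX : X.1.1 = 1) (hX' : X.1.2.1 = 0) (α β : Fin m) :
    omega s T P R q ![X, vU α, vUx β] = R q α β := by
  rw [omega_apply]
  simp [wedge3_apply, dX_apply, dY_apply, θ_apply, θx_apply, θy_apply, vU, vUx, hX, hX',
    sum_sum_mul_single_single]

theorem omega_Y_U_Uy (hY : Y.1.1 = 0) (hY' : Y.1.2.1 = 1) (α β : Fin m) :
    omega s T P R q ![Y, vU α, vUy β] = -R q β α := by
  rw [omega_apply]
  simp [wedge3_apply, dX_apply, dY_apply, θ_apply, θx_apply, θy_apply, vU, vUy, hY, hY']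
  rw [← sum_sum_mul_single_single (R q) β α]
  simp only [mul_comm]

theorem omega_Y_U_Ux (hY : Y.1.1 = 0) (hY' : Y.1.2.1 = 1) (α β : Fin m) :
    omega s T P R q ![Y, vU α, vUx β] = 0 := by
  rw [omega_apply]
  simp [wedge3_apply, dX_apply, dY_apply, θ_apply, θx_apply, θy_apply, vU, vUx, hY, hY']

theorem omega_X_U_Uy (hX : X.1.1 = 1) (hX' : X.1.2.1 = 0) (α β : Fin m) :
    omega s T P R q ![X, vU α, vUy β] = 0 := by
  rw [omega_apply]
  simp [wedge3_apply, dX_apply, dY_apply, θ_apply, θx_apply, θy_apply, vU, vUy, hX, hX']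

theorem omega_X_U_U (hX : X.1.1 = 1) (hX' : X.1.2.1 = 0) (α β : Fin m) :
    omega s T P R q ![X, vU α, vU β] = T q α β - T q β α := by
  rw [omega_apply]
  simp [wedge3_apply, dX_apply, dY_apply, θ_apply, θx_apply, θy_apply, vU, hX, hX', mul_sub,
    sum_sum_mul_single_single]

theorem omega_Y_U_U (hY : Y.1.1 = 0) (hY' : Y.1.2.1 = 1) (α β : Fin m) :
    omega s T P R q ![Y, vU α, vU β] = P q α β - P q β α := by
  rw [omega_apply]
  simp [wedge3_apply, dX_apply, dY_apply, θ_apply, θx_apply, θy_apply, vU, hY, hY', mul_sub,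
    sum_sum_mul_single_single]

theorem omega_X_Y_Ux (hX : X.1.1 = 1) (hX' : X.1.2.1 = 0) (hY : Y.1.1 = 0) (hY' : Y.1.2.1 = 1)
    (β : Fin m) :
    omega s T P R q ![X, Y, vUx β] = ∑ a, R q a β * (Y.1.2.2 a - q.2.2 0 a) := by
  rw [omega_apply]
  simp [wedge3_apply, dX_apply, dY_apply, θ_apply, θx_apply, θy_apply, vUx, hX, hX', hY, hY',
    sum_sum_mul_single_right]

theorem omega_X_Y_Uy (hX : X.1.1 = 1) (hX' : X.1.2.1 = 0) (hY : Y.1.1 = 0) (hY' : Y.1.2.1 = 1)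
    (β : Fin m) :
    omega s T P R q ![X, Y, vUy β] = ∑ b, R q β b * (X.1.2.2 b - q.2.1 0 b) := by
  rw [omega_apply]
  simp [wedge3_apply, dX_apply, dY_apply, θ_apply, θx_apply, θy_apply, vUy, hX, hX', hY, hY']
  rw [← sum_sum_mul_single_left (R q)]
  simp only [mul_comm]

theorem omega_X_Y_U (hX : X.1.1 = 1) (hX' : X.1.2.1 = 0) (hY : Y.1.1 = 0) (hY' : Y.1.2.1 = 1)
    (α : Fin m) :
    omega s T P R q ![X, Y, vU α] = (∑ a, (T q a α - T q α a) * (Y.1.2.2 a - q.2.2 0 a)) -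
      (∑ a, (P q a α - P q α a) * (X.1.2.2 a - q.2.1 0 a)) -
      (∑ b, R q α b * (Y.2.1 0 b - s.f b q.toJ1)) -
      ∑ a, R q a α * (X.2.2 0 a - s.f a q.toJ1) := by
  rw [omega_apply]
  simp only [wedge3_apply, dX_apply, dY_apply, θ_apply, θx_apply, θy_apply, vU]
  simp only [sub_mul, Finset.sum_sub_distrib, ← sum_sum_mul_single_right (T q) α,
    ← sum_sum_mul_single_left (T q) α, ← sum_sum_mul_single_right (P q) α,
    ← sum_sum_mul_single_left (P q) α, ← sum_sum_mul_single_right (R q) α,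
    ← sum_sum_mul_single_left (R q) α]
  simp only [← Finset.sum_sub_distrib]
  refine Finset.sum_congr rfl fun a _ => Finset.sum_congr rfl fun b _ => ?_
  simp [hX, hX', hY, hY']
  ring

theorem omega_X_V_Ux (hX : X.1.2.1 = 0) (hV : V.1 = 0) (β : Fin m) :
    omega s T P R q ![X, V, vUx β] = 0 := by
  rw [omega_apply]
  simp [wedge3_apply, dX_apply, dY_apply, θ_apply, θx_apply, θy_apply, vUx, hX, hV]

theorem omega_Y_V_Uy (hY : Y.1.1 = 0) (hV : V.1 = 0) (β : Fin m) :
    omega s T P R q ![Y, V, vUy β] = 0 := by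
  rw [omega_apply]
  simp [wedge3_apply, dX_apply, dY_apply, θ_apply, θx_apply, θy_apply, vUy, hY, hV]

theorem omega_V_U_V (hV : V.1 = 0) {V' : EqJet m (n + 2)} (hV' : V'.1 = 0) (α : Fin m) :
    omega s T P R q ![V, vU α, V'] = 0 := by
  rw [omega_apply]
  simp [wedge3_apply, dX_apply, dY_apply, vU, hV, hV']

theorem omega_X_V_U (hX : X.1.2.1 = 0) (hV : V.1 = 0) (hV' : V.2.1 0 = 0) (α : Fin m) :
    omega s T P R q ![X, V, vU α] = 0 := by
  rw [omega_apply]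
  simp [wedge3_apply, dX_apply, dY_apply, θ_apply, θx_apply, θy_apply, vU, hX, hV, hV']

theorem omega_Y_V_U (hY : Y.1.1 = 0) (hV : V.1 = 0) (hV' : V.2.2 0 = 0) (α : Fin m) :
    omega s T P R q ![Y, V, vU α] = 0 := by
  rw [omega_apply]
  simp [wedge3_apply, dX_apply, dY_apply, θ_apply, θx_apply, θy_apply, vU, hY, hV, hV']

end Evaluate

theorem contDiff_θ {k : WithTop ℕ∞} (α : Fin m) :
    ContDiff ℝ k (θ α : EqJet m (n + 2) → EqJet m (n + 2) →L[ℝ] ℝ) := by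
  unfold θ
  fun_prop

theorem contDiffOn_θx {V : Set (J0 m)} (hs : s.SmoothOn V) (α : Fin m) :
    ContDiffOn ℝ ∞ (θx s α : EqJet m (n + 2) → EqJet m (n + 2) →L[ℝ] ℝ) (overEq (n + 2) V) := by
  have h := (ContDiffOn.comp_toJ1 (n := n) (hs.f α)).smul
    (contDiffOn_const (c := (dY : EqJet m (n + 2) →L[ℝ] ℝ)))
  have h' : ContDiff ℝ ∞ (fun q : EqJet m (n + 2) =>
      (dUX 0 α - q.2.1 1 α • dX : EqJet m (n + 2) →L[ℝ] ℝ)) := by fun_prop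
  exact h'.contDiffOn.sub h

theorem contDiffOn_θy {V : Set (J0 m)} (hs : s.SmoothOn V) (α : Fin m) :
    ContDiffOn ℝ ∞ (θy s α : EqJet m (n + 2) → EqJet m (n + 2) →L[ℝ] ℝ) (overEq (n + 2) V) := by
  have h := (ContDiffOn.comp_toJ1 (n := n) (hs.f α)).smul
    (contDiffOn_const (c := (dX : EqJet m (n + 2) →L[ℝ] ℝ)))
  have h' : ContDiff ℝ ∞ (fun q : EqJet m (n + 2) => (q.2.2 1 α • dY : EqJet m (n + 2) →L[ℝ] ℝ)) := by
    fun_prop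
  exact (contDiffOn_const.sub h).sub h'.contDiffOn

theorem contDiffOn_omega {V : Set (J0 m)} (hs : s.SmoothOn V)
    {T P R : EqJet m (n + 2) → Matrix (Fin m) (Fin m) ℝ}
    (hT : ∀ α β, ContDiffOn ℝ ∞ (fun q => T q α β) (overEq (n + 2) V))
    (hP : ∀ α β, ContDiffOn ℝ ∞ (fun q => P q α β) (overEq (n + 2) V))
    (hR : ∀ α β, ContDiffOn ℝ ∞ (fun q => R q α β) (overEq (n + 2) V)) :
    ContDiffOn ℝ ∞ (omega s T P R) (overEq (n + 2) V) := by
  have hθ : ∀ α, ContDiffOn ℝ ∞ (θ α : EqJet m (n + 2) → _) (overEq (n + 2) V) :=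
    fun α => (contDiff_θ α).contDiffOn
  refine ContDiffOn.sum fun α _ => ContDiffOn.sum fun β _ => ?_
  exact (((hT α β).smul (ContDiffOn.wedge3 contDiffOn_const (hθ α) (hθ β))).add
    ((hP α β).smul (ContDiffOn.wedge3 contDiffOn_const (hθ α) (hθ β)))).add
    ((hR α β).smul ((ContDiffOn.wedge3 (hθ α) (contDiffOn_θx hs β) contDiffOn_const).sub
      (ContDiffOn.wedge3 (hθ β) (contDiffOn_θy hs α) contDiffOn_const)))

end FGordon

/-! ### From closed forms to the conditions -/

namespace FGordon

variable {m n : ℕ} {s : System m}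

namespace System

variable {W : Set (J0 m)} {N : J0 m → Matrix (Fin m) (Fin m) ℝ}

theorem fderiv_sum_mul_fUx (hs : s.SmoothOn W) (hW : IsOpen W)
    (hN : ∀ α β, ContDiffOn ℝ ∞ (fun z => N z α β) W) {j : J1 m} (hj : j ∈ over1 W)
    (α β : Fin m) (v : J0 m) (a b : Fin m → ℝ) :
    fderiv ℝ (fun j : J1 m => ∑ σ, N j.1 α σ * s.fUx σ β j) j (v, a, b) =
      ∑ σ, (fderiv ℝ (fun z => N z α σ) j.1 v * s.fUx σ β j +
        N j.1 α σ * (fderiv ℝ (s.fUx σ β) j (v, 0) - ∑ ν, s.C σ β ν j.1 * b ν)) := by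
  have h := HasFDerivAt.fun_sum (u := Finset.univ) fun σ _ =>
    (HasFDerivAt.comp (g := fun z => N z α σ) (f := Prod.fst) j
      (ContDiffOn.differentiableAt_of_isOpen (hN α σ) hW hj).hasFDerivAt hasFDerivAt_fst).mul
      (ContDiffOn.differentiableAt_of_isOpen (hs.fUx σ β) (isOpen_over1 hW) hj).hasFDerivAt
  have hv : ((v, a, b) : J1 m) = (v, 0) + (0, a, b) := by simp
  rw [show fderiv ℝ (fun j : J1 m => ∑ σ, N j.1 α σ * s.fUx σ β j) j = _ from h.fderiv]
  simp only [sum_apply]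
  refine Finset.sum_congr rfl fun σ _ => ?_
  have hv' : fderiv ℝ (s.fUx σ β) j (v, a, b) =
      fderiv ℝ (s.fUx σ β) j (v, 0) - ∑ ν, s.C σ β ν j.1 * b ν := by
    rw [hv, map_add, fderiv_fUx_vertical hs hW hj, sub_eq_add_neg]
  simp [hv']
  ring

theorem fderiv_sum_mul_fUy (hs : s.SmoothOn W) (hW : IsOpen W)
    (hN : ∀ α β, ContDiffOn ℝ ∞ (fun z => N z α β) W) {j : J1 m} (hj : j ∈ over1 W)
    (α β : Fin m) (v : J0 m) (a b : Fin m → ℝ) :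
    fderiv ℝ (fun j : J1 m => ∑ σ, N j.1 α σ * s.fUy σ β j) j (v, a, b) =
      ∑ σ, (fderiv ℝ (fun z => N z α σ) j.1 v * s.fUy σ β j +
        N j.1 α σ * (fderiv ℝ (s.fUy σ β) j (v, 0) - ∑ ν, s.C σ ν β j.1 * a ν)) := by
  have h := HasFDerivAt.fun_sum (u := Finset.univ) fun σ _ =>
    (HasFDerivAt.comp (g := fun z => N z α σ) (f := Prod.fst) j
      (ContDiffOn.differentiableAt_of_isOpen (hN α σ) hW hj).hasFDerivAt hasFDerivAt_fst).mul
      (ContDiffOn.differentiableAt_of_isOpen (hs.fUy σ β) (isOpen_over1 hW) hj).hasFDerivAt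
  have hv : ((v, a, b) : J1 m) = (v, 0) + (0, a, b) := by simp
  rw [show fderiv ℝ (fun j : J1 m => ∑ σ, N j.1 α σ * s.fUy σ β j) j = _ from h.fderiv]
  simp only [sum_apply]
  refine Finset.sum_congr rfl fun σ _ => ?_
  have hv' : fderiv ℝ (s.fUy σ β) j (v, a, b) =
      fderiv ℝ (s.fUy σ β) j (v, 0) - ∑ ν, s.C σ ν β j.1 * a ν := by
    rw [hv, map_add, fderiv_fUy_vertical hs hW hj, sub_eq_add_neg]
  simp [hv']
  ring

end System

/-- The jet variable u_x occurs in the direction of differentiation, and varying it contributes the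
second term. With u_xy = f in that term, total derivatives in x and y commute. -/
theorem fderiv_fderiv_x {r : J0 m → ℝ} {W : Set (J0 m)} (hW : IsOpen W)
    (hr : ContDiffOn ℝ ∞ r W) {j : J1 m} (hj : j ∈ over1 W) (v : J0 m) (a b : Fin m → ℝ) :
    fderiv ℝ (fun j : J1 m => fderiv ℝ r j.1 (1, 0, j.2.1)) j (v, a, b) =
      fderiv ℝ (fun z => fderiv ℝ r z (1, 0, j.2.1)) j.1 v + fderiv ℝ r j.1 (0, 0, a) := by
  have hd : DifferentiableAt ℝ (fderiv ℝ r) j.1 :=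
    ContDiffOn.differentiableAt_of_isOpen (hr.fderiv_of_isOpen hW (by simp)) hW hj
  have h1 : HasFDerivAt (fun j : J1 m => fderiv ℝ r j.1)
      (fderiv ℝ (fderiv ℝ r) j.1 ∘L ContinuousLinearMap.fst ℝ _ _) j :=
    HasFDerivAt.comp (g := fderiv ℝ r) (f := Prod.fst) j hd.hasFDerivAt hasFDerivAt_fst
  have h3 : HasFDerivAt (fun j : J1 m => j.2.1)
      (ContinuousLinearMap.fst ℝ _ _ ∘L ContinuousLinearMap.snd ℝ _ _) j :=
    hasFDerivAt_fst.comp j hasFDerivAt_snd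
  have h2 : HasFDerivAt (fun j : J1 m => ((1, 0, j.2.1) : J0 m))
      ((0 : J1 m →L[ℝ] ℝ).prod ((0 : J1 m →L[ℝ] ℝ).prod
        (ContinuousLinearMap.fst ℝ _ _ ∘L ContinuousLinearMap.snd ℝ _ _))) j :=
    (hasFDerivAt_const 1 j).prodMk ((hasFDerivAt_const 0 j).prodMk h3)
  rw [(h1.clm_apply h2).fderiv, fderiv_clm_apply hd (by fun_prop)]
  simp [add_comm]

theorem fderiv_fderiv_y {r : J0 m → ℝ} {W : Set (J0 m)} (hW : IsOpen W)
    (hr : ContDiffOn ℝ ∞ r W) {j : J1 m} (hj : j ∈ over1 W) (v : J0 m) (a b : Fin m → ℝ) :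
    fderiv ℝ (fun j : J1 m => fderiv ℝ r j.1 (0, 1, j.2.2)) j (v, a, b) =
      fderiv ℝ (fun z => fderiv ℝ r z (0, 1, j.2.2)) j.1 v + fderiv ℝ r j.1 (0, 0, b) := by
  have hd : DifferentiableAt ℝ (fderiv ℝ r) j.1 :=
    ContDiffOn.differentiableAt_of_isOpen (hr.fderiv_of_isOpen hW (by simp)) hW hj
  have h1 : HasFDerivAt (fun j : J1 m => fderiv ℝ r j.1)
      (fderiv ℝ (fderiv ℝ r) j.1 ∘L ContinuousLinearMap.fst ℝ _ _) j :=
    HasFDerivAt.comp (g := fderiv ℝ r) (f := Prod.fst) j hd.hasFDerivAt hasFDerivAt_fst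
  have h3 : HasFDerivAt (fun j : J1 m => j.2.2)
      (ContinuousLinearMap.snd ℝ _ _ ∘L ContinuousLinearMap.snd ℝ _ _) j :=
    hasFDerivAt_snd.comp j hasFDerivAt_snd
  have h2 : HasFDerivAt (fun j : J1 m => ((0, 1, j.2.2) : J0 m))
      ((0 : J1 m →L[ℝ] ℝ).prod ((0 : J1 m →L[ℝ] ℝ).prod
        (ContinuousLinearMap.snd ℝ _ _ ∘L ContinuousLinearMap.snd ℝ _ _))) j :=
    (hasFDerivAt_const 0 j).prodMk ((hasFDerivAt_const 1 j).prodMk h3)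
  rw [(h1.clm_apply h2).fderiv, fderiv_clm_apply hd (by fun_prop)]
  simp [add_comm]

section ClosedForm

variable {V : Set (J0 m)} {T P R : EqJet m (n + 2) → Matrix (Fin m) (Fin m) ℝ}

/-- R_{αβ} is the coefficient of both θ^α ∧ θ^β_x ∧ dx and -θ^β ∧ θ^α_y ∧ dy. In dω = 0 on (∂/∂x, v,
∂/∂u^α, ∂/∂u^β_x) only v(R) survives if v has no u_x component, and the second occurrence treats v
without u_y component in the same way. -/
theorem fderiv_R_vertical (hV : IsOpen V) (hω : DifferentiableOn ℝ (omega s T P R) (overEq (n + 2) V))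
    (hclosed : ∀ q ∈ overEq (n + 2) V, extDeriv (omega s T P R) q = 0) (α β : Fin m)
    {q : EqJet m (n + 2)} (hq : q ∈ overEq (n + 2) V) {v : EqJet m (n + 2)} (hv : v.1 = 0) :
    fderiv ℝ (fun q => R q α β) q v = 0 := by
  have hd := (hω q hq).differentiableAt ((isOpen_overEq hV _).mem_nhds hq)
  have hvx : ∀ v : EqJet m (n + 2), v.1 = 0 → v.2.1 0 = 0 →
      fderiv ℝ (fun q => R q α β) q v = 0 := by
    intro v hv hv'
    have h := extDeriv_three_apply hd ((1, 0, 0), 0) v (vU α) (vUx β)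
    rw [hclosed q hq] at h
    simp only [omega_V_U_V T P R _ hv (V' := vUx β) rfl,
      omega_X_U_Ux T P R _ (X := ((1, 0, 0), 0)) rfl rfl,
      omega_X_V_Ux T P R _ (X := ((1, 0, 0), 0)) rfl hv,
      omega_X_V_U T P R _ (X := ((1, 0, 0), 0)) rfl hv hv'] at h
    simpa using h
  have hvy : ∀ v : EqJet m (n + 2), v.1 = 0 → v.2.2 0 = 0 →
      fderiv ℝ (fun q => R q α β) q v = 0 := by
    intro v hv hv'
    have h := extDeriv_three_apply hd ((0, 1, 0), 0) v (vU β) (vUy α)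
    rw [hclosed q hq] at h
    simp only [omega_V_U_V T P R _ hv (V' := vUy α) rfl,
      omega_Y_U_Uy T P R _ (Y := ((0, 1, 0), 0)) rfl rfl,
      omega_Y_V_Uy T P R _ (Y := ((0, 1, 0), 0)) rfl hv,
      omega_Y_V_U T P R _ (Y := ((0, 1, 0), 0)) rfl hv hv'] at h
    simpa using h.symm
  -- The summand along the x-derivatives has no u_y component and the one along the y-derivatives
  -- has no u_x component, so each of the two facts covers one of them.
  have hsplit : v = (0, v.2.1, 0) + (0, 0, v.2.2) := by
    ext <;> simp [hv]
  rw [hsplit, map_add, hvy _ rfl rfl, hvx _ rfl rfl, add_zero]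

/-- The fibre over a base point is a whole vector space, so a function with vanishing fibre
derivative is constant on it. -/
theorem R_eq_base (hV : IsOpen V) (hω : DifferentiableOn ℝ (omega s T P R) (overEq (n + 2) V))
    (hR : ∀ α β, ContDiffOn ℝ ∞ (fun q => R q α β) (overEq (n + 2) V))
    (hclosed : ∀ q ∈ overEq (n + 2) V, extDeriv (omega s T P R) q = 0) (α β : Fin m)
    {q : EqJet m (n + 2)} (hq : q ∈ overEq (n + 2) V) : R q α β = R (q.1, 0) α β := by
  have hd : ∀ w, HasFDerivAt (fun w => R (q.1, w) α β) (0 : _ →L[ℝ] ℝ) w := by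
    intro w
    have hw : (q.1, w) ∈ overEq (n + 2) V := hq
    have h := HasFDerivAt.comp (g := fun q => R q α β) (f := fun w => (q.1, w)) w
      (ContDiffOn.differentiableAt_of_isOpen (hR α β) (isOpen_overEq hV _) hw).hasFDerivAt
      (hasFDerivAt_prodMk_right q.1 w)
    refine h.congr_fderiv ?_
    refine ContinuousLinearMap.ext fun v => ?_
    simpa using fderiv_R_vertical hV hω hclosed α β hw (v := (0, v)) rfl
  exact is_const_of_fderiv_eq_zero (fun w => (hd w).differentiableAt) (fun w => (hd w).fderiv) q.2 0

end ClosedForm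

end FGordon

/-! ### Closedness evaluated on total derivatives -/

namespace FGordon

variable {m n : ℕ} {s : System m}

/-- Used with `d` the values of contact forms on a total derivative frozen at a point: they vanish
at that point, so no derivative of the coefficients of `omega` enters. -/
theorem hasFDerivAt_sum_mul_of_eq_zero {E : Type*} [NormedAddCommGroup E] [NormedSpace ℝ E]
    {c d : Fin m → E → ℝ} {x : E} (hc : ∀ a, DifferentiableAt ℝ (c a) x)
    (hd : ∀ a, DifferentiableAt ℝ (d a) x) (h0 : ∀ a, d a x = 0) :
    HasFDerivAt (fun y => ∑ a, c a y * d a y) (∑ a, c a x • fderiv ℝ (d a) x) x := by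
  refine (HasFDerivAt.fun_sum (u := Finset.univ) fun a _ =>
    (hc a).hasFDerivAt.mul (hd a).hasFDerivAt).congr_fderiv ?_
  simp [h0]

/-- The total vector field `D_x` at a point of the equation manifold. -/
def totalX (s : System m) (q : EqJet m (n + 2)) : EqJet m (n + 2) :=
  ((1, 0, q.2.1 0), Pi.single 0 (q.2.1 1), Pi.single 0 fun β => s.f β q.toJ1)

/-- The total vector field `D_y` at a point of the equation manifold. -/
def totalY (s : System m) (q : EqJet m (n + 2)) : EqJet m (n + 2) :=
  ((0, 1, q.2.2 0), Pi.single 0 fun β => s.f β q.toJ1, Pi.single 0 (q.2.2 1))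

theorem toJ1_totalX (q : EqJet m (n + 2)) :
    (totalX s q).toJ1 = ((1, 0, q.2.1 0), q.2.1 1, fun β => s.f β q.toJ1) := by
  simp [EqJet.toJ1, totalX]

theorem toJ1_totalY (q : EqJet m (n + 2)) :
    (totalY s q).toJ1 = ((0, 1, q.2.2 0), fun β => s.f β q.toJ1, q.2.2 1) := by
  simp [EqJet.toJ1, totalY]

/-- The form `omega` has smooth coefficients over `V` and is closed. -/
structure IsClosedOmega (s : System m) (V : Set (J0 m))
    (T P R : EqJet m (n + 2) → Matrix (Fin m) (Fin m) ℝ) : Prop where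
  smooth_T : ∀ α β, ContDiffOn ℝ ∞ (fun q => T q α β) (overEq (n + 2) V)
  smooth_P : ∀ α β, ContDiffOn ℝ ∞ (fun q => P q α β) (overEq (n + 2) V)
  smooth_R : ∀ α β, ContDiffOn ℝ ∞ (fun q => R q α β) (overEq (n + 2) V)
  closed : ∀ q ∈ overEq (n + 2) V, extDeriv (omega s T P R) q = 0

namespace IsClosedOmega

variable {V : Set (J0 m)} {T P R : EqJet m (n + 2) → Matrix (Fin m) (Fin m) ℝ}

theorem differentiableAt (h : IsClosedOmega s V T P R) (hs : s.SmoothOn V) (hV : IsOpen V)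
    {q : EqJet m (n + 2)} (hq : q ∈ overEq (n + 2) V) : DifferentiableAt ℝ (omega s T P R) q :=
  ContDiffOn.differentiableAt_of_isOpen
    (contDiffOn_omega hs h.smooth_T h.smooth_P h.smooth_R) (isOpen_overEq hV _) hq

theorem R_eq (h : IsClosedOmega s V T P R) (hs : s.SmoothOn V) (hV : IsOpen V) (α β : Fin m) :
    Set.EqOn (fun q => R q α β) (fun q => R (q.1, 0) α β) (overEq (n + 2) V) := fun _ hq =>
  R_eq_base hV (fun _ hq => (h.differentiableAt hs hV hq).differentiableWithinAt) h.smooth_R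
    h.closed α β hq

theorem smooth_base (h : IsClosedOmega s V T P R) (α β : Fin m) :
    ContDiffOn ℝ ∞ (fun z => R (z, 0) α β) V :=
  (h.smooth_R α β).comp (f := fun z : J0 m => ((z, 0) : EqJet m (n + 2))) (by fun_prop)
    fun _ hz => hz

theorem fderiv_R (h : IsClosedOmega s V T P R) (hs : s.SmoothOn V) (hV : IsOpen V) (α β : Fin m)
    {q : EqJet m (n + 2)} (hq : q ∈ overEq (n + 2) V) (v : EqJet m (n + 2)) :
    fderiv ℝ (fun q => R q α β) q v = fderiv ℝ (fun z => R (z, 0) α β) q.1 v.1 := by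
  rw [fderiv_eq_of_eqOn_open (isOpen_overEq hV _) (h.R_eq hs hV α β) hq]
  have := HasFDerivAt.comp (g := fun z => R (z, 0) α β) (f := Prod.fst) q
    (ContDiffOn.differentiableAt_of_isOpen (h.smooth_base α β) hV hq).hasFDerivAt hasFDerivAt_fst
  exact congrArg (fun D => D v) this.fderiv

theorem differentiableAt_R (h : IsClosedOmega s V T P R) (hV : IsOpen V) (α β : Fin m)
    {q : EqJet m (n + 2)} (hq : q ∈ overEq (n + 2) V) :
    DifferentiableAt ℝ (fun q => R q α β) q :=
  ContDiffOn.differentiableAt_of_isOpen (h.smooth_R α β) (isOpen_overEq hV _) hq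

theorem hasFDerivAt_sub_coord_x (c : ℝ) (a : Fin m) (q : EqJet m (n + 2)) :
    HasFDerivAt (fun q : EqJet m (n + 2) => c - q.2.1 0 a) (-dUX 0 a) q := by
  exact ((dUX 0 a : EqJet m (n + 2) →L[ℝ] ℝ).hasFDerivAt (x := q)).const_sub c

theorem hasFDerivAt_sub_coord_y (c : ℝ) (a : Fin m) (q : EqJet m (n + 2)) :
    HasFDerivAt (fun q : EqJet m (n + 2) => c - q.2.2 0 a) (-dUY 0 a) q := by
  exact ((dUY 0 a : EqJet m (n + 2) →L[ℝ] ℝ).hasFDerivAt (x := q)).const_sub c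

/-- The total derivatives are frozen at `q` while the point `q'` varies, because the formula for the
exterior derivative takes constant vectors. Their components of order above one are zero, which is
harmless as `omega` does not see them. -/
theorem fderiv_omega_X_Y_Ux (h : IsClosedOmega s V T P R) (hV : IsOpen V) (β : Fin m)
    {q : EqJet m (n + 2)} (hq : q ∈ overEq (n + 2) V) (v : EqJet m (n + 2)) :
    fderiv ℝ (fun q' => omega s T P R q' ![totalX s q, totalY s q, vUx β]) q v =
      -∑ a, R q a β * v.2.2 0 a := by
  simp only [omega_X_Y_Ux T P R _ (X := totalX s q) (Y := totalY s q) rfl rfl rfl rfl]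
  rw [(hasFDerivAt_sum_mul_of_eq_zero (fun a => h.differentiableAt_R hV a β hq)
    (fun a => (hasFDerivAt_sub_coord_y _ a q).differentiableAt)
    fun a => by simp [totalY]).fderiv]
  simp [(hasFDerivAt_sub_coord_y _ _ q).fderiv, dUY]

theorem fderiv_omega_X_Y_Uy (h : IsClosedOmega s V T P R) (hV : IsOpen V) (β : Fin m)
    {q : EqJet m (n + 2)} (hq : q ∈ overEq (n + 2) V) (v : EqJet m (n + 2)) :
    fderiv ℝ (fun q' => omega s T P R q' ![totalX s q, totalY s q, vUy β]) q v =
      -∑ a, R q β a * v.2.1 0 a := by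
  simp only [omega_X_Y_Uy T P R _ (X := totalX s q) (Y := totalY s q) rfl rfl rfl rfl]
  rw [(hasFDerivAt_sum_mul_of_eq_zero (fun a => h.differentiableAt_R hV β a hq)
    (fun a => (hasFDerivAt_sub_coord_x _ a q).differentiableAt)
    fun a => by simp [totalX]).fderiv]
  simp [(hasFDerivAt_sub_coord_x _ _ q).fderiv, dUX]

theorem fderiv_omega_X_Y_U (h : IsClosedOmega s V T P R) (hs : s.SmoothOn V) (hV : IsOpen V)
    (α : Fin m) {q : EqJet m (n + 2)} (hq : q ∈ overEq (n + 2) V) (v : EqJet m (n + 2)) :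
    fderiv ℝ (fun q' => omega s T P R q' ![totalX s q, totalY s q, vU α]) q v =
      -(∑ a, (T q a α - T q α a) * v.2.2 0 a) + (∑ a, (P q a α - P q α a) * v.2.1 0 a) +
        ∑ b, (R q α b + R q b α) * fderiv ℝ (s.f b) q.toJ1 v.toJ1 := by
  simp only [omega_X_Y_U T P R _ (X := totalX s q) (Y := totalY s q) rfl rfl rfl rfl]
  have hO := isOpen_overEq hV (n + 2)
  have hf : ∀ c b, HasFDerivAt (fun q : EqJet m (n + 2) => c - s.f b q.toJ1)
      (-(fderiv ℝ (s.f b) q.toJ1 ∘L toJ1L)) q := fun c b =>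
    (HasFDerivAt.comp (g := s.f b) (f := toJ1L) q (ContDiffOn.differentiableAt_of_isOpen (hs.f b)
      (isOpen_over1 hV) hq).hasFDerivAt toJ1L.hasFDerivAt).const_sub c
  have hT := hasFDerivAt_sum_mul_of_eq_zero (c := fun a q => T q a α - T q α a)
    (d := fun a q' => (totalY s q).1.2.2 a - q'.2.2 0 a) (x := q)
    (fun a => (ContDiffOn.differentiableAt_of_isOpen (h.smooth_T a α) hO hq).sub
      (ContDiffOn.differentiableAt_of_isOpen (h.smooth_T α a) hO hq))
    (fun a => (hasFDerivAt_sub_coord_y _ a q).differentiableAt) fun a => by simp [totalY]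
  have hP := hasFDerivAt_sum_mul_of_eq_zero (c := fun a q => P q a α - P q α a)
    (d := fun a q' => (totalX s q).1.2.2 a - q'.2.1 0 a) (x := q)
    (fun a => (ContDiffOn.differentiableAt_of_isOpen (h.smooth_P a α) hO hq).sub
      (ContDiffOn.differentiableAt_of_isOpen (h.smooth_P α a) hO hq))
    (fun a => (hasFDerivAt_sub_coord_x _ a q).differentiableAt) fun a => by simp [totalX]
  have hR1 := hasFDerivAt_sum_mul_of_eq_zero (c := fun a q => R q α a)
    (d := fun a q' => (totalY s q).2.1 0 a - s.f a q'.toJ1) (x := q)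
    (fun a => h.differentiableAt_R hV α a hq)
    (fun a => (hf _ a).differentiableAt) fun a => by simp [totalY]
  have hR2 := hasFDerivAt_sum_mul_of_eq_zero (c := fun a q => R q a α)
    (d := fun a q' => (totalX s q).2.2 0 a - s.f a q'.toJ1) (x := q)
    (fun a => h.differentiableAt_R hV a α hq)
    (fun a => (hf _ a).differentiableAt) fun a => by simp [totalX]
  refine (congrArg (fun D => D v) (((hT.fun_sub hP).fun_sub hR1).fun_sub hR2).fderiv).trans ?_
  simp only [(hasFDerivAt_sub_coord_x _ _ q).fderiv, (hasFDerivAt_sub_coord_y _ _ q).fderiv, (hf _ _).fderiv]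
  simp [dUX, dUY, toJ1L_apply, add_mul, Finset.sum_add_distrib]
  ring

/-- This is dω(D_x, D_y, ∂/∂u^α, ∂/∂u^β_x) = 0. The derivative of R comes from ω(D_x, ∂/∂u^α,
∂/∂u^β_x). The antisymmetric part of P and the derivatives of f come from differentiating ω(D_x,
D_y, ∂/∂u^α) along ∂/∂u^β_x. -/
theorem P_antisymm_part (h : IsClosedOmega s V T P R) (hs : s.SmoothOn V) (hV : IsOpen V)
    (α β : Fin m) {q : EqJet m (n + 2)} (hq : q ∈ overEq (n + 2) V) :
    P q α β - P q β α = fderiv ℝ (fun z => R (z, 0) α β) q.1 (0, 1, q.2.2 0) +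
      ∑ σ, (R (q.1, 0) α σ + R (q.1, 0) σ α) * s.fUx σ β q.toJ1 := by
  have h0 := extDeriv_three_apply (h.differentiableAt hs hV hq) (totalX s q) (totalY s q) (vU α)
    (vUx β)
  rw [h.closed q hq, h.fderiv_omega_X_Y_Ux hV β hq, h.fderiv_omega_X_Y_U hs hV α hq] at h0
  simp only [omega_Y_U_Ux T P R _ (Y := totalY s q) rfl rfl,
    omega_X_U_Ux T P R _ (X := totalX s q) rfl rfl, h.fderiv_R hs hV α β hq, toJ1_vUx] at h0
  have hf : ∀ b, fderiv ℝ (s.f b) q.toJ1 (eUx β) = s.fUx b β q.toJ1 := fun b =>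
    System.pd_eUx_f hs hV b β hq
  have hR : ∀ a b, R q a b = R (q.1, 0) a b := fun a b => h.R_eq hs hV a b hq
  simp only [hf, hR] at h0
  simp [vU, vUx, totalY, sum_mul_single] at h0
  linarith

theorem T_antisymm_part (h : IsClosedOmega s V T P R) (hs : s.SmoothOn V) (hV : IsOpen V)
    (α β : Fin m) {q : EqJet m (n + 2)} (hq : q ∈ overEq (n + 2) V) :
    T q α β - T q β α = -fderiv ℝ (fun z => R (z, 0) β α) q.1 (1, 0, q.2.1 0) -
      ∑ σ, (R (q.1, 0) α σ + R (q.1, 0) σ α) * s.fUy σ β q.toJ1 := by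
  have h0 := extDeriv_three_apply (h.differentiableAt hs hV hq) (totalX s q) (totalY s q) (vU α)
    (vUy β)
  rw [h.closed q hq, h.fderiv_omega_X_Y_Uy hV β hq, h.fderiv_omega_X_Y_U hs hV α hq] at h0
  have hn : fderiv ℝ (fun q => -R q β α) q (totalX s q) =
      -fderiv ℝ (fun z => R (z, 0) β α) q.1 (1, 0, q.2.1 0) := by
    rw [fderiv_fun_neg, neg_apply, h.fderiv_R hs hV β α hq]
    rfl
  simp only [omega_Y_U_Uy T P R _ (Y := totalY s q) rfl rfl,
    omega_X_U_Uy T P R _ (X := totalX s q) rfl rfl, hn, toJ1_vUy] at h0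
  have hf : ∀ b, fderiv ℝ (s.f b) q.toJ1 (eUy β) = s.fUy b β q.toJ1 := fun b =>
    System.pd_eUy_f hs hV b β hq
  have hR : ∀ a b, R q a b = R (q.1, 0) a b := fun a b => h.R_eq hs hV a b hq
  simp only [hf, hR] at h0
  simp [vU, vUy, sum_mul_single] at h0
  linarith

theorem extDeriv_totalX_totalY_U_U (h : IsClosedOmega s V T P R) (hs : s.SmoothOn V)
    (hV : IsOpen V) (α β : Fin m) {q : EqJet m (n + 2)} (hq : q ∈ overEq (n + 2) V) :
    fderiv ℝ (fun q => P q α β - P q β α) q (totalX s q) -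
      fderiv ℝ (fun q => T q α β - T q β α) q (totalY s q) +
      (∑ σ, (R (q.1, 0) β σ + R (q.1, 0) σ β) * pd (eU α) (s.f σ) q.toJ1) -
      ∑ σ, (R (q.1, 0) α σ + R (q.1, 0) σ α) * pd (eU β) (s.f σ) q.toJ1 = 0 := by
  have h0 := extDeriv_three_apply (h.differentiableAt hs hV hq) (totalX s q) (totalY s q) (vU α)
    (vU β)
  rw [h.closed q hq, h.fderiv_omega_X_Y_U hs hV β hq, h.fderiv_omega_X_Y_U hs hV α hq] at h0
  simp only [omega_Y_U_U T P R _ (Y := totalY s q) rfl rfl,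
    omega_X_U_U T P R _ (X := totalX s q) rfl rfl, toJ1_vU] at h0
  have hR : ∀ a b, R q a b = R (q.1, 0) a b := fun a b => h.R_eq hs hV a b hq
  simp only [hR] at h0
  simp [vU] at h0
  simp only [pd]
  linarith

end IsClosedOmega

end FGordon

/-! ### The conditions for the symmetric part of R -/

namespace FGordon

variable {m n : ℕ} {s : System m}

namespace System

variable {W : Set (J0 m)} {N : J0 m → Matrix (Fin m) (Fin m) ℝ}

theorem Ω_apply (σ α : Fin m) (z v : J0 m) :
    s.Ω σ α z v = (∑ τ, s.C σ α τ z * v.2.2 τ) + s.A σ α z * v.2.1 + s.B σ α z * v.1 := by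
  simp [Ω]

/-- The equations `D_x N_{αβ} = …` and `D_y N_{αβ} = …` together with the vanishing of the
Helmholtz expressions amount to the conditions on the multiplier. -/
theorem conditions_of_total_derivatives (hs : s.SmoothOn W) (hW : IsOpen W)
    (hN : ∀ α β, ContDiffOn ℝ ∞ (fun z => N z α β) W) (hsymm : ∀ z ∈ W, (N z).IsSymm)
    (hx : ∀ j ∈ over1 W, ∀ α β, fderiv ℝ (fun z => N z α β) j.1 (1, 0, j.2.1) =
      -((∑ σ, N j.1 α σ * s.fUy σ β j) + ∑ σ, N j.1 β σ * s.fUy σ α j))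
    (hy : ∀ j ∈ over1 W, ∀ α β, fderiv ℝ (fun z => N z α β) j.1 (0, 1, j.2.2) =
      -((∑ σ, N j.1 α σ * s.fUx σ β j) + ∑ σ, N j.1 β σ * s.fUx σ α j))
    (hh : ∀ j ∈ over1 W, ∀ α β, s.helmholtz N α β j = 0) : s.Conditions W N := by
  have hx' : ∀ z ∈ W, ∀ α β, ∀ c : Fin m → ℝ, fderiv ℝ (fun z => N z α β) z (1, 0, c) =
      ∑ σ, (N z α σ * ((∑ ν, s.C σ ν β z * c ν) + s.B σ β z) +
        N z β σ * ((∑ ν, s.C σ ν α z * c ν) + s.B σ α z)) := by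
    intro z hz α β c
    -- The derivatives of f in u_y do not contain u_y, so its value 0 here is immaterial. The choice
    -- of u_x for the other equation is equally free.
    rw [hx (z, c, 0) hz α β]
    simp only [fUy, ← Finset.sum_add_distrib, ← Finset.sum_neg_distrib]
    exact Finset.sum_congr rfl fun σ _ => by ring
  have hy' : ∀ z ∈ W, ∀ α β, ∀ c : Fin m → ℝ, fderiv ℝ (fun z => N z α β) z (0, 1, c) =
      ∑ σ, (N z α σ * ((∑ ν, s.C σ β ν z * c ν) + s.A σ β z) +
        N z β σ * ((∑ ν, s.C σ α ν z * c ν) + s.A σ α z)) := by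
    intro z hz α β c
    rw [hy (z, 0, c) hz α β]
    simp only [fUx, ← Finset.sum_add_distrib, ← Finset.sum_neg_distrib]
    exact Finset.sum_congr rfl fun σ _ => by ring
  -- Subtracting the value at u_x = 0 isolates the derivative of N in u. The equation in y gives the
  -- same derivative with the lower indices of C interchanged; equating the two is the condition on
  -- S.
  have hux : ∀ z ∈ W, ∀ α β, ∀ c : Fin m → ℝ, fderiv ℝ (fun z => N z α β) z (0, 0, c) =
      ∑ σ, (N z α σ * (∑ ν, s.C σ ν β z * c ν) + N z β σ * (∑ ν, s.C σ ν α z * c ν)) := by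
    intro z hz α β c
    rw [show ((0, 0, c) : J0 m) = (1, 0, c) - (1, 0, 0) by simp, map_sub, hx' z hz, hx' z hz,
      ← Finset.sum_sub_distrib]
    refine Finset.sum_congr rfl fun σ _ => ?_
    simp
    ring
  have huy : ∀ z ∈ W, ∀ α β, ∀ c : Fin m → ℝ, fderiv ℝ (fun z => N z α β) z (0, 0, c) =
      ∑ σ, (N z α σ * (∑ ν, s.C σ β ν z * c ν) + N z β σ * (∑ ν, s.C σ α ν z * c ν)) := by
    intro z hz α β c
    rw [show ((0, 0, c) : J0 m) = (0, 1, c) - (0, 1, 0) by simp, map_sub, hy' z hz, hy' z hz,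
      ← Finset.sum_sub_distrib]
    refine Finset.sum_congr rfl fun σ _ => ?_
    simp
    ring
  refine ⟨hsymm, fun j hj uxx uyy α β => ?_, fun j hj α β γ => ?_, fun z hz α β => ?_⟩
  · have h := sum_H_sub_sum_K hs hW hj (hsymm _ hj) (hx j hj) (hy j hj) α β uxx uyy
    rw [hh j hj, neg_zero] at h
    linarith
  · have h := (hux j.1 hj α β (Pi.single γ 1)).symm.trans (huy j.1 hj α β (Pi.single γ 1))
    simp only [sum_mul_single, Finset.sum_add_distrib] at h
    simp only [S_eq hs hW hj, mul_sub, Finset.sum_sub_distrib]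
    linarith
  · refine (ContDiffOn.differentiableAt_of_isOpen (hN α β) hW hz).hasFDerivAt.congr_fderiv ?_
    refine ContinuousLinearMap.ext fun v => ?_
    obtain ⟨a, b, c⟩ := v
    have hv : ((a, b, c) : J0 m) = a • (1, 0, 0) + b • (0, 1, 0) + (0, 0, c) := by simp
    rw [hv, map_add, map_add, map_smul, map_smul, hx' z hz, hy' z hz, huy z hz, ← hv]
    simp only [sum_apply, add_apply, smul_apply, Ω_apply, smul_eq_mul, Finset.mul_sum,
      ← Finset.sum_add_distrib]
    refine Finset.sum_congr rfl fun σ _ => ?_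
    simp [Finset.sum_add_distrib, ← Finset.mul_sum]
    ring

end System

namespace IsClosedOmega

variable {V : Set (J0 m)} {T P R : EqJet m (n + 2) → Matrix (Fin m) (Fin m) ℝ}

/-- The symmetric part of the coefficient `R`, a function on the base. -/
def symmPart (R : EqJet m (n + 2) → Matrix (Fin m) (Fin m) ℝ) (z : J0 m) :
    Matrix (Fin m) (Fin m) ℝ :=
  Matrix.of fun α β => (R (z, 0) α β + R (z, 0) β α) / 2

theorem contDiffOn_symmPart (h : IsClosedOmega s V T P R) (α β : Fin m) :
    ContDiffOn ℝ ∞ (fun z => symmPart R z α β) V :=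
  ((h.smooth_base α β).add (h.smooth_base β α)).div_const 2

theorem fderiv_symmPart (h : IsClosedOmega s V T P R) (hV : IsOpen V) (α β : Fin m) {z : J0 m}
    (hz : z ∈ V) (v : J0 m) : fderiv ℝ (fun z => symmPart R z α β) z v =
      (fderiv ℝ (fun z => R (z, 0) α β) z v + fderiv ℝ (fun z => R (z, 0) β α) z v) / 2 := by
  have h1 := (ContDiffOn.differentiableAt_of_isOpen (h.smooth_base α β) hV hz).hasFDerivAt
  have h2 := (ContDiffOn.differentiableAt_of_isOpen (h.smooth_base β α) hV hz).hasFDerivAt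
  have h3 := (h1.add h2).mul_const (2⁻¹ : ℝ)
  refine (congrArg (fun D => D v) h3.fderiv).trans ?_
  simp
  ring

theorem R_add_R (α σ : Fin m) (z : J0 m) :
    R (z, 0) α σ + R (z, 0) σ α = 2 * symmPart R z α σ := by
  simp [symmPart]
  ring

/-- A point of the equation manifold over a first-order jet. -/
def liftJ1 (n : ℕ) (j : J1 m) : EqJet m (n + 2) := (j.1, fun _ => j.2.1, fun _ => j.2.2)

theorem P_eq (h : IsClosedOmega s V T P R) (hs : s.SmoothOn V) (hV : IsOpen V) (α β : Fin m) :
    Set.EqOn (fun q => P q α β - P q β α) (fun q => (fun j : J1 m =>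
      fderiv ℝ (fun z => R (z, 0) α β) j.1 (0, 1, j.2.2) +
        2 * ∑ σ, symmPart R j.1 α σ * s.fUx σ β j) q.toJ1) (overEq (n + 2) V) := fun q hq => by
  refine (h.P_antisymm_part hs hV α β hq).trans ?_
  simp only [R_add_R, mul_assoc, ← Finset.mul_sum]
  rfl

theorem T_eq (h : IsClosedOmega s V T P R) (hs : s.SmoothOn V) (hV : IsOpen V) (α β : Fin m) :
    Set.EqOn (fun q => T q α β - T q β α) (fun q => (fun j : J1 m =>
      -(fderiv ℝ (fun z => R (z, 0) β α) j.1 (1, 0, j.2.1) +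
        2 * ∑ σ, symmPart R j.1 α σ * s.fUy σ β j)) q.toJ1) (overEq (n + 2) V) := fun q hq => by
  refine (h.T_antisymm_part hs hV α β hq).trans ?_
  simp only [R_add_R, mul_assoc, ← Finset.mul_sum, neg_add, ← sub_eq_add_neg]
  rfl

/-- Add the formula for the antisymmetric part of P to the one with α, β interchanged: the left
sides cancel. The second and higher derivatives chosen in `liftJ1` do not matter, since the formula
involves only the first-order jet. -/
theorem fderiv_symmPart_y (h : IsClosedOmega s V T P R) (hs : s.SmoothOn V) (hV : IsOpen V)
    {j : J1 m} (hj : j ∈ over1 V) (α β : Fin m) :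
    fderiv ℝ (fun z => symmPart R z α β) j.1 (0, 1, j.2.2) =
      -((∑ σ, symmPart R j.1 α σ * s.fUx σ β j) + ∑ σ, symmPart R j.1 β σ * s.fUx σ α j) := by
  have hq : liftJ1 n j ∈ overEq (n + 2) V := hj
  have h1 : _ = _ := h.P_eq hs hV α β hq
  have h2 : _ = _ := h.P_eq hs hV β α hq
  rw [h.fderiv_symmPart hV α β hj]
  have h3 : (liftJ1 n j).toJ1 = j := rfl
  simp only [h3] at h1 h2
  linarith

theorem fderiv_symmPart_x (h : IsClosedOmega s V T P R) (hs : s.SmoothOn V) (hV : IsOpen V)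
    {j : J1 m} (hj : j ∈ over1 V) (α β : Fin m) :
    fderiv ℝ (fun z => symmPart R z α β) j.1 (1, 0, j.2.1) =
      -((∑ σ, symmPart R j.1 α σ * s.fUy σ β j) + ∑ σ, symmPart R j.1 β σ * s.fUy σ α j) := by
  have hq : liftJ1 n j ∈ overEq (n + 2) V := hj
  have h1 : _ = _ := h.T_eq hs hV α β hq
  have h2 : _ = _ := h.T_eq hs hV β α hq
  rw [h.fderiv_symmPart hV α β hj]
  have h3 : (liftJ1 n j).toJ1 = j := rfl
  simp only [h3] at h1 h2
  linarith

/-- Insert the formulas for the antisymmetric parts of P and T into dω(D_x, D_y, ∂/∂u^α, ∂/∂u^β) =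
0. This produces D_x D_y R_{αβ} + D_y D_x R_{βα}. Since total derivatives commute on base functions
along the equation, it is D_x D_y of twice the symmetric part, which the total x-derivative of
`fderiv_symmPart_y` turns into first-order terms. -/
theorem helmholtz_eq_zero (h : IsClosedOmega s V T P R) (hs : s.SmoothOn V) (hV : IsOpen V)
    {j : J1 m} (hj : j ∈ over1 V) (β α : Fin m) : s.helmholtz (symmPart R) β α j = 0 := by
  have hO := isOpen_over1 hV
  have hq : liftJ1 n j ∈ overEq (n + 2) V := hj
  have h0 := h.extDeriv_totalX_totalY_U_U hs hV α β hq
  have hN := h.contDiffOn_symmPart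
  have dr : ∀ α β, ContDiffOn ℝ ∞ (fun j : J1 m => fderiv ℝ (fun z => R (z, 0) α β) j.1) (over1 V) :=
    fun α β => ((h.smooth_base α β).fderiv_of_isOpen hV (m := ∞) (by simp)).comp contDiffOn_fst
      fun _ h => h
  have drx : ∀ α β, DifferentiableAt ℝ
      (fun j : J1 m => fderiv ℝ (fun z => R (z, 0) α β) j.1 (1, 0, j.2.1)) j := fun α β =>
    ContDiffOn.differentiableAt_of_isOpen ((dr α β).clm_apply (by fun_prop)) hO hj
  have dry : ∀ α β, DifferentiableAt ℝ
      (fun j : J1 m => fderiv ℝ (fun z => R (z, 0) α β) j.1 (0, 1, j.2.2)) j := fun α β =>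
    ContDiffOn.differentiableAt_of_isOpen ((dr α β).clm_apply (by fun_prop)) hO hj
  have dfx : ∀ α β, DifferentiableAt ℝ
      (fun j : J1 m => ∑ σ, symmPart R j.1 α σ * s.fUx σ β j) j := fun α β =>
    ContDiffOn.differentiableAt_of_isOpen (ContDiffOn.sum fun σ _ =>
      (System.contDiffOn_comp_fst (hN α σ)).mul (hs.fUx σ β)) hO hj
  have dfy : ∀ α β, DifferentiableAt ℝ
      (fun j : J1 m => ∑ σ, symmPart R j.1 α σ * s.fUy σ β j) j := fun α β =>
    ContDiffOn.differentiableAt_of_isOpen (ContDiffOn.sum fun σ _ =>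
      (System.contDiffOn_comp_fst (hN α σ)).mul (hs.fUy σ β)) hO hj
  have hqj : (liftJ1 n j).toJ1 = j := rfl
  have hX : (totalX s (liftJ1 n j)).toJ1 = ((1, 0, j.2.1), j.2.1, fun β => s.f β j) :=
    toJ1_totalX _
  have hY : (totalY s (liftJ1 n j)).toJ1 = ((0, 1, j.2.2), (fun β => s.f β j), j.2.2) :=
    toJ1_totalY _
  have eP : fderiv ℝ (fun q => P q α β - P q β α) (liftJ1 n j) (totalX s (liftJ1 n j)) =
      fderiv ℝ (fun j : J1 m => fderiv ℝ (fun z => R (z, 0) α β) j.1 (0, 1, j.2.2) +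
        2 * ∑ σ, symmPart R j.1 α σ * s.fUx σ β j) j
        ((1, 0, j.2.1), j.2.1, fun β => s.f β j) := by
    rw [fderiv_eq_of_eqOn_open (isOpen_overEq hV _) (h.P_eq hs hV α β) hq, ← hX]
    exact fderiv_comp_toJ1 (q := liftJ1 n j) ((dry α β).fun_add ((dfx α β).const_mul 2)) _
  have eT : fderiv ℝ (fun q => T q α β - T q β α) (liftJ1 n j) (totalY s (liftJ1 n j)) =
      -fderiv ℝ (fun j : J1 m => fderiv ℝ (fun z => R (z, 0) β α) j.1 (1, 0, j.2.1) +
        2 * ∑ σ, symmPart R j.1 α σ * s.fUy σ β j) j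
        ((0, 1, j.2.2), (fun β => s.f β j), j.2.2) := by
    rw [fderiv_eq_of_eqOn_open (isOpen_overEq hV _) (h.T_eq hs hV α β) hq, ← hY, ← neg_apply,
      ← fderiv_fun_neg]
    exact fderiv_comp_toJ1 (q := liftJ1 n j) ((drx β α).fun_add ((dfy α β).const_mul 2)).fun_neg _
  rw [eP, eT, hqj, fderiv_fun_add (dry α β) ((dfx α β).const_mul 2),
    fderiv_fun_add (drx β α) ((dfy α β).const_mul 2), fderiv_const_mul (dfx α β),
    fderiv_const_mul (dfy α β)] at h0
  -- the total `x`-derivative of the equation for the total `y`-derivative of the symmetric part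
  have h1 : Set.EqOn (fun j : J1 m => fderiv ℝ (fun z => R (z, 0) α β) j.1 (0, 1, j.2.2) +
        fderiv ℝ (fun z => R (z, 0) β α) j.1 (0, 1, j.2.2))
      (fun j => -(2 * ((∑ σ, symmPart R j.1 α σ * s.fUx σ β j) +
        ∑ σ, symmPart R j.1 β σ * s.fUx σ α j))) (over1 V) := by
    intro j hj
    have := h.fderiv_symmPart_y hs hV hj α β
    rw [h.fderiv_symmPart hV α β hj] at this
    simp only
    linarith
  have h2 := congrArg (fun D => D ((1, 0, j.2.1), j.2.1, fun β => s.f β j))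
    (fderiv_eq_of_eqOn_open hO h1 hj)
  simp only [fderiv_fun_neg] at h2
  rw [fderiv_fun_add (dry α β) (dry β α), fderiv_const_mul ((dfx α β).fun_add (dfx β α)),
    fderiv_fun_add (dfx α β) (dfx β α)] at h2
  simp only [add_apply, neg_apply, smul_apply, smul_eq_mul,
    System.fderiv_sum_mul_fUx hs hV hN hj, System.fderiv_sum_mul_fUy hs hV hN hj,
    fderiv_fderiv_y hV (h.smooth_base _ _) hj, fderiv_fderiv_x hV (h.smooth_base _ _) hj] at h0 h2
  have h3 := fderiv_fderiv_comm (h.smooth_base β α) hV hj (1, 0, j.2.1) (0, 1, j.2.2)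
  simp only [R_add_R, mul_assoc, ← Finset.mul_sum] at h0
  have hb : (liftJ1 n j).1 = j.1 := rfl
  simp only [hb] at h0
  rw [System.helmholtz]
  linarith

theorem conditions (h : IsClosedOmega s V T P R) (hs : s.SmoothOn V) (hV : IsOpen V) :
    s.Conditions V (symmPart R) :=
  System.conditions_of_total_derivatives hs hV h.contDiffOn_symmPart
    (fun z _ => by ext α β; simp [symmPart, add_comm])
    (fun _ hj α β => h.fderiv_symmPart_x hs hV hj α β)
    (fun _ hj α β => h.fderiv_symmPart_y hs hV hj α β)
    fun _ hj α β => h.helmholtz_eq_zero hs hV hj α β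

end IsClosedOmega

end FGordon

/-! ### The closed form of a Lagrangian -/

namespace FGordon

open Filter Topology

variable {m n : ℕ} {s : System m}

/-- Expansion in the frame dual to the coframe dx, dy, θ, θ_x, θ_y: the total derivatives on the
equation together with the fibre coordinate vectors. -/
theorem toJ1_eq_contact (q v : EqJet m (n + 2)) : v.toJ1 =
    v.1.1 • ((1, 0, q.2.1 0), q.2.1 1, fun β => s.f β q.toJ1) +
      v.1.2.1 • ((0, 1, q.2.2 0), (fun β => s.f β q.toJ1), q.2.2 1) +
      ∑ β, (θ β q v • eU β + θx s β q v • eUx β + θy s β q v • eUy β) := by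
  ext i <;>
    simp [EqJet.toJ1, Prod.fst_sum, Prod.snd_sum, eU, eUx, eUy, Pi.single_apply, θ_apply, θx_apply,
      θy_apply] <;> ring

/-- The differential of a first-order function in the contact coframe. -/
theorem fderiv_toJ1_eq_contact (g : J1 m → ℝ) (q v : EqJet m (n + 2)) :
    fderiv ℝ g q.toJ1 v.toJ1 = v.1.1 * Dx g q.toJ1 (q.2.1 1) (fun β => s.f β q.toJ1) +
      v.1.2.1 * Dy g q.toJ1 (fun β => s.f β q.toJ1) (q.2.2 1) +
      ∑ β, (pd (eU β) g q.toJ1 * θ β q v + pd (eUx β) g q.toJ1 * θx s β q v +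
        pd (eUy β) g q.toJ1 * θy s β q v) := by
  rw [toJ1_eq_contact (s := s) q v]
  simp only [map_add, map_sum, map_smul, smul_eq_mul, pd, Dx, Dy, mul_comm]
  rfl

theorem sum_mul_wedge3_right {F : Type*} [NormedAddCommGroup F] [NormedSpace ℝ F]
    (k : Fin m → ℝ) (a b : F →L[ℝ] ℝ) (c : Fin m → F →L[ℝ] ℝ) (v : Fin 3 → F) :
    ∑ β, k β * wedge3 a b (c β) v = wedge3 a b (∑ β, k β • c β) v := by
  simp only [wedge3_apply, sum_apply, smul_apply, smul_eq_mul, Finset.mul_sum,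
    ← Finset.sum_sub_distrib, ← Finset.sum_add_distrib]
  exact Finset.sum_congr rfl fun β _ => by ring

theorem sum_mul_wedge3_mid {F : Type*} [NormedAddCommGroup F] [NormedSpace ℝ F]
    (k : Fin m → ℝ) (a b : F →L[ℝ] ℝ) (c : Fin m → F →L[ℝ] ℝ) (v : Fin 3 → F) :
    ∑ β, k β * wedge3 a (c β) b v = wedge3 a (∑ β, k β • c β) b v := by
  simp only [wedge3_apply, sum_apply, smul_apply, smul_eq_mul, Finset.mul_sum, Finset.sum_mul,
    ← Finset.sum_sub_distrib, ← Finset.sum_add_distrib]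
  exact Finset.sum_congr rfl fun β _ => by ring

theorem omega_apply_sum (T P R : EqJet m (n + 2) → Matrix (Fin m) (Fin m) ℝ) (q : EqJet m (n + 2))
    (v : Fin 3 → EqJet m (n + 2)) : omega s T P R q v =
      ∑ α, (wedge3 dX (θ α q) (∑ β, T q α β • θ β q) v + wedge3 dY (θ α q) (∑ β, P q α β • θ β q) v +
        (wedge3 (θ α q) (∑ β, R q α β • θx s β q) dX v -
          wedge3 (θ α q) (∑ β, R q β α • θy s β q) dY v)) := by
  rw [omega_apply]
  simp only [Finset.sum_add_distrib, mul_sub, Finset.sum_sub_distrib, ← sum_mul_wedge3_right,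
    ← sum_mul_wedge3_mid]
  congr 2
  exact Finset.sum_comm

theorem omega_const_smul (c : ℝ) (T P R : EqJet m (n + 2) → Matrix (Fin m) (Fin m) ℝ) :
    omega s (fun q => c • T q) (fun q => c • P q) (fun q => c • R q) = c • omega s T P R := by
  funext q
  ext v
  simp only [Pi.smul_apply, ContinuousAlternatingMap.smul_apply, omega_apply, smul_eq_mul,
    Matrix.smul_apply, Finset.mul_sum]
  exact Finset.sum_congr rfl fun α _ => Finset.sum_congr rfl fun β _ => by ring

theorem IsClosedOmega.const_smul {V : Set (J0 m)}
    {T P R : EqJet m (n + 2) → Matrix (Fin m) (Fin m) ℝ}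
    (h : IsClosedOmega s V T P R) (c : ℝ) :
    IsClosedOmega s V (fun q => c • T q) (fun q => c • P q) (fun q => c • R q) where
  smooth_T α β := contDiffOn_const.mul (h.smooth_T α β)
  smooth_P α β := contDiffOn_const.mul (h.smooth_P α β)
  smooth_R α β := contDiffOn_const.mul (h.smooth_R α β)
  closed q hq := by
    rw [omega_const_smul, extDeriv_smul, h.closed q hq, smul_zero]

section Lagrangian

variable {V : Set (J0 m)} {L : J1 m → ℝ}

/-- The form `L dx ∧ dy + L_{u^α_x} θ^α ∧ dy - L_{u^α_y} θ^α ∧ dx`. -/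
def lagrangeForm (L : J1 m → ℝ) (q : EqJet m (n + 2)) : EqJet m (n + 2) [⋀^Fin 2]→L[ℝ] ℝ :=
  L q.toJ1 • wedgeProd ![dX, dY] + ∑ α, (pd (eUx α) L q.toJ1 • wedgeProd ![θ α q, dY] -
    pd (eUy α) L q.toJ1 • wedgeProd ![θ α q, dX])

theorem contDiffOn_lagrangeForm (hV : IsOpen V) (hL : ContDiffOn ℝ ∞ L (over1 V)) :
    ContDiffOn ℝ ∞ (lagrangeForm L : EqJet m (n + 2) → _) (overEq (n + 2) V) := by
  have hθ : ∀ α, ContDiffOn ℝ ∞ (θ α : EqJet m (n + 2) → _) (overEq (n + 2) V) :=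
    fun α => (contDiff_θ α).contDiffOn
  have hp : ∀ e, ContDiffOn ℝ ∞ (fun q : EqJet m (n + 2) => pd e L q.toJ1) (overEq (n + 2) V) :=
    fun e => ContDiffOn.comp_toJ1 (ContDiffOn.pd hL (isOpen_over1 hV) e)
  refine ((ContDiffOn.comp_toJ1 hL).smul contDiffOn_const).add (ContDiffOn.sum fun α _ => ?_)
  exact ((hp _).smul (ContDiffOn.wedge2 (hθ α) contDiffOn_const)).sub
    ((hp _).smul (ContDiffOn.wedge2 (hθ α) contDiffOn_const))

theorem hasFDerivAt_θ (α : Fin m) (q v : EqJet m (n + 2)) :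
    HasFDerivAt (fun q => θ α q v) (-(v.1.1 • dUX 0 α) - v.1.2.1 • dUY 0 α) q := by
  have h := ((hasFDerivAt_const (v.1.2.2 α) q).sub
    ((dUX 0 α : EqJet m (n + 2) →L[ℝ] ℝ).hasFDerivAt.mul_const v.1.1)).sub
    ((dUY 0 α : EqJet m (n + 2) →L[ℝ] ℝ).hasFDerivAt.mul_const v.1.2.1)
  exact h.congr_fderiv (by simp)

theorem lagrangeForm_apply (q v w : EqJet m (n + 2)) : lagrangeForm L q ![v, w] =
    L q.toJ1 * (v.1.1 * w.1.2.1 - w.1.1 * v.1.2.1) +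
      ∑ α, (pd (eUx α) L q.toJ1 * (θ α q v * w.1.2.1 - θ α q w * v.1.2.1) -
        pd (eUy α) L q.toJ1 * (θ α q v * w.1.1 - θ α q w * v.1.1)) := by
  simp [lagrangeForm, wedgeProd_two_apply, dX_apply, dY_apply]

theorem fderiv_lagrangeForm_apply (hV : IsOpen V) (hL : ContDiffOn ℝ ∞ L (over1 V))
    {q : EqJet m (n + 2)} (hq : q ∈ overEq (n + 2) V) (u v w : EqJet m (n + 2)) :
    fderiv ℝ (fun q => lagrangeForm L q ![v, w]) q u =
      fderiv ℝ L q.toJ1 u.toJ1 * (v.1.1 * w.1.2.1 - w.1.1 * v.1.2.1) +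
      ∑ α, (fderiv ℝ (pd (eUx α) L) q.toJ1 u.toJ1 * (θ α q v * w.1.2.1 - θ α q w * v.1.2.1) -
        fderiv ℝ (pd (eUy α) L) q.toJ1 u.toJ1 * (θ α q v * w.1.1 - θ α q w * v.1.1) -
        (pd (eUx α) L q.toJ1 * u.2.1 0 α + pd (eUy α) L q.toJ1 * u.2.2 0 α) *
          (v.1.1 * w.1.2.1 - w.1.1 * v.1.2.1)) := by
  have hO := isOpen_over1 hV
  have hc : ∀ {g : J1 m → ℝ}, ContDiffOn ℝ ∞ g (over1 V) →
      HasFDerivAt (fun q : EqJet m (n + 2) => g q.toJ1) (fderiv ℝ g q.toJ1 ∘L toJ1L) q :=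
    fun {g} hg => HasFDerivAt.comp (g := g) (f := toJ1L) q
      (ContDiffOn.differentiableAt_of_isOpen hg hO hq).hasFDerivAt toJ1L.hasFDerivAt
  have h := ((hc hL).mul_const (v.1.1 * w.1.2.1 - w.1.1 * v.1.2.1)).add
    (HasFDerivAt.fun_sum (u := Finset.univ) fun α _ =>
      ((hc (ContDiffOn.pd hL hO (eUx α))).mul (((hasFDerivAt_θ α q v).mul_const w.1.2.1).sub
        ((hasFDerivAt_θ α q w).mul_const v.1.2.1))).sub
      ((hc (ContDiffOn.pd hL hO (eUy α))).mul (((hasFDerivAt_θ α q v).mul_const w.1.1).sub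
        ((hasFDerivAt_θ α q w).mul_const v.1.1))))
  simp only [lagrangeForm_apply]
  refine (congrArg (fun D => D u) h.fderiv).trans ?_
  simp only [add_apply, smul_apply, sum_apply, sub_apply, neg_apply, ContinuousLinearMap.comp_apply,
    toJ1L_apply, smul_eq_mul]
  congr 1
  · ring
  · refine Finset.sum_congr rfl fun α _ => ?_
    simp [dUX, dUY]
    ring

/-- Expand all differentials in the contact coframe. The vanishing pure second derivatives remove
the terms θ_x ∧ θ ∧ dy and θ_y ∧ θ ∧ dx, which `omega` does not contain. The Euler–Lagrange equation
removes θ ∧ dx ∧ dy, and the symmetry of mixed derivatives gives the two R-terms a common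
coefficient. -/
theorem extDeriv_lagrangeForm (hV : IsOpen V) (hL : ContDiffOn ℝ ∞ L (over1 V))
    (hpp : ∀ j ∈ over1 V, ∀ α β, pd (eUx β) (pd (eUx α) L) j = 0)
    (hqq : ∀ j ∈ over1 V, ∀ α β, pd (eUy β) (pd (eUy α) L) j = 0)
    (hE : ∀ j ∈ over1 V, ∀ (uxx uyy : Fin m → ℝ) (α : Fin m),
      eulerLagrange L α j uxx (fun β => s.f β j) uyy = 0)
    {q : EqJet m (n + 2)} (hq : q ∈ overEq (n + 2) V) :
    extDeriv (lagrangeForm L) q =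
      omega s (fun q => Matrix.of fun α β => pd (eU β) (pd (eUy α) L) q.toJ1)
        (fun q => Matrix.of fun α β => -pd (eU β) (pd (eUx α) L) q.toJ1)
        (fun q => Matrix.of fun α β => pd (eUx β) (pd (eUy α) L) q.toJ1) q := by
  have hO := isOpen_over1 hV
  have hj : q.toJ1 ∈ over1 V := hq
  have hd : DifferentiableAt ℝ (lagrangeForm L : EqJet m (n + 2) → _) q :=
    ContDiffOn.differentiableAt_of_isOpen (contDiffOn_lagrangeForm hV hL) (isOpen_overEq hV _) hq
  have hcomm : ∀ α β, pd (eUx α) (pd (eUy β) L) q.toJ1 = pd (eUy β) (pd (eUx α) L) q.toJ1 :=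
    fun α β => fderiv_fderiv_comm hL hO hj (eUy β) (eUx α)
  have hu : ∀ α, pd (eU α) L q.toJ1 =
      Dx (pd (eUx α) L) q.toJ1 (q.2.1 1) (fun β => s.f β q.toJ1) +
        Dy (pd (eUy α) L) q.toJ1 (fun β => s.f β q.toJ1) (q.2.2 1) := fun α => by
    have := hE _ hj (q.2.1 1) (q.2.2 1) α
    rw [eulerLagrange] at this
    linarith
  have hg : ∀ α (v : EqJet m (n + 2)), fderiv ℝ (pd (eUx α) L) q.toJ1 v.toJ1 =
      v.1.1 * Dx (pd (eUx α) L) q.toJ1 (q.2.1 1) (fun β => s.f β q.toJ1) +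
      v.1.2.1 * Dy (pd (eUx α) L) q.toJ1 (fun β => s.f β q.toJ1) (q.2.2 1) +
      (∑ β, pd (eU β) (pd (eUx α) L) q.toJ1 * θ β q v) +
      ∑ β, pd (eUy β) (pd (eUx α) L) q.toJ1 * θy s β q v := fun α v => by
    rw [fderiv_toJ1_eq_contact (s := s)]
    simp [hpp _ hj, Finset.sum_add_distrib, add_assoc]
  have hh : ∀ α (v : EqJet m (n + 2)), fderiv ℝ (pd (eUy α) L) q.toJ1 v.toJ1 =
      v.1.1 * Dx (pd (eUy α) L) q.toJ1 (q.2.1 1) (fun β => s.f β q.toJ1) +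
      v.1.2.1 * Dy (pd (eUy α) L) q.toJ1 (fun β => s.f β q.toJ1) (q.2.2 1) +
      (∑ β, pd (eU β) (pd (eUy α) L) q.toJ1 * θ β q v) +
      ∑ β, pd (eUx β) (pd (eUy α) L) q.toJ1 * θx s β q v := fun α v => by
    rw [fderiv_toJ1_eq_contact (s := s)]
    simp [hqq _ hj, Finset.sum_add_distrib, add_assoc]
  have hl : ∀ v : EqJet m (n + 2), fderiv ℝ L q.toJ1 v.toJ1 =
      v.1.1 * Dx L q.toJ1 (q.2.1 1) (fun β => s.f β q.toJ1) +
      v.1.2.1 * Dy L q.toJ1 (fun β => s.f β q.toJ1) (q.2.2 1) +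
      ∑ β, (pd (eU β) L q.toJ1 * θ β q v + pd (eUx β) L q.toJ1 * θx s β q v +
        pd (eUy β) L q.toJ1 * θy s β q v) := fun v => fderiv_toJ1_eq_contact _ _ _
  ext v
  have hv : v = ![v 0, v 1, v 2] := by
    ext i : 1
    fin_cases i <;> rfl
  rw [hv, extDeriv_two_apply hd, fderiv_lagrangeForm_apply hV hL hq,
    fderiv_lagrangeForm_apply hV hL hq, fderiv_lagrangeForm_apply hV hL hq, omega_apply_sum]
  generalize v 0 = u, v 1 = v, v 2 = w
  set S : EqJet m (n + 2) → ℝ := fun v => ∑ β, (pd (eU β) L q.toJ1 * θ β q v +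
    pd (eUx β) L q.toJ1 * θx s β q v + pd (eUy β) L q.toJ1 * θy s β q v) with hS
  -- The dx and dy components of dL disappear after wedging with dx ∧ dy.
  have hcyc : ∀ a b A B C : ℝ,
      (u.1.1 * a + u.1.2.1 * b + S u) * (v.1.1 * w.1.2.1 - w.1.1 * v.1.2.1) + A -
        ((v.1.1 * a + v.1.2.1 * b + S v) * (u.1.1 * w.1.2.1 - w.1.1 * u.1.2.1) + B) +
        ((w.1.1 * a + w.1.2.1 * b + S w) * (u.1.1 * v.1.2.1 - v.1.1 * u.1.2.1) + C) =
      S u * (v.1.1 * w.1.2.1 - w.1.1 * v.1.2.1) - S v * (u.1.1 * w.1.2.1 - w.1.1 * u.1.2.1) +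
        S w * (u.1.1 * v.1.2.1 - v.1.1 * u.1.2.1) + A - B + C := fun a b A B C => by ring
  rw [hl, hl, hl, hcyc]
  simp only [hS, Finset.sum_mul, ← Finset.sum_sub_distrib, ← Finset.sum_add_distrib]
  refine Finset.sum_congr rfl fun α _ => ?_
  simp only [hu, hg, hh, wedge3_apply, sum_apply, smul_apply, smul_eq_mul, Matrix.of_apply, hcomm,
    neg_mul, Finset.sum_neg_distrib, Matrix.cons_val, dX_apply, dY_apply]
  simp only [θx_apply α, θy_apply α]
  ring

theorem isClosedOmega_of_lagrangian (hV : IsOpen V) (hL : ContDiffOn ℝ ∞ L (over1 V))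
    (hpp : ∀ j ∈ over1 V, ∀ α β, pd (eUx β) (pd (eUx α) L) j = 0)
    (hqq : ∀ j ∈ over1 V, ∀ α β, pd (eUy β) (pd (eUy α) L) j = 0)
    (hE : ∀ j ∈ over1 V, ∀ (uxx uyy : Fin m → ℝ) (α : Fin m),
      eulerLagrange L α j uxx (fun β => s.f β j) uyy = 0) :
    IsClosedOmega (n := n) s V (fun q => Matrix.of fun α β => pd (eU β) (pd (eUy α) L) q.toJ1)
        (fun q => Matrix.of fun α β => -pd (eU β) (pd (eUx α) L) q.toJ1)
        (fun q => Matrix.of fun α β => pd (eUx β) (pd (eUy α) L) q.toJ1) where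
  smooth_T α β := ContDiffOn.comp_toJ1 (ContDiffOn.pd (ContDiffOn.pd hL (isOpen_over1 hV) _)
    (isOpen_over1 hV) _)
  smooth_P α β := (ContDiffOn.comp_toJ1 (ContDiffOn.pd (ContDiffOn.pd hL (isOpen_over1 hV) _)
    (isOpen_over1 hV) _)).neg
  smooth_R α β := ContDiffOn.comp_toJ1 (ContDiffOn.pd (ContDiffOn.pd hL (isOpen_over1 hV) _)
    (isOpen_over1 hV) _)
  closed q hq := by
    have hO := isOpen_overEq hV (n + 2)
    have h : extDeriv (lagrangeForm L : EqJet m (n + 2) → _) =ᶠ[𝓝 q] omega s _ _ _ :=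
      eventuallyEq_of_eqOn_open hO (fun q hq => extDeriv_lagrangeForm hV hL hpp hqq hE hq) hq
    rw [← h.extDeriv_eq]
    exact extDeriv_extDeriv_apply ((contDiffOn_lagrangeForm hV hL).contDiffAt (hO.mem_nhds hq))
      (by simp; exact WithTop.coe_le_coe.2 le_top)

theorem Dx_eq (g : J1 m → ℝ) (j : J1 m) (uxx uxy : Fin m → ℝ) : Dx g j uxx uxy =
    fderiv ℝ g j ((1, 0, j.2.1), 0) + (∑ β, uxx β * pd (eUx β) g j) +
      ∑ β, uxy β * pd (eUy β) g j := by
  have : (((1, 0, j.2.1), uxx, uxy) : J1 m) =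
      ((1, 0, j.2.1), 0) + (∑ β, uxx β • eUx β) + ∑ β, uxy β • eUy β := by
    ext i <;> simp [Prod.fst_sum, Prod.snd_sum, eUx, eUy, Pi.single_apply]
  rw [Dx, this]
  simp only [map_add, map_sum, map_smul, smul_eq_mul, pd]

theorem Dy_eq (g : J1 m → ℝ) (j : J1 m) (uxy uyy : Fin m → ℝ) : Dy g j uxy uyy =
    fderiv ℝ g j ((0, 1, j.2.2), 0) + (∑ β, uxy β * pd (eUx β) g j) +
      ∑ β, uyy β * pd (eUy β) g j := by
  have : (((0, 1, j.2.2), uxy, uyy) : J1 m) =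
      ((0, 1, j.2.2), 0) + (∑ β, uxy β • eUx β) + ∑ β, uyy β • eUy β := by
    ext i <;> simp [Prod.fst_sum, Prod.snd_sum, eUx, eUy, Pi.single_apply]
  rw [Dy, this]
  simp only [map_add, map_sum, map_smul, smul_eq_mul, pd]

/-- Displays the affine dependence on the second derivatives. Comparing coefficients with M (u_xy -
f) then gives the three relations on the second fibre derivatives of L. -/
theorem eulerLagrange_eq (α : Fin m) (j : J1 m) (uxx uxy uyy : Fin m → ℝ) :
    eulerLagrange L α j uxx uxy uyy = eulerLagrange L α j 0 0 0 -
      (∑ β, uxx β * pd (eUx β) (pd (eUx α) L) j) - (∑ β, uyy β * pd (eUy β) (pd (eUy α) L) j) -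
      ∑ β, uxy β * (pd (eUy β) (pd (eUx α) L) j + pd (eUx β) (pd (eUy α) L) j) := by
  simp only [eulerLagrange, Dx_eq, Dy_eq, mul_add, Finset.sum_add_distrib]
  simp
  ring

theorem sum_single_mul (β : Fin m) (a : Fin m → ℝ) :
    ∑ ν, (Pi.single β (1 : ℝ) : Fin m → ℝ) ν * a ν = a β := by
  simp [Pi.single_apply]

variable {M : Matrix (Fin m) (Fin m) ℝ}

theorem pd_eUx_pd_eUx_of_eulerLagrange {j : J1 m} {α : Fin m} (h : ∀ uxx uxy uyy : Fin m → ℝ,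
    eulerLagrange L α j uxx uxy uyy = ∑ β, M α β * (uxy β - s.f β j)) (β : Fin m) :
    pd (eUx β) (pd (eUx α) L) j = 0 := by
  have h1 := h (Pi.single β 1) 0 0
  rw [eulerLagrange_eq, h 0 0 0, sum_single_mul] at h1
  simp at h1
  exact h1

theorem pd_eUy_pd_eUy_of_eulerLagrange {j : J1 m} {α : Fin m} (h : ∀ uxx uxy uyy : Fin m → ℝ,
    eulerLagrange L α j uxx uxy uyy = ∑ β, M α β * (uxy β - s.f β j)) (β : Fin m) :
    pd (eUy β) (pd (eUy α) L) j = 0 := by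
  have h1 := h 0 0 (Pi.single β 1)
  rw [eulerLagrange_eq, h 0 0 0, sum_single_mul] at h1
  simp at h1
  exact h1

theorem pd_eUy_pd_eUx_of_eulerLagrange {j : J1 m} {α : Fin m} (h : ∀ uxx uxy uyy : Fin m → ℝ,
    eulerLagrange L α j uxx uxy uyy = ∑ β, M α β * (uxy β - s.f β j)) (β : Fin m) :
    pd (eUy β) (pd (eUx α) L) j + pd (eUx β) (pd (eUy α) L) j = -M α β := by
  have h1 := h 0 (Pi.single β 1) 0
  rw [eulerLagrange_eq, h 0 0 0, sum_single_mul] at h1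
  simp only [mul_sub, Finset.sum_sub_distrib, sum_mul_single] at h1
  simp at h1
  linarith

/-- A Lagrangian for the multiplier `M` yields a closed form with symmetric part `M`. -/
theorem exists_isClosedOmega_of_hasLagrangian (hV : IsOpen V) {M : J1 m → Matrix (Fin m) (Fin m) ℝ}
    (h : s.HasLagrangian V M) (n : ℕ) :
    ∃ T P R : EqJet m (n + 2) → Matrix (Fin m) (Fin m) ℝ, IsClosedOmega s V T P R ∧
      ∀ q ∈ overEq (n + 2) V, ∀ α β, (R q α β + R q β α) / 2 = M q.toJ1 α β := by
  obtain ⟨L, hL, hE⟩ := h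
  have hO := isOpen_over1 hV
  -- The coefficient R of the form of L is L_{u^β_x u^α_y}. Its symmetric part is half of a sum that
  -- equals -M_{αβ}, hence the factor -2.
  have hcl := (isClosedOmega_of_lagrangian (s := s) (n := n) hV hL
    (fun j hj α β => pd_eUx_pd_eUx_of_eulerLagrange (fun a b c => hE j hj a b c α) β)
    (fun j hj α β => pd_eUy_pd_eUy_of_eulerLagrange (fun a b c => hE j hj a b c α) β)
    fun j hj uxx uyy α => by rw [hE j hj]; simp).const_smul (-2)
  refine ⟨_, _, _, hcl, fun q hq α β => ?_⟩
  have h1 := pd_eUy_pd_eUx_of_eulerLagrange (fun a b c => hE q.toJ1 hq a b c α) β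
  have h2 : pd (eUx α) (pd (eUy β) L) q.toJ1 = pd (eUy β) (pd (eUx α) L) q.toJ1 :=
    fderiv_fderiv_comm hL hO (x := q.toJ1) hq (eUy β) (eUx α)
  simp [h2]
  linarith

end Lagrangian

end FGordon

/-! ### The three-form of a multiplier -/

namespace FGordon

variable {m : ℕ}

/-- The trilinear form with coefficients `c`. -/
def tri (c : Fin m → Fin m → Fin m → ℝ) (x y w : Fin m → ℝ) : ℝ :=
  ∑ α, ∑ β, ∑ γ, c α β γ * (x α * y β * w γ)

/-- The bilinear form with coefficients `a`. -/
def bil (a : Fin m → Fin m → ℝ) (x y : Fin m → ℝ) : ℝ := ∑ α, ∑ β, a α β * (x α * y β)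

/-- The linear form with coefficients `e`. -/
def lin (e : Fin m → ℝ) (x : Fin m → ℝ) : ℝ := ∑ α, e α * x α

namespace System

variable (s : System m) (N : J0 m → Matrix (Fin m) (Fin m) ℝ)

/-- The coefficients `N_{ασ} C^σ_{βγ}`. -/
def lowC (z : J0 m) (α β γ : Fin m) : ℝ := ∑ σ, N z α σ * s.C σ β γ z

/-- The coefficients `N_{ασ} A^σ_β`. -/
def lowA (z : J0 m) (α β : Fin m) : ℝ := ∑ σ, N z α σ * s.A σ β z

/-- The coefficients `N_{ασ} B^σ_β`. -/
def lowB (z : J0 m) (α β : Fin m) : ℝ := ∑ σ, N z α σ * s.B σ β z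

/-- The coefficients `N_{ασ} E^σ`. -/
def lowE (z : J0 m) (α : Fin m) : ℝ := ∑ σ, N z α σ * s.E σ z

variable {s N} {W : Set (J0 m)}

theorem contDiffOn_Ω (hs : s.SmoothOn W) (σ α : Fin m) : ContDiffOn ℝ ∞ (s.Ω σ α) W := by
  unfold Ω
  exact ((ContDiffOn.sum fun τ _ => (hs.1 σ α τ).smul contDiffOn_const).add
    ((hs.2.1 σ α).smul contDiffOn_const)).add ((hs.2.2.1 σ α).smul contDiffOn_const)

/-- Bootstrap: the equation expresses dN through N and smooth forms, so N of class C^k is of class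
C^(k+1). -/
theorem Conditions.contDiffOn (h : s.Conditions W N) (hs : s.SmoothOn W) (hW : IsOpen W)
    (α β : Fin m) : ContDiffOn ℝ ∞ (fun z => N z α β) W := by
  rw [contDiffOn_infty]
  intro k
  induction k generalizing α β with
  | zero =>
    rw [Nat.cast_zero, contDiffOn_zero]
    exact fun z hz => (h.deriv z hz α β).continuousAt.continuousWithinAt
  | succ k ih =>
    rw [show ((k + 1 : ℕ) : WithTop ℕ∞) = (k : WithTop ℕ∞) + 1 from rfl,
      contDiffOn_succ_iff_fderiv_of_isOpen hW]
    refine ⟨fun z hz => (h.deriv z hz α β).differentiableAt.differentiableWithinAt, by simp, ?_⟩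
    have hΩ : ∀ σ α, ContDiffOn ℝ k (s.Ω σ α) W := fun σ α =>
      (contDiffOn_Ω hs σ α).of_le (by exact_mod_cast le_top)
    refine ContDiffOn.congr (f := fun z => ∑ σ, (N z α σ • s.Ω σ β z + N z β σ • s.Ω σ α z)) ?_
      fun z hz => (h.deriv z hz α β).fderiv
    exact ContDiffOn.sum fun σ _ => ((ih α σ).smul (hΩ σ β)).add ((ih β σ).smul (hΩ σ α))

theorem Conditions.fderiv_apply (h : s.Conditions W N) {z : J0 m} (hz : z ∈ W) (α β : Fin m)
    (v : J0 m) : fderiv ℝ (fun w => N w α β) z v =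
      (∑ γ, (s.lowC N z α β γ + s.lowC N z β α γ) * v.2.2 γ) +
        (s.lowA N z α β + s.lowA N z β α) * v.2.1 + (s.lowB N z α β + s.lowB N z β α) * v.1 := by
  rw [(h.deriv z hz α β).fderiv]
  simp only [lowC, lowA, lowB, sum_apply, add_apply, smul_apply, Ω_apply, smul_eq_mul, mul_add,
    Finset.sum_add_distrib, add_mul, Finset.sum_mul, Finset.mul_sum]
  rw [Finset.sum_comm (f := fun x i => N z α x * (s.C x β i z * v.2.2 i)),
    Finset.sum_comm (f := fun x i => N z β x * (s.C x α i z * v.2.2 i))]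
  simp only [mul_assoc]
  ring

/-- The lowered torsion is skew in its first two indices. It is skew in the last two by definition,
so it is a three-form. -/
theorem Conditions.lowC_skew (h : s.Conditions W N) (hs : s.SmoothOn W) (hW : IsOpen W) {z : J0 m}
    (hz : z ∈ W) (α β γ : Fin m) : s.lowC N z α β γ - s.lowC N z α γ β =
      -(s.lowC N z β α γ - s.lowC N z β γ α) := by
  have hj : ((z, 0, 0) : J1 m) ∈ over1 W := hz
  have h1 := h.skew _ hj α β γ
  simp only [S_eq hs hW hj, mul_sub, Finset.sum_sub_distrib] at h1
  exact h1

theorem Conditions.tri_skew (h : s.Conditions W N) (hs : s.SmoothOn W) (hW : IsOpen W) {z : J0 m}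
    (hz : z ∈ W) (x y w : Fin m → ℝ) :
    tri (s.lowC N z) x y w - tri (s.lowC N z) x w y =
      -(tri (s.lowC N z) y x w - tri (s.lowC N z) y w x) := by
  have h1 : tri (s.lowC N z) x w y = ∑ α, ∑ β, ∑ γ, s.lowC N z α γ β * (x α * y β * w γ) := by
    rw [tri]
    refine Finset.sum_congr rfl fun α _ => ?_
    rw [Finset.sum_comm]
    exact Finset.sum_congr rfl fun β _ => Finset.sum_congr rfl fun γ _ => by ring
  have h2 : tri (s.lowC N z) y x w = ∑ α, ∑ β, ∑ γ, s.lowC N z β α γ * (x α * y β * w γ) := by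
    rw [tri, Finset.sum_comm]
    exact Finset.sum_congr rfl fun α _ => Finset.sum_congr rfl fun β _ =>
      Finset.sum_congr rfl fun γ _ => by ring
  have h3 : tri (s.lowC N z) y w x = ∑ α, ∑ β, ∑ γ, s.lowC N z β γ α * (x α * y β * w γ) := by
    rw [tri, Finset.sum_congr rfl fun α _ => Finset.sum_comm, Finset.sum_comm]
    exact Finset.sum_congr rfl fun α _ => Finset.sum_congr rfl fun β _ =>
      Finset.sum_congr rfl fun γ _ => by ring
  rw [h1, h2, h3, tri]
  simp only [← Finset.sum_sub_distrib, ← Finset.sum_neg_distrib, ← sub_mul, ← neg_mul]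
  exact Finset.sum_congr rfl fun α _ => Finset.sum_congr rfl fun β _ =>
      Finset.sum_congr rfl fun γ _ => by rw [h.lowC_skew hs hW hz]

theorem Conditions.bil_symm (h : s.Conditions W N) {z : J0 m} (hz : z ∈ W) (x y : Fin m → ℝ) :
    bil (fun α β => N z α β) x y = bil (fun α β => N z α β) y x := by
  refine Finset.sum_comm.trans ?_
  refine Finset.sum_congr rfl fun α _ => Finset.sum_congr rfl fun β _ => ?_
  change N z β α * _ = N z α β * _
  rw [(h.symm z hz).apply α β]
  ring

theorem Conditions.hasFDerivAt_bil (h : s.Conditions W N) {z : J0 m} (hz : z ∈ W)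
    (x y : Fin m → ℝ) : HasFDerivAt (fun w => bil (fun α β => N w α β) x y)
      (∑ α, ∑ β, (x α * y β) • fderiv ℝ (fun w => N w α β) z) z := by
  exact HasFDerivAt.fun_sum fun α _ => HasFDerivAt.fun_sum fun β _ =>
    (h.deriv z hz α β).differentiableAt.hasFDerivAt.mul_const _

theorem Conditions.fderiv_bil (h : s.Conditions W N) {z : J0 m} (hz : z ∈ W) (x y : Fin m → ℝ)
    (v : J0 m) : fderiv ℝ (fun w => bil (fun α β => N w α β) x y) z v =
      tri (s.lowC N z) x y v.2.2 + tri (s.lowC N z) y x v.2.2 +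
        (bil (s.lowA N z) x y + bil (s.lowA N z) y x) * v.2.1 +
        (bil (s.lowB N z) x y + bil (s.lowB N z) y x) * v.1 := by
  rw [(h.hasFDerivAt_bil hz x y).fderiv]
  have h1 : tri (s.lowC N z) y x v.2.2 = ∑ α, ∑ β, ∑ γ, s.lowC N z β α γ * (y β * x α * v.2.2 γ) :=
    by rw [tri, Finset.sum_comm]
  have h2 : ∀ a : Fin m → Fin m → ℝ, bil a y x = ∑ α, ∑ β, a β α * (y β * x α) := fun a => by
    rw [bil, Finset.sum_comm]
  rw [h1, h2, h2, tri, bil, bil]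
  simp only [sum_apply, smul_apply, smul_eq_mul, h.fderiv_apply hz, Finset.sum_mul,
    ← Finset.sum_add_distrib]
  refine Finset.sum_congr rfl fun α _ => Finset.sum_congr rfl fun β _ => ?_
  rw [mul_add, mul_add, Finset.mul_sum, Finset.sum_congr rfl fun γ _ => ?_, add_assoc, add_assoc,
    add_right_inj]
  · ring
  · ring

theorem tri_single_left (c : Fin m → Fin m → Fin m → ℝ) (α : Fin m) (y w : Fin m → ℝ) :
    tri c (Pi.single α 1) y w = ∑ β, ∑ γ, c α β γ * (y β * w γ) := by
  rw [tri, Finset.sum_eq_single α]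
  · simp
  · intro b _ hb
    simp [hb]
  · simp

theorem bil_single_left (a : Fin m → Fin m → ℝ) (α : Fin m) (y : Fin m → ℝ) :
    bil a (Pi.single α 1) y = ∑ β, a α β * y β := by
  rw [bil, Finset.sum_eq_single α]
  · simp
  · intro b _ hb
    simp [hb]
  · simp

theorem bil_single_single (a : Fin m → Fin m → ℝ) (α β : Fin m) :
    bil a (Pi.single α 1) (Pi.single β 1) = a α β := by
  rw [bil_single_left, sum_mul_single]

theorem lin_single (e : Fin m → ℝ) (α : Fin m) : lin e (Pi.single α 1) = e α := by
  simp [lin, Pi.single_apply]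

theorem sum_mul_f (z : J0 m) (α : Fin m) (p q : Fin m → ℝ) :
    ∑ σ, N z α σ * s.f σ (z, p, q) = -(tri (s.lowC N z) (Pi.single α 1) p q +
      bil (s.lowA N z) (Pi.single α 1) p + bil (s.lowB N z) (Pi.single α 1) q +
      lin (s.lowE N z) (Pi.single α 1)) := by
  simp only [tri_single_left, bil_single_left, lin_single, f, mul_neg, Finset.sum_neg_distrib,
    mul_add, Finset.sum_add_distrib, lowC, lowA, lowB, lowE, Finset.sum_mul, Finset.mul_sum]
  rw [Finset.sum_comm (f := fun x i => N z α x * (s.A x i z * p i)),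
    Finset.sum_comm (f := fun x i => N z α x * (s.B x i z * q i)), Finset.sum_comm
    (f := fun x i => ∑ k, N z α x * (s.C x i k z * p i * q k)),
    Finset.sum_congr rfl fun β _ => Finset.sum_comm (f := fun x k =>
      N z α x * (s.C x β k z * p β * q k))]
  simp only [mul_assoc]

theorem sum_mul_fUx (z : J0 m) (α β : Fin m) (p q : Fin m → ℝ) :
    ∑ σ, N z α σ * s.fUx σ β (z, p, q) = -(tri (s.lowC N z) (Pi.single α 1) (Pi.single β 1) q +
      bil (s.lowA N z) (Pi.single α 1) (Pi.single β 1)) := by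
  have h : tri (s.lowC N z) (Pi.single α 1) (Pi.single β 1) q = ∑ γ, s.lowC N z α β γ * q γ := by
    rw [tri_single_left, Finset.sum_eq_single β]
    · simp
    · intro b _ hb
      simp [hb]
    · simp
  simp only [h, bil_single_single, fUx, mul_neg, Finset.sum_neg_distrib,
    mul_add, Finset.sum_add_distrib, lowC, lowA, Finset.sum_mul, Finset.mul_sum]
  rw [Finset.sum_comm (f := fun x i => N z α x * (s.C x β i z * q i))]
  simp only [mul_assoc]

theorem sum_mul_fUy (z : J0 m) (α β : Fin m) (p q : Fin m → ℝ) :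
    ∑ σ, N z α σ * s.fUy σ β (z, p, q) = -(tri (s.lowC N z) (Pi.single α 1) p (Pi.single β 1) +
      bil (s.lowB N z) (Pi.single α 1) (Pi.single β 1)) := by
  have h : tri (s.lowC N z) (Pi.single α 1) p (Pi.single β 1) = ∑ γ, s.lowC N z α γ β * p γ := by
    rw [tri_single_left]
    refine Finset.sum_congr rfl fun γ _ => ?_
    rw [Finset.sum_eq_single β]
    · simp
    · intro b _ hb
      simp [hb]
    · simp
  simp only [h, bil_single_single, fUy, mul_neg, Finset.sum_neg_distrib,
    mul_add, Finset.sum_add_distrib, lowC, lowB, Finset.sum_mul, Finset.mul_sum]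
  rw [Finset.sum_comm (f := fun x i => N z α x * (s.C x i β z * p i))]
  simp only [mul_assoc]

/-- Here C enters dN with its lower indices in the order opposite to that in ∂f/∂u_y, and skewness
of the lowered torsion absorbs the difference. In the y-direction the orders agree and no skewness
is needed. -/
theorem Conditions.fderiv_x (h : s.Conditions W N) (hs : s.SmoothOn W) (hW : IsOpen W) {j : J1 m}
    (hj : j ∈ over1 W) (α β : Fin m) : fderiv ℝ (fun z => N z α β) j.1 (1, 0, j.2.1) =
      -((∑ σ, N j.1 α σ * s.fUy σ β j) + ∑ σ, N j.1 β σ * s.fUy σ α j) := by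
  obtain ⟨z, p, q⟩ := j
  have h1 := h.fderiv_bil hj (Pi.single α 1) (Pi.single β 1) (1, 0, p)
  have h2 := h.tri_skew hs hW (z := z) hj (Pi.single α 1) (Pi.single β 1) p
  simp only [bil_single_single] at h1
  simp only [h1, sum_mul_fUy, bil_single_single]
  linarith

theorem Conditions.fderiv_y (h : s.Conditions W N) {j : J1 m}
    (hj : j ∈ over1 W) (α β : Fin m) : fderiv ℝ (fun z => N z α β) j.1 (0, 1, j.2.2) =
      -((∑ σ, N j.1 α σ * s.fUx σ β j) + ∑ σ, N j.1 β σ * s.fUx σ α j) := by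
  obtain ⟨z, p, q⟩ := j
  have h1 := h.fderiv_bil hj (Pi.single α 1) (Pi.single β 1) (0, 1, q)
  simp only [bil_single_single] at h1
  simp only [h1, sum_mul_fUx, bil_single_single]
  ring

theorem Conditions.helmholtz_eq_zero (h : s.Conditions W N) (hs : s.SmoothOn W) (hW : IsOpen W)
    {j : J1 m} (hj : j ∈ over1 W) (α β : Fin m) : s.helmholtz N α β j = 0 := by
  have h1 := sum_H_sub_sum_K hs hW hj (h.symm _ hj) (fun α β => h.fderiv_x hs hW hj α β)
    (fun α β => h.fderiv_y hj α β) α β 0 0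
  rw [h.HK j hj 0 0 α β] at h1
  linarith

/-- The covector `du^α` on the base. -/
def du (α : Fin m) : J0 m →L[ℝ] ℝ :=
  ContinuousLinearMap.proj (R := ℝ) (φ := fun _ : Fin m => ℝ) α ∘L
    ContinuousLinearMap.snd ℝ ℝ (Fin m → ℝ) ∘L ContinuousLinearMap.snd ℝ ℝ _

/-- The covector `dx` on the base. -/
def dx : J0 m →L[ℝ] ℝ := ContinuousLinearMap.fst ℝ ℝ _

/-- The covector `dy` on the base. -/
def dy : J0 m →L[ℝ] ℝ := ContinuousLinearMap.fst ℝ ℝ _ ∘L ContinuousLinearMap.snd ℝ ℝ _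

theorem du_apply (α : Fin m) (v : J0 m) : du α v = v.2.2 α := rfl

theorem dx_apply (v : J0 m) : dx v = v.1 := rfl

theorem dy_apply (v : J0 m) : dy v = v.2.1 := rfl

variable (s N) in
/-- The three-form `du^α ∧ du^β ∧ (c_{αβγ} du^γ / 6 + a_{αβ} dy / 2 - b_{αβ} dx / 2) +
e_α du^α ∧ dx ∧ dy`, in terms of the coefficients of the system lowered by `N`. -/
def multiplierForm (z : J0 m) : J0 m [⋀^Fin 3]→L[ℝ] ℝ :=
  (∑ α, ∑ β, ∑ γ, s.lowC N z α β γ • (1 / 6 : ℝ) • wedge3 (du α) (du β) (du γ)) +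
    (∑ α, ∑ β, s.lowA N z α β • (1 / 2 : ℝ) • wedge3 (du α) (du β) dy) -
    (∑ α, ∑ β, s.lowB N z α β • (1 / 2 : ℝ) • wedge3 (du α) (du β) dx) +
    ∑ α, s.lowE N z α • wedge3 (du α) dx dy

theorem contDiffOn_multiplierForm (hs : s.SmoothOn W)
    (hN : ∀ α β, ContDiffOn ℝ ∞ (fun z => N z α β) W) :
    ContDiffOn ℝ ∞ (s.multiplierForm N) W := by
  have hC : ∀ α β γ, ContDiffOn ℝ ∞ (fun z => s.lowC N z α β γ) W := fun α β γ =>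
    ContDiffOn.sum fun σ _ => (hN α σ).mul (hs.1 σ β γ)
  have hA : ∀ α β, ContDiffOn ℝ ∞ (fun z => s.lowA N z α β) W := fun α β =>
    ContDiffOn.sum fun σ _ => (hN α σ).mul (hs.2.1 σ β)
  have hB : ∀ α β, ContDiffOn ℝ ∞ (fun z => s.lowB N z α β) W := fun α β =>
    ContDiffOn.sum fun σ _ => (hN α σ).mul (hs.2.2.1 σ β)
  have hE : ∀ α, ContDiffOn ℝ ∞ (fun z => s.lowE N z α) W := fun α =>
    ContDiffOn.sum fun σ _ => (hN α σ).mul (hs.2.2.2 σ)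
  exact (((ContDiffOn.sum fun α _ => ContDiffOn.sum fun β _ => ContDiffOn.sum fun γ _ =>
    (hC α β γ).smul contDiffOn_const).add (ContDiffOn.sum fun α _ => ContDiffOn.sum fun β _ =>
    (hA α β).smul contDiffOn_const)).sub (ContDiffOn.sum fun α _ => ContDiffOn.sum fun β _ =>
    (hB α β).smul contDiffOn_const)).add (ContDiffOn.sum fun α _ => (hE α).smul contDiffOn_const)

theorem multiplierForm_apply (z u v w : J0 m) : s.multiplierForm N z ![u, v, w] =
    (tri (s.lowC N z) u.2.2 v.2.2 w.2.2 - tri (s.lowC N z) u.2.2 w.2.2 v.2.2 -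
      tri (s.lowC N z) v.2.2 u.2.2 w.2.2 + tri (s.lowC N z) v.2.2 w.2.2 u.2.2 +
      tri (s.lowC N z) w.2.2 u.2.2 v.2.2 - tri (s.lowC N z) w.2.2 v.2.2 u.2.2) * (1 / 6) +
    ((bil (s.lowA N z) u.2.2 v.2.2 - bil (s.lowA N z) v.2.2 u.2.2) * w.2.1 -
      (bil (s.lowA N z) u.2.2 w.2.2 - bil (s.lowA N z) w.2.2 u.2.2) * v.2.1 +
      (bil (s.lowA N z) v.2.2 w.2.2 - bil (s.lowA N z) w.2.2 v.2.2) * u.2.1) * (1 / 2) -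
    ((bil (s.lowB N z) u.2.2 v.2.2 - bil (s.lowB N z) v.2.2 u.2.2) * w.1 -
      (bil (s.lowB N z) u.2.2 w.2.2 - bil (s.lowB N z) w.2.2 u.2.2) * v.1 +
      (bil (s.lowB N z) v.2.2 w.2.2 - bil (s.lowB N z) w.2.2 v.2.2) * u.1) * (1 / 2) +
    (lin (s.lowE N z) u.2.2 * (v.1 * w.2.1 - w.1 * v.2.1) -
      lin (s.lowE N z) v.2.2 * (u.1 * w.2.1 - w.1 * u.2.1) +
      lin (s.lowE N z) w.2.2 * (u.1 * v.2.1 - v.1 * u.2.1)) := by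
  simp only [multiplierForm, ContinuousAlternatingMap.add_apply,
    ContinuousAlternatingMap.sub_apply, ContinuousAlternatingMap.sum_apply,
    ContinuousAlternatingMap.smul_apply, smul_eq_mul, wedge3_apply, Matrix.cons_val,
    du_apply, dx_apply, dy_apply, tri, bil, lin]
  congr 1
  congr 1
  congr 1
  all_goals
    simp only [Finset.sum_mul, ← Finset.sum_sub_distrib, ← Finset.sum_add_distrib]
  · exact Finset.sum_congr rfl fun α _ => Finset.sum_congr rfl fun β _ =>
      Finset.sum_congr rfl fun γ _ => by ring
  · exact Finset.sum_congr rfl fun α _ => Finset.sum_congr rfl fun β _ => by ring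
  · exact Finset.sum_congr rfl fun α _ => Finset.sum_congr rfl fun β _ => by ring
  · exact Finset.sum_congr rfl fun α _ => by ring

end System

end FGordon

/-! ### Contractions and exterior derivative of the three-form -/

namespace FGordon

namespace System

variable {m : ℕ} {s : System m} {N : J0 m → Matrix (Fin m) (Fin m) ℝ} {W : Set (J0 m)}

/-- The derivatives of N subtract the symmetric halves of the lowered A and B and leave, of the
lowered C, half the torsion. The torsion being totally skew, its full alternation counts it three
times, and the factor 1/6 in `multiplierForm` leaves the same half. -/
theorem Conditions.multiplierForm_U_X_Y (h : s.Conditions W N) (hs : s.SmoothOn W) (hW : IsOpen W)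
    (α : Fin m) (p q : Fin m → ℝ) :
    Set.EqOn (fun z => s.multiplierForm N z ![(0, 0, Pi.single α 1), (1, 0, p), (0, 1, q)])
      (fun z => -(∑ σ, N z α σ * s.f σ (z, p, q)) +
        (fderiv ℝ (fun z => bil (fun α β => N z α β) p q) z (0, 0, Pi.single α 1) -
          fderiv ℝ (fun z => bil (fun α β => N z α β) (Pi.single α 1) q) z (1, 0, p) -
          fderiv ℝ (fun z => bil (fun α β => N z α β) (Pi.single α 1) p) z (0, 1, q)) / 2) W := by
  intro z hz
  have h1 := h.tri_skew hs hW hz (Pi.single α 1) p q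
  have h2 := h.tri_skew hs hW hz (Pi.single α 1) q p
  have h3 := h.tri_skew hs hW hz p q (Pi.single α 1)
  simp only [multiplierForm_apply, sum_mul_f, h.fderiv_bil hz]
  linarith

/-- The polarized form of the previous identity: ∂/∂u^β replaces D_x. The vector `p` is a dummy, as
∂f/∂u_x does not contain u_x. -/
theorem Conditions.multiplierForm_U_U_Y (h : s.Conditions W N) (hs : s.SmoothOn W) (hW : IsOpen W)
    (α β : Fin m) (p q : Fin m → ℝ) :
    Set.EqOn (fun z => s.multiplierForm N z ![(0, 0, Pi.single α 1), (0, 0, Pi.single β 1),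
        (0, 1, q)])
      (fun z => -(∑ σ, N z α σ * s.fUx σ β (z, p, q)) +
        (fderiv ℝ (fun z => bil (fun α β => N z α β) (Pi.single β 1) q) z (0, 0, Pi.single α 1) -
          fderiv ℝ (fun z => bil (fun α β => N z α β) (Pi.single α 1) q) z (0, 0, Pi.single β 1) -
          fderiv ℝ (fun z => bil (fun α β => N z α β) (Pi.single α 1) (Pi.single β 1)) z
            (0, 1, q)) / 2) W := by
  intro z hz
  have h1 := h.tri_skew hs hW hz (Pi.single α 1) (Pi.single β 1) q
  have h2 := h.tri_skew hs hW hz (Pi.single α 1) q (Pi.single β 1)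
  have h3 := h.tri_skew hs hW hz (Pi.single β 1) q (Pi.single α 1)
  simp only [multiplierForm_apply, sum_mul_fUx, h.fderiv_bil hz]
  linarith

theorem Conditions.multiplierForm_U_U_X (h : s.Conditions W N) (hs : s.SmoothOn W) (hW : IsOpen W)
    (α β : Fin m) (p q : Fin m → ℝ) :
    Set.EqOn (fun z => -s.multiplierForm N z ![(0, 0, Pi.single α 1), (0, 0, Pi.single β 1),
        (1, 0, p)])
      (fun z => -(∑ σ, N z α σ * s.fUy σ β (z, p, q)) +
        (fderiv ℝ (fun z => bil (fun α β => N z α β) (Pi.single β 1) p) z (0, 0, Pi.single α 1) -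
          fderiv ℝ (fun z => bil (fun α β => N z α β) (Pi.single α 1) p) z (0, 0, Pi.single β 1) -
          fderiv ℝ (fun z => bil (fun α β => N z α β) (Pi.single α 1) (Pi.single β 1)) z
            (1, 0, p)) / 2) W := by
  intro z hz
  have h1 := h.tri_skew hs hW hz (Pi.single α 1) (Pi.single β 1) p
  have h2 := h.tri_skew hs hW hz (Pi.single α 1) p (Pi.single β 1)
  have h3 := h.tri_skew hs hW hz (Pi.single β 1) p (Pi.single α 1)
  simp only [multiplierForm_apply, sum_mul_fUy, h.fderiv_bil hz]
  linarith

theorem fderiv_neg_add_div {E : Type*} [NormedAddCommGroup E] [NormedSpace ℝ E]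
    {a b c d : E → ℝ} {z : E} (ha : DifferentiableAt ℝ a z) (hb : DifferentiableAt ℝ b z)
    (hc : DifferentiableAt ℝ c z) (hd : DifferentiableAt ℝ d z) (v : E) :
    fderiv ℝ (fun z => -a z + (b z - c z - d z) / 2) z v =
      -fderiv ℝ a z v + (fderiv ℝ b z v - fderiv ℝ c z v - fderiv ℝ d z v) / 2 := by
  have h := ha.hasFDerivAt.fun_neg.fun_add
    (((hb.hasFDerivAt.fun_sub hc.hasFDerivAt).fun_sub hd.hasFDerivAt).mul_const (2⁻¹ : ℝ))
  simp only [div_eq_mul_inv]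
  rw [h.fderiv]
  simp
  ring

theorem fderiv_sum_mul_f_slice (hs : s.SmoothOn W) (hW : IsOpen W)
    (hN : ∀ α β, ContDiffOn ℝ ∞ (fun z => N z α β) W) {z : J0 m} (hz : z ∈ W)
    (α : Fin m) (p q : Fin m → ℝ) (v : J0 m) :
    fderiv ℝ (fun z => ∑ σ, N z α σ * s.f σ (z, p, q)) z v =
      ∑ σ, (fderiv ℝ (fun z => N z α σ) z v * s.f σ (z, p, q) +
        N z α σ * fderiv ℝ (s.f σ) (z, p, q) (v, 0)) := by
  have hd : ∀ σ, DifferentiableAt ℝ (s.f σ) (z, p, q) := fun σ =>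
    ContDiffOn.differentiableAt_of_isOpen (hs.f σ) (isOpen_over1 hW) hz
  have hd' : ∀ σ, DifferentiableAt ℝ (fun z => s.f σ (z, p, q)) z := fun σ =>
    DifferentiableAt.comp (g := s.f σ) (f := fun z => (z, p, q)) z (hd σ) (by fun_prop)
  have h := HasFDerivAt.fun_sum (u := Finset.univ) fun σ _ =>
    (ContDiffOn.differentiableAt_of_isOpen (hN α σ) hW hz).hasFDerivAt.mul (hd' σ).hasFDerivAt
  refine (congrArg (fun D => D v) h.fderiv).trans ?_
  simp only [sum_apply, add_apply, smul_apply, smul_eq_mul]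
  refine Finset.sum_congr rfl fun σ _ => ?_
  rw [← fderiv_base_slice (hd σ) v]
  ring

theorem differentiableAt_sum_mul (hW : IsOpen W) (hN : ∀ α β, ContDiffOn ℝ ∞ (fun z => N z α β) W)
    {g : Fin m → J1 m → ℝ} (hg : ∀ σ, ContDiffOn ℝ ∞ (g σ) (over1 W)) {z : J0 m} (hz : z ∈ W)
    (α : Fin m) (p q : Fin m → ℝ) :
    DifferentiableAt ℝ (fun z => ∑ σ, N z α σ * g σ (z, p, q)) z := by
  refine ContDiffOn.differentiableAt_of_isOpen (ContDiffOn.sum fun σ _ => (hN α σ).mul ?_) hW hz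
  exact (hg σ).comp (f := fun z => (z, p, q)) (by fun_prop) fun _ h => h

theorem fderiv_sum_mul_fUx_slice (hs : s.SmoothOn W) (hW : IsOpen W)
    (hN : ∀ α β, ContDiffOn ℝ ∞ (fun z => N z α β) W) {z : J0 m} (hz : z ∈ W)
    (α β : Fin m) (p q : Fin m → ℝ) (v : J0 m) :
    fderiv ℝ (fun z => ∑ σ, N z α σ * s.fUx σ β (z, p, q)) z v =
      ∑ σ, (fderiv ℝ (fun z => N z α σ) z v * s.fUx σ β (z, p, q) +
        N z α σ * fderiv ℝ (s.fUx σ β) (z, p, q) (v, 0)) := by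
  have hj : ((z, p, q) : J1 m) ∈ over1 W := hz
  have h := fderiv_base_slice (g := fun j : J1 m => ∑ σ, N j.1 α σ * s.fUx σ β j) (j := (z, p, q))
    (ContDiffOn.differentiableAt_of_isOpen (ContDiffOn.sum fun σ _ =>
      (contDiffOn_comp_fst (hN α σ)).mul (hs.fUx σ β)) (isOpen_over1 hW) hj) v
  refine h.trans ((fderiv_sum_mul_fUx hs hW hN hj α β v 0 0).trans ?_)
  simp

theorem fderiv_sum_mul_fUy_slice (hs : s.SmoothOn W) (hW : IsOpen W)
    (hN : ∀ α β, ContDiffOn ℝ ∞ (fun z => N z α β) W) {z : J0 m} (hz : z ∈ W)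
    (α β : Fin m) (p q : Fin m → ℝ) (v : J0 m) :
    fderiv ℝ (fun z => ∑ σ, N z α σ * s.fUy σ β (z, p, q)) z v =
      ∑ σ, (fderiv ℝ (fun z => N z α σ) z v * s.fUy σ β (z, p, q) +
        N z α σ * fderiv ℝ (s.fUy σ β) (z, p, q) (v, 0)) := by
  have hj : ((z, p, q) : J1 m) ∈ over1 W := hz
  have h := fderiv_base_slice (g := fun j : J1 m => ∑ σ, N j.1 α σ * s.fUy σ β j) (j := (z, p, q))
    (ContDiffOn.differentiableAt_of_isOpen (ContDiffOn.sum fun σ _ =>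
      (contDiffOn_comp_fst (hN α σ)).mul (hs.fUy σ β)) (isOpen_over1 hW) hj) v
  refine h.trans ((fderiv_sum_mul_fUy hs hW hN hj α β v 0 0).trans ?_)
  simp

/-- The terms with `f` in the Helmholtz expression cancel against those from differentiating `N`. -/
theorem Conditions.sum_lowC_cancel (h : s.Conditions W N) (hs : s.SmoothOn W) (hW : IsOpen W)
    {z : J0 m} (hz : z ∈ W) (α β : Fin m) (w : Fin m → ℝ) :
    (∑ σ, fderiv ℝ (fun z => N z β σ) z (0, 0, Pi.single α 1) * w σ) -
      (∑ σ, fderiv ℝ (fun z => N z α σ) z (0, 0, Pi.single β 1) * w σ) +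
      (∑ σ, N z α σ * ∑ ν, s.C σ β ν z * w ν) - ∑ σ, N z β σ * ∑ ν, s.C σ ν α z * w ν = 0 := by
  have h1 : ∀ α β, ∑ σ, N z α σ * ∑ ν, s.C σ β ν z * w ν = ∑ ν, s.lowC N z α β ν * w ν := by
    intro α β
    simp only [lowC, Finset.mul_sum, Finset.sum_mul, mul_assoc]
    exact Finset.sum_comm
  have h2 : ∀ α β, ∑ σ, N z α σ * ∑ ν, s.C σ ν β z * w ν = ∑ ν, s.lowC N z α ν β * w ν := by
    intro α β
    simp only [lowC, Finset.mul_sum, Finset.sum_mul, mul_assoc]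
    exact Finset.sum_comm
  have h3 : ∀ a b c, fderiv ℝ (fun z => N z a b) z (0, 0, Pi.single c 1) =
      s.lowC N z a b c + s.lowC N z b a c := by
    intro a b c
    rw [h.fderiv_apply hz]
    simp [sum_mul_single]
  rw [h1, h2]
  simp only [h3, ← Finset.sum_sub_distrib, ← Finset.sum_add_distrib]
  refine Finset.sum_eq_zero fun ν _ => ?_
  have e1 := h.lowC_skew hs hW hz α β ν
  have e2 := h.lowC_skew hs hW hz β ν α
  linear_combination w ν * e1 + w ν * e2

/-- The contraction formulas write dΦ on these vectors through second derivatives of N and first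
derivatives of N f and its fibre partials. After commuting derivatives, the second derivatives of N
that remain are eliminated by differentiating the equation for D_y N. The Helmholtz equation
accounts for the rest, except for the terms in which it replaces u_xy by f; these cancel by
`sum_lowC_cancel`. -/
theorem Conditions.extDeriv_multiplierForm_U_U_X_Y (h : s.Conditions W N) (hs : s.SmoothOn W)
    (hW : IsOpen W) {z : J0 m} (hz : z ∈ W) (α β : Fin m) (p q : Fin m → ℝ) :
    extDeriv (s.multiplierForm N) z
      ![(0, 0, Pi.single β 1), (0, 0, Pi.single α 1), (1, 0, p), (0, 1, q)] = 0 := by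
  have hN := h.contDiffOn hs hW
  have hb : ∀ x y, ContDiffOn ℝ ∞ (fun z => bil (fun α β => N z α β) x y) W := fun x y =>
    ContDiffOn.sum fun α _ => ContDiffOn.sum fun β _ => (hN α β).mul contDiffOn_const
  have hd : ∀ x y v, DifferentiableAt ℝ
      (fun z => fderiv ℝ (fun z => bil (fun α β => N z α β) x y) z v) z := fun x y v =>
    ContDiffOn.differentiableAt_of_isOpen (ContDiffOn.fderiv_apply (hb x y) hW contDiffOn_const)
      hW hz
  have hc : ∀ x y v w, fderiv ℝ (fun z => fderiv ℝ (fun z => bil (fun α β => N z α β) x y) z v) z w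
      = fderiv ℝ (fun z => fderiv ℝ (fun z => bil (fun α β => N z α β) x y) z w) z v :=
    fun x y v w => fderiv_fderiv_comm (hb x y) hW hz v w
  have df : ∀ α, DifferentiableAt ℝ (fun z => ∑ σ, N z α σ * s.f σ (z, p, q)) z := fun α =>
    differentiableAt_sum_mul hW hN hs.f hz α p q
  have dx : ∀ α β, DifferentiableAt ℝ (fun z => ∑ σ, N z α σ * s.fUx σ β (z, p, q)) z :=
    fun α β => differentiableAt_sum_mul hW hN (fun σ => hs.fUx σ β) hz α p q
  have dy : ∀ α β, DifferentiableAt ℝ (fun z => ∑ σ, N z α σ * s.fUy σ β (z, p, q)) z :=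
    fun α β => differentiableAt_sum_mul hW hN (fun σ => hs.fUy σ β) hz α p q
  have hy : Set.EqOn (fun z => fderiv ℝ (fun z => bil (fun α β => N z α β) (Pi.single β 1)
        (Pi.single α 1)) z (0, 1, q))
      (fun z => -((∑ σ, N z β σ * s.fUx σ α (z, p, q)) + ∑ σ, N z α σ * s.fUx σ β (z, p, q))) W :=
    fun z hz => by
      simp only [bil_single_single]
      exact h.fderiv_y (j := (z, p, q)) hz β α
  have hxy := congrArg (fun D => D (1, 0, p)) (fderiv_eq_of_eqOn_open hW hy hz)
  simp only [fderiv_fun_neg] at hxy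
  rw [fderiv_fun_add (dx β α) (dx α β)] at hxy
  have hneg : fderiv ℝ (fun z => s.multiplierForm N z ![(0, 0, Pi.single β 1),
      (0, 0, Pi.single α 1), (1, 0, p)]) z (0, 1, q) = -fderiv ℝ (fun z => -s.multiplierForm N z
      ![(0, 0, Pi.single β 1), (0, 0, Pi.single α 1), (1, 0, p)]) z (0, 1, q) := by
    rw [fderiv_fun_neg, neg_apply, neg_neg]
  have hh := h.helmholtz_eq_zero hs hW (j := (z, p, q)) hz α β
  have hcancel := h.sum_lowC_cancel hs hW hz α β fun σ => s.f σ (z, p, q)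
  rw [extDeriv_three_apply (ContDiffOn.differentiableAt_of_isOpen
      (contDiffOn_multiplierForm hs hN) hW hz), hneg,
    fderiv_eq_of_eqOn_open hW (h.multiplierForm_U_X_Y hs hW α p q) hz,
    fderiv_eq_of_eqOn_open hW (h.multiplierForm_U_X_Y hs hW β p q) hz,
    fderiv_eq_of_eqOn_open hW (h.multiplierForm_U_U_Y hs hW β α p q) hz,
    fderiv_eq_of_eqOn_open hW (h.multiplierForm_U_U_X hs hW β α p q) hz,
    fderiv_neg_add_div (df α) (hd _ _ _) (hd _ _ _) (hd _ _ _),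
    fderiv_neg_add_div (df β) (hd _ _ _) (hd _ _ _) (hd _ _ _),
    fderiv_neg_add_div (dx β α) (hd _ _ _) (hd _ _ _) (hd _ _ _),
    fderiv_neg_add_div (dy β α) (hd _ _ _) (hd _ _ _) (hd _ _ _),
    hc p q (0, 0, Pi.single α 1) (0, 0, Pi.single β 1),
    hc (Pi.single α 1) q (1, 0, p), hc (Pi.single α 1) p (0, 1, q),
    hc (Pi.single β 1) q (1, 0, p), hc (Pi.single β 1) p (0, 1, q),
    hc (Pi.single β 1) (Pi.single α 1) (1, 0, p)]
  simp only [add_apply, neg_apply] at hxy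
  rw [hxy]
  simp only [fderiv_sum_mul_f_slice hs hW hN hz, fderiv_sum_mul_fUx_slice hs hW hN hz,
    fderiv_sum_mul_fUy_slice hs hW hN hz]
  rw [helmholtz] at hh
  have hU : ∀ α σ, pd (eU α) (s.f σ) (z, p, q) =
    fderiv ℝ (s.f σ) (z, p, q) ((0, 0, Pi.single α 1), 0) := fun _ _ => rfl
  simp only [hU, mul_sub, Finset.sum_add_distrib, Finset.sum_sub_distrib] at hh ⊢
  linarith

end System

end FGordon

/-! ### The Lagrangian of a multiplier -/

namespace FGordon

variable {m : ℕ} {W : Set (J0 m)}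

theorem alternating_two_swap {E : Type*} [NormedAddCommGroup E] [NormedSpace ℝ E]
    (f : E [⋀^Fin 2]→L[ℝ] ℝ) (a b : E) : f ![a, b] = -f ![b, a] := by
  have h := f.map_swap ![b, a] (i := 0) (j := 1) (by decide)
  have h2 : (![b, a] ∘ Equiv.swap (0 : Fin 2) 1) = ![a, b] := by
    ext i : 1
    fin_cases i <;> rfl
  rw [h2] at h
  exact h

theorem contDiffOn_alternating_two {E : Type} {F : Type*} [NormedAddCommGroup E] [NormedSpace ℝ E]
    [NormedAddCommGroup F] [NormedSpace ℝ F] {η : F → E [⋀^Fin 2]→L[ℝ] ℝ} {a b : F → E} {t : Set F}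
    (hη : ContDiffOn ℝ ∞ η t) (ha : ContDiffOn ℝ ∞ a t) (hb : ContDiffOn ℝ ∞ b t) :
    ContDiffOn ℝ ∞ (fun x => η x ![a x, b x]) t := by
  have h1 : ContDiffOn ℝ ∞ (fun x => (η x).curryLeft) t :=
    (contDiff_curryLeft (E := E) (F := ℝ) (n := 1) (k := ∞)).comp_contDiffOn hη
  have h2 : ContDiffOn ℝ ∞ (fun x => ((η x).curryLeft (a x)).curryLeft) t :=
    (contDiff_curryLeft (E := E) (F := ℝ) (n := 0) (k := ∞)).comp_contDiffOn (h1.clm_apply ha)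
  exact (ContinuousAlternatingMap.apply ℝ E ℝ ![]).contDiff.comp_contDiffOn (h2.clm_apply hb)

theorem fderiv_alternating_two {E F : Type*} [NormedAddCommGroup E] [NormedSpace ℝ E]
    [NormedAddCommGroup F] [NormedSpace ℝ F] {η : F → E [⋀^Fin 2]→L[ℝ] ℝ} {a b : F → E} {x : F}
    (hη : DifferentiableAt ℝ η x) (ha : DifferentiableAt ℝ a x) (hb : DifferentiableAt ℝ b x)
    (v : F) : fderiv ℝ (fun x => η x ![a x, b x]) x v =
      fderiv ℝ η x v ![a x, b x] + η x ![fderiv ℝ a x v, b x] + η x ![a x, fderiv ℝ b x v] := by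
  have hg : ∀ i : Fin 2, DifferentiableAt ℝ ((![a, b] : Fin 2 → F → E) i) x := by
    intro i
    fin_cases i
    exacts [ha, hb]
  have h := fderiv_continuousAlternatingMap_apply_apply hη hg v
  have e : ∀ x, (fun i => (![a, b] : Fin 2 → F → E) i x) = ![a x, b x] := fun x => by
    ext i : 1
    fin_cases i <;> rfl
  simp only [e, Fin.sum_univ_two] at h
  rw [h, ← add_assoc]
  congr 3
  · ext i : 1
    fin_cases i <;> rfl
  · ext i : 1
    fin_cases i <;> rfl

namespace System

variable {s : System m} {N : J0 m → Matrix (Fin m) (Fin m) ℝ}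

/-- Any vector is a combination of D_x, D_y and the ∂/∂u^β. The first two repeat an argument and
contribute nothing, so only the case already settled remains. -/
theorem Conditions.extDeriv_multiplierForm (h : s.Conditions W N) (hs : s.SmoothOn W)
    (hW : IsOpen W) {z : J0 m} (hz : z ∈ W) (v : J0 m) (α : Fin m) (p q : Fin m → ℝ) :
    extDeriv (s.multiplierForm N) z
      (Matrix.vecCons v ![(0, 0, Pi.single α 1), (1, 0, p), (0, 1, q)]) = 0 := by
  obtain ⟨a, b, c⟩ := v
  set D := extDeriv (s.multiplierForm N) z
  have hv : ((a, b, c) : J0 m) = a • (1, 0, p) + b • (0, 1, q) +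
      ∑ β, (c β - a * p β - b * q β) • ((0, 0, Pi.single β 1) : J0 m) := by
    ext i <;> simp [Prod.fst_sum, Prod.snd_sum, Pi.single_apply]
  rw [← ContinuousAlternatingMap.curryLeft_apply_apply, hv]
  simp only [map_add, map_sum, map_smul, ContinuousAlternatingMap.add_apply,
    ContinuousAlternatingMap.sum_apply, ContinuousAlternatingMap.smul_apply,
    ContinuousAlternatingMap.curryLeft_apply_apply]
  have h1 : D (Matrix.vecCons (1, 0, p) ![(0, 0, Pi.single α 1), (1, 0, p), (0, 1, q)]) = 0 :=
    D.map_eq_zero_of_eq _ (i := 0) (j := 2) rfl (by decide)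
  have h2 : D (Matrix.vecCons (0, 1, q) ![(0, 0, Pi.single α 1), (1, 0, p), (0, 1, q)]) = 0 :=
    D.map_eq_zero_of_eq _ (i := 0) (j := 3) rfl (by decide)
  rw [h1, h2]
  simp only [D, h.extDeriv_multiplierForm_U_U_X_Y hs hW hz]
  simp

/-- The Lagrangian `Λ(D_x, D_y) - N_{βγ} u^β_x u^γ_y / 2` of a two-form `Λ` and a multiplier. -/
def lagrangian (Λ : J0 m → J0 m [⋀^Fin 2]→L[ℝ] ℝ) (N : J0 m → Matrix (Fin m) (Fin m) ℝ)
    (j : J1 m) : ℝ :=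
  Λ j.1 ![(1, 0, j.2.1), (0, 1, j.2.2)] - bil (fun α β => N j.1 α β) j.2.1 j.2.2 / 2

theorem fderiv_bil_comp (hW : IsOpen W) (hN : ∀ α β, ContDiffOn ℝ ∞ (fun z => N z α β) W)
    {j : J1 m} (hj : j ∈ over1 W) {a b : J1 m → Fin m → ℝ} {a' b' : J1 m →L[ℝ] Fin m → ℝ}
    (ha : HasFDerivAt a a' j) (hb : HasFDerivAt b b' j) (v : J1 m) :
    fderiv ℝ (fun j => bil (fun α β => N j.1 α β) (a j) (b j)) j v =
      fderiv ℝ (fun z => bil (fun α β => N z α β) (a j) (b j)) j.1 v.1 +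
        bil (fun α β => N j.1 α β) (a' v) (b j) + bil (fun α β => N j.1 α β) (a j) (b' v) := by
  have hd : ∀ α β, DifferentiableAt ℝ (fun z => N z α β) j.1 := fun α β =>
    ContDiffOn.differentiableAt_of_isOpen (hN α β) hW hj
  have h1 : HasFDerivAt (fun z => bil (fun α β => N z α β) (a j) (b j))
      (∑ α, ∑ β, (a j α * b j β) • fderiv ℝ (fun z => N z α β) j.1) j.1 :=
    HasFDerivAt.fun_sum fun α _ => HasFDerivAt.fun_sum fun β _ =>
      (hd α β).hasFDerivAt.mul_const _
  have h2 := HasFDerivAt.fun_sum (u := Finset.univ) fun α _ => HasFDerivAt.fun_sum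
    (u := Finset.univ) fun β _ => (HasFDerivAt.comp (g := fun z => N z α β) (f := Prod.fst) j
      (hd α β).hasFDerivAt hasFDerivAt_fst).mul
      ((hasFDerivAt_pi'.1 ha α).mul (hasFDerivAt_pi'.1 hb β))
  refine (congrArg (fun D => D v) h2.fderiv).trans ?_
  rw [h1.fderiv]
  simp only [bil, sum_apply, add_apply, smul_apply, smul_eq_mul, ContinuousLinearMap.comp_apply,
    ← Finset.sum_add_distrib]
  refine Finset.sum_congr rfl fun α _ => Finset.sum_congr rfl fun β _ => ?_
  simp
  ring

theorem fderiv_alternating_comp (hW : IsOpen W) {Λ : J0 m → J0 m [⋀^Fin 2]→L[ℝ] ℝ}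
    (hΛ : ContDiffOn ℝ ∞ Λ W) {j : J1 m} (hj : j ∈ over1 W) {a b : J1 m → J0 m}
    {a' b' : J1 m →L[ℝ] J0 m} (ha : HasFDerivAt a a' j) (hb : HasFDerivAt b b' j) (v : J1 m) :
    fderiv ℝ (fun j => Λ j.1 ![a j, b j]) j v =
      fderiv ℝ Λ j.1 v.1 ![a j, b j] + Λ j.1 ![a' v, b j] + Λ j.1 ![a j, b' v] := by
  have h1 := HasFDerivAt.comp (g := Λ) (f := Prod.fst) j
    (ContDiffOn.differentiableAt_of_isOpen hΛ hW hj).hasFDerivAt hasFDerivAt_fst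
  have h2 := fderiv_alternating_two (η := fun j => Λ j.1) h1.differentiableAt ha.differentiableAt
    hb.differentiableAt v
  rw [show fderiv ℝ (fun j : J1 m => Λ j.1) j = _ from h1.fderiv, ha.fderiv, hb.fderiv] at h2
  exact h2

theorem hasFDerivAt_p (j : J1 m) : HasFDerivAt (fun j : J1 m => j.2.1)
    (ContinuousLinearMap.fst ℝ _ _ ∘L ContinuousLinearMap.snd ℝ _ _) j :=
  hasFDerivAt_fst.comp j hasFDerivAt_snd

theorem hasFDerivAt_q (j : J1 m) : HasFDerivAt (fun j : J1 m => j.2.2)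
    (ContinuousLinearMap.snd ℝ _ _ ∘L ContinuousLinearMap.snd ℝ _ _) j :=
  hasFDerivAt_snd.comp j hasFDerivAt_snd

theorem hasFDerivAt_X (j : J1 m) : HasFDerivAt (fun j : J1 m => ((1, 0, j.2.1) : J0 m))
    ((0 : J1 m →L[ℝ] ℝ).prod ((0 : J1 m →L[ℝ] ℝ).prod
      (ContinuousLinearMap.fst ℝ _ _ ∘L ContinuousLinearMap.snd ℝ _ _))) j :=
  (hasFDerivAt_const 1 j).prodMk ((hasFDerivAt_const 0 j).prodMk (hasFDerivAt_p j))

theorem hasFDerivAt_Y (j : J1 m) : HasFDerivAt (fun j : J1 m => ((0, 1, j.2.2) : J0 m))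
    ((0 : J1 m →L[ℝ] ℝ).prod ((0 : J1 m →L[ℝ] ℝ).prod
      (ContinuousLinearMap.snd ℝ _ _ ∘L ContinuousLinearMap.snd ℝ _ _))) j :=
  (hasFDerivAt_const 0 j).prodMk ((hasFDerivAt_const 1 j).prodMk (hasFDerivAt_q j))

theorem bil_zero_left (a : Fin m → Fin m → ℝ) (y : Fin m → ℝ) : bil a 0 y = 0 := by
  simp [bil]

theorem bil_zero_right (a : Fin m → Fin m → ℝ) (x : Fin m → ℝ) : bil a x 0 = 0 := by
  simp [bil]

theorem alternating_two_zero_left {E : Type*} [NormedAddCommGroup E] [NormedSpace ℝ E]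
    (f : E [⋀^Fin 2]→L[ℝ] ℝ) (a : E) : f ![0, a] = 0 :=
  f.map_coord_zero 0 rfl

theorem alternating_two_zero_right {E : Type*} [NormedAddCommGroup E] [NormedSpace ℝ E]
    (f : E [⋀^Fin 2]→L[ℝ] ℝ) (a : E) : f ![a, 0] = 0 :=
  f.map_coord_zero 1 rfl

section

variable {Λ : J0 m → J0 m [⋀^Fin 2]→L[ℝ] ℝ}

theorem contDiffOn_lagrangian (hΛ : ContDiffOn ℝ ∞ Λ W)
    (hN : ∀ α β, ContDiffOn ℝ ∞ (fun z => N z α β) W) :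
    ContDiffOn ℝ ∞ (lagrangian Λ N) (over1 W) := by
  refine ContDiffOn.sub (contDiffOn_alternating_two (hΛ.comp contDiffOn_fst fun _ h => h)
    (by fun_prop) (by fun_prop)) (ContDiffOn.div_const ?_ 2)
  exact ContDiffOn.sum fun α _ => ContDiffOn.sum fun β _ =>
    (contDiffOn_comp_fst (hN α β)).mul (by fun_prop)

theorem differentiableAt_alternating_comp (hW : IsOpen W) (hΛ : ContDiffOn ℝ ∞ Λ W) {j : J1 m}
    (hj : j ∈ over1 W) {a b : J1 m → J0 m} (ha : ContDiff ℝ ∞ a) (hb : ContDiff ℝ ∞ b) :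
    DifferentiableAt ℝ (fun j => Λ j.1 ![a j, b j]) j :=
  ContDiffOn.differentiableAt_of_isOpen (contDiffOn_alternating_two
    (hΛ.comp contDiffOn_fst fun _ h => h) ha.contDiffOn hb.contDiffOn) (isOpen_over1 hW) hj

theorem differentiableAt_bil_comp (hW : IsOpen W)
    (hN : ∀ α β, ContDiffOn ℝ ∞ (fun z => N z α β) W) {j : J1 m}
    (hj : j ∈ over1 W) {a b : J1 m → Fin m → ℝ} (ha : ContDiff ℝ ∞ a) (hb : ContDiff ℝ ∞ b) :
    DifferentiableAt ℝ (fun j => bil (fun α β => N j.1 α β) (a j) (b j)) j :=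
  ContDiffOn.differentiableAt_of_isOpen (ContDiffOn.sum fun α _ => ContDiffOn.sum fun β _ =>
    (contDiffOn_comp_fst (hN α β)).mul (by fun_prop)) (isOpen_over1 hW) hj

theorem fderiv_alternating_sub_bil_div (hW : IsOpen W) (hΛ : ContDiffOn ℝ ∞ Λ W)
    (hN : ∀ α β, ContDiffOn ℝ ∞ (fun z => N z α β) W) {j : J1 m} (hj : j ∈ over1 W)
    {a b : J1 m → J0 m} (ha : ContDiff ℝ ∞ a) (hb : ContDiff ℝ ∞ b)
    {c d : J1 m → Fin m → ℝ} (hc : ContDiff ℝ ∞ c) (hd : ContDiff ℝ ∞ d) (v : J1 m) :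
    fderiv ℝ (fun j => Λ j.1 ![a j, b j] - bil (fun α β => N j.1 α β) (c j) (d j) / 2) j v =
      fderiv ℝ (fun j => Λ j.1 ![a j, b j]) j v -
        fderiv ℝ (fun j => bil (fun α β => N j.1 α β) (c j) (d j)) j v / 2 := by
  have h := (differentiableAt_alternating_comp hW hΛ hj ha hb).hasFDerivAt.fun_sub
    ((differentiableAt_bil_comp hW hN hj hc hd).hasFDerivAt.mul_const (2⁻¹ : ℝ))
  simp only [div_eq_mul_inv]
  rw [h.fderiv]
  simp
  ring

theorem fderiv_lagrangian (hW : IsOpen W) (hΛ : ContDiffOn ℝ ∞ Λ W)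
    (hN : ∀ α β, ContDiffOn ℝ ∞ (fun z => N z α β) W) {j : J1 m} (hj : j ∈ over1 W) (v : J1 m) :
    fderiv ℝ (lagrangian Λ N) j v =
      fderiv ℝ Λ j.1 v.1 ![(1, 0, j.2.1), (0, 1, j.2.2)] +
        Λ j.1 ![(0, 0, v.2.1), (0, 1, j.2.2)] + Λ j.1 ![(1, 0, j.2.1), (0, 0, v.2.2)] -
        (fderiv ℝ (fun z => bil (fun α β => N z α β) j.2.1 j.2.2) j.1 v.1 +
          bil (fun α β => N j.1 α β) v.2.1 j.2.2 + bil (fun α β => N j.1 α β) j.2.1 v.2.2) / 2 := by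
  have h := fderiv_alternating_sub_bil_div (a := fun j => (1, 0, j.2.1)) (b := fun j => (0, 1, j.2.2))
    (c := fun j => j.2.1) (d := fun j => j.2.2) hW hΛ hN hj (by fun_prop) (by fun_prop)
    (by fun_prop) (by fun_prop) v
  rw [fderiv_alternating_comp hW hΛ hj (hasFDerivAt_X j) (hasFDerivAt_Y j),
    fderiv_bil_comp hW hN hj (hasFDerivAt_p j) (hasFDerivAt_q j)] at h
  exact h

theorem pd_eUx_lagrangian (hW : IsOpen W) (hΛ : ContDiffOn ℝ ∞ Λ W)
    (hN : ∀ α β, ContDiffOn ℝ ∞ (fun z => N z α β) W) (α : Fin m) :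
    Set.EqOn (pd (eUx α) (lagrangian Λ N)) (fun j => Λ j.1 ![(0, 0, Pi.single α 1), (0, 1, j.2.2)] -
      bil (fun α β => N j.1 α β) (Pi.single α 1) j.2.2 / 2) (over1 W) := by
  intro j hj
  rw [pd, eUx, fderiv_lagrangian hW hΛ hN hj]
  simp [bil_zero_right, alternating_two_zero_right _ ((1, 0, j.2.1) : J0 m), ← Prod.zero_eq_mk]

theorem pd_eUy_lagrangian (hW : IsOpen W) (hΛ : ContDiffOn ℝ ∞ Λ W)
    (hN : ∀ α β, ContDiffOn ℝ ∞ (fun z => N z α β) W) (α : Fin m) :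
    Set.EqOn (pd (eUy α) (lagrangian Λ N)) (fun j => Λ j.1 ![(1, 0, j.2.1), (0, 0, Pi.single α 1)] -
      bil (fun α β => N j.1 α β) j.2.1 (Pi.single α 1) / 2) (over1 W) := by
  intro j hj
  rw [pd, eUy, fderiv_lagrangian hW hΛ hN hj]
  simp [bil_zero_left, alternating_two_zero_left _ ((0, 1, j.2.2) : J0 m), ← Prod.zero_eq_mk]

theorem Dx_pd_eUx_lagrangian (hW : IsOpen W) (hΛ : ContDiffOn ℝ ∞ Λ W)
    (hN : ∀ α β, ContDiffOn ℝ ∞ (fun z => N z α β) W) (α : Fin m) {j : J1 m} (hj : j ∈ over1 W)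
    (uxx uxy : Fin m → ℝ) : Dx (pd (eUx α) (lagrangian Λ N)) j uxx uxy =
      fderiv ℝ Λ j.1 (1, 0, j.2.1) ![(0, 0, Pi.single α 1), (0, 1, j.2.2)] +
        Λ j.1 ![(0, 0, Pi.single α 1), (0, 0, uxy)] -
        (fderiv ℝ (fun z => bil (fun α β => N z α β) (Pi.single α 1) j.2.2) j.1 (1, 0, j.2.1) +
          bil (fun α β => N j.1 α β) (Pi.single α 1) uxy) / 2 := by
  rw [Dx, fderiv_eq_of_eqOn_open (isOpen_over1 hW) (pd_eUx_lagrangian hW hΛ hN α) hj,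
    fderiv_alternating_sub_bil_div (a := fun _ => (0, 0, Pi.single α 1))
      (b := fun j => (0, 1, j.2.2)) (c := fun _ => Pi.single α 1) (d := fun j => j.2.2) hW hΛ hN hj
      (by fun_prop) (by fun_prop) (by fun_prop) (by fun_prop),
    fderiv_alternating_comp hW hΛ hj (hasFDerivAt_const _ j) (hasFDerivAt_Y j),
    fderiv_bil_comp hW hN hj (hasFDerivAt_const _ j) (hasFDerivAt_q j)]
  simp [bil_zero_left, alternating_two_zero_left]

theorem Dy_pd_eUy_lagrangian (hW : IsOpen W) (hΛ : ContDiffOn ℝ ∞ Λ W)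
    (hN : ∀ α β, ContDiffOn ℝ ∞ (fun z => N z α β) W) (α : Fin m) {j : J1 m} (hj : j ∈ over1 W)
    (uxy uyy : Fin m → ℝ) : Dy (pd (eUy α) (lagrangian Λ N)) j uxy uyy =
      fderiv ℝ Λ j.1 (0, 1, j.2.2) ![(1, 0, j.2.1), (0, 0, Pi.single α 1)] +
        Λ j.1 ![(0, 0, uxy), (0, 0, Pi.single α 1)] -
        (fderiv ℝ (fun z => bil (fun α β => N z α β) j.2.1 (Pi.single α 1)) j.1 (0, 1, j.2.2) +
          bil (fun α β => N j.1 α β) uxy (Pi.single α 1)) / 2 := by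
  rw [Dy, fderiv_eq_of_eqOn_open (isOpen_over1 hW) (pd_eUy_lagrangian hW hΛ hN α) hj,
    fderiv_alternating_sub_bil_div (a := fun j => (1, 0, j.2.1))
      (b := fun _ => (0, 0, Pi.single α 1)) (c := fun j => j.2.1) (d := fun _ => Pi.single α 1)
      hW hΛ hN hj (by fun_prop) (by fun_prop) (by fun_prop) (by fun_prop),
    fderiv_alternating_comp hW hΛ hj (hasFDerivAt_X j) (hasFDerivAt_const _ j),
    fderiv_bil_comp hW hN hj (hasFDerivAt_p j) (hasFDerivAt_const _ j)]
  simp [bil_zero_right, alternating_two_zero_right]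

theorem extDeriv_two_apply_fderiv {z : J0 m} (hΛ : DifferentiableAt ℝ Λ z) (u v w : J0 m) :
    extDeriv Λ z ![u, v, w] =
      fderiv ℝ Λ z u ![v, w] - fderiv ℝ Λ z v ![u, w] + fderiv ℝ Λ z w ![u, v] := by
  have h : ∀ a b c : J0 m, fderiv ℝ (fun z => Λ z ![a, b]) z c = fderiv ℝ Λ z c ![a, b] := by
    intro a b c
    rw [fderiv_alternating_two (a := fun _ => a) (b := fun _ => b) hΛ (by fun_prop) (by fun_prop)]
    simp [alternating_two_zero_right, alternating_two_zero_left]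
  rw [extDeriv_two_apply hΛ, h, h, h]

/-- The term Λ(D_x, D_y) contributes just dΛ(∂/∂u^α, D_x, D_y): its two occurrences of u_xy cancel
by antisymmetry of Λ. All dependence on second derivatives therefore comes from the quadratic term.
-/
theorem eulerLagrange_lagrangian (hW : IsOpen W) (hΛ : ContDiffOn ℝ ∞ Λ W)
    (hN : ∀ α β, ContDiffOn ℝ ∞ (fun z => N z α β) W) (α : Fin m) {j : J1 m} (hj : j ∈ over1 W)
    (uxx uxy uyy : Fin m → ℝ) : eulerLagrange (lagrangian Λ N) α j uxx uxy uyy =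
      extDeriv Λ j.1 ![(0, 0, Pi.single α 1), (1, 0, j.2.1), (0, 1, j.2.2)] -
        (fderiv ℝ (fun z => bil (fun α β => N z α β) j.2.1 j.2.2) j.1 (0, 0, Pi.single α 1) -
          fderiv ℝ (fun z => bil (fun α β => N z α β) (Pi.single α 1) j.2.2) j.1 (1, 0, j.2.1) -
          fderiv ℝ (fun z => bil (fun α β => N z α β) j.2.1 (Pi.single α 1)) j.1 (0, 1, j.2.2)) / 2
        + (bil (fun α β => N j.1 α β) (Pi.single α 1) uxy +
          bil (fun α β => N j.1 α β) uxy (Pi.single α 1)) / 2 := by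
  have h1 := fderiv_lagrangian hW hΛ hN hj (eU α)
  simp only [eU, bil_zero_left, bil_zero_right] at h1
  have h2 : Λ j.1 ![(0, 0, 0), (0, 1, j.2.2)] = 0 := alternating_two_zero_left _ _
  have h3 : Λ j.1 ![(1, 0, j.2.1), (0, 0, 0)] = 0 := alternating_two_zero_right _ _
  have h4 := alternating_two_swap (Λ j.1) (0, 0, uxy) (0, 0, Pi.single α 1)
  have h5 := alternating_two_swap (fderiv ℝ Λ j.1 (0, 1, j.2.2)) (1, 0, j.2.1)
    (0, 0, Pi.single α 1)
  rw [eulerLagrange, Dx_pd_eUx_lagrangian hW hΛ hN α hj, Dy_pd_eUy_lagrangian hW hΛ hN α hj,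
    extDeriv_two_apply_fderiv (ContDiffOn.differentiableAt_of_isOpen hΛ hW hj), pd, eU, h1, h2, h3,
    h4, h5]
  ring

end

/-- Over a convex open set the conditions on a multiplier yield a Lagrangian. -/
theorem Conditions.hasLagrangian (h : s.Conditions W N) (hs : s.SmoothOn W) (hW : IsOpen W)
    (hc : Convex ℝ W) : s.HasLagrangian W fun j => N j.1 := by
  obtain rfl | ⟨z₀, hz₀⟩ := W.eq_empty_or_nonempty
  · refine ⟨0, ?_, fun j hj => absurd hj (Set.notMem_empty _)⟩
    exact contDiffOn_const
  have hN := h.contDiffOn hs hW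
  have hΦ := contDiffOn_multiplierForm hs hN
  have hΛ := ContDiffOn.homotopyOperator hW hc hz₀ hΦ
  refine ⟨lagrangian (homotopyOperator z₀ (s.multiplierForm N)) N, contDiffOn_lagrangian hΛ hN,
    fun j hj uxx uxy uyy α => ?_⟩
  have hΦ' : _ = _ := h.multiplierForm_U_X_Y hs hW α j.2.1 j.2.2 hj
  have hsymm : bil (fun α β => N j.1 α β) uxy (Pi.single α 1) =
      bil (fun α β => N j.1 α β) (Pi.single α 1) uxy := h.bil_symm hj _ _
  have hsymm' : fderiv ℝ (fun z => bil (fun α β => N z α β) j.2.1 (Pi.single α 1)) j.1 =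
      fderiv ℝ (fun z => bil (fun α β => N z α β) (Pi.single α 1) j.2.1) j.1 :=
    fderiv_eq_of_eqOn_open hW (fun z hz => h.bil_symm hz _ _) hj
  -- With dΛ replaced by the three-form on (∂/∂u^α, D_x, D_y), the contraction formula cancels the
  -- derivatives of N. By symmetry of N the two halves of the u_xy term combine, leaving N (u_xy -
  -- f).
  rw [eulerLagrange_lagrangian hW hΛ hN α hj, extDeriv_homotopyOperator_apply hW hc hz₀ hΦ hj
    fun w hw => h.extDeriv_multiplierForm hs hW hw _ α _ _, hsymm, hsymm', bil_single_left]
  simp only at hΦ'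
  rw [hΦ']
  simp only [mul_sub, Finset.sum_sub_distrib]
  ring

end System

end FGordon

/-! ### Localization and the main theorem -/

namespace FGordon

open Filter Topology

variable {m : ℕ} {s : System m} {V W : Set (J0 m)}

namespace System

variable {N : J0 m → Matrix (Fin m) (Fin m) ℝ}

theorem Conditions.mono (h : s.Conditions W N) (hVW : V ⊆ W) : s.Conditions V N :=
  ⟨fun z hz => h.symm z (hVW hz), fun j hj => h.HK j (hVW hj), fun j hj => h.skew j (hVW hj),
    fun z hz => h.deriv z (hVW hz)⟩

/-- The conditions on a multiplier are local. -/
theorem conditions_of_local (h : ∀ p ∈ W, ∃ V, IsOpen V ∧ p ∈ V ∧ ∃ N', s.Conditions V N' ∧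
    Set.EqOn N N' V) : s.Conditions W N := by
  refine ⟨fun z hz => ?_, fun j hj uxx uyy α β => ?_, fun j hj α β γ => ?_, fun z hz α β => ?_⟩
  · obtain ⟨V, -, hp, N', hN', he⟩ := h z hz
    rw [he hp]
    exact hN'.symm z hp
  · obtain ⟨V, -, hp, N', hN', he⟩ := h j.1 hj
    rw [he hp]
    exact hN'.HK j hp uxx uyy α β
  · obtain ⟨V, -, hp, N', hN', he⟩ := h j.1 hj
    rw [he hp]
    exact hN'.skew j hp α β γ
  · obtain ⟨V, hV, hp, N', hN', he⟩ := h z hz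
    rw [he hp]
    exact (hN'.deriv z hp α β).congr_of_eventuallyEq
      ((eventuallyEq_of_eqOn_open hV he hp).mono fun w hw => congrFun (congrFun hw α) β)

theorem HasLagrangian.congr {M M' : J1 m → Matrix (Fin m) (Fin m) ℝ} (h : s.HasLagrangian V M)
    (hM : Set.EqOn M' M (over1 V)) : s.HasLagrangian V M' := by
  obtain ⟨L, hL, hE⟩ := h
  exact ⟨L, hL, fun j hj uxx uxy uyy α => by rw [hE j hj, hM hj]⟩

/-- Passing through the closed form of the Lagrangian lets one argument serve both parts of the
theorem, including the fact that the multiplier depends on (x, y, u) only. -/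
theorem HasLagrangian.exists_conditions {M : J1 m → Matrix (Fin m) (Fin m) ℝ}
    (h : s.HasLagrangian V M) (hs : s.SmoothOn V) (hV : IsOpen V) :
    ∃ N, s.Conditions V N ∧ ∀ j ∈ over1 V, M j = N j.1 := by
  obtain ⟨T, P, R, hω, hM⟩ := exists_isClosedOmega_of_hasLagrangian hV h 0
  refine ⟨_, hω.conditions hs hV, fun j hj => ?_⟩
  ext α β
  have hq : IsClosedOmega.liftJ1 0 j ∈ overEq (0 + 2) V := hj
  have h1 : R _ α β = R _ α β := hω.R_eq hs hV α β hq
  have h2 : R _ β α = R _ β α := hω.R_eq hs hV β α hq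
  have h3 := hM _ hq α β
  rw [h1, h2] at h3
  exact h3.symm

/-- A closed form determines M only at truncations of jets of its own order. By surjectivity these
are all jets on which M is defined. -/
theorem exists_trunc_eq {k l : ℕ} (h : k ≤ l) (q : EqJet m k) : ∃ q' : EqJet m l, q'.trunc h = q := by
  refine ⟨(q.1, fun i => if hi : (i : ℕ) < k then q.2.1 ⟨i, hi⟩ else 0,
    fun i => if hi : (i : ℕ) < k then q.2.2 ⟨i, hi⟩ else 0), ?_⟩
  simp [EqJet.trunc]

theorem HasClosedForm.exists_conditions {k : ℕ} {M : EqJet m k → Matrix (Fin m) (Fin m) ℝ}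
    (h : s.HasClosedForm V M) (hs : s.SmoothOn V) (hV : IsOpen V) :
    ∃ N, s.Conditions V N ∧ ∀ q ∈ overEq k V, M q = N q.1 := by
  obtain ⟨n, hk, T, P, R, hT, hP, hR, hM, hcl⟩ := h
  have hω : IsClosedOmega s V T P R := ⟨hT, hP, hR, hcl⟩
  refine ⟨_, hω.conditions hs hV, fun q hq => ?_⟩
  obtain ⟨q', rfl⟩ := exists_trunc_eq hk q
  ext α β
  have hq' : q' ∈ overEq (n + 2) V := hq
  have h1 : R q' α β = R _ α β := hω.R_eq hs hV α β hq'
  have h2 : R q' β α = R _ β α := hω.R_eq hs hV β α hq'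
  have h3 := hM q' hq' α β
  rw [h1, h2] at h3
  exact h3.symm

theorem Conditions.hasClosedForm (h : s.Conditions V N) (hs : s.SmoothOn V) (hV : IsOpen V)
    (hc : Convex ℝ V) {k : ℕ} {M : EqJet m k → Matrix (Fin m) (Fin m) ℝ}
    (hM : ∀ q ∈ overEq k V, M q = N q.1) : s.HasClosedForm V M := by
  -- The form of a Lagrangian lives on every order from two on; order k + 2 is high enough to
  -- compare with M.
  obtain ⟨T, P, R, hω, hR⟩ := exists_isClosedOmega_of_hasLagrangian hV (h.hasLagrangian hs hV hc) k
  refine ⟨k, Nat.le_add_right k 2, T, P, R, hω.smooth_T, hω.smooth_P, hω.smooth_R,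
    fun q hq α β => ?_, hω.closed⟩
  rw [hR q hq, hM _ (show q.trunc _ ∈ overEq k V from hq)]
  rfl

theorem exists_convex_nhd (hW : IsOpen W) {p : J0 m} (hp : p ∈ W) :
    ∃ V, IsOpen V ∧ p ∈ V ∧ V ⊆ W ∧ Convex ℝ V := by
  obtain ⟨ε, hε, h⟩ := Metric.isOpen_iff.1 hW p hp
  exact ⟨_, Metric.isOpen_ball, Metric.mem_ball_self hε, h, convex_ball p ε⟩

theorem multiplierVariational_iff (hs : s.SmoothOn W) (hW : IsOpen W)
    (M : J1 m → Matrix (Fin m) (Fin m) ℝ) : s.MultiplierVariational W M ↔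
      ∃ N : J0 m → Matrix (Fin m) (Fin m) ℝ, (∀ j ∈ over1 W, M j = N j.1) ∧
        (∀ z ∈ W, (N z).det ≠ 0) ∧ s.Conditions W N := by
  constructor
  · rintro ⟨hdet, hloc⟩
    have key : ∀ p ∈ W, ∃ V, IsOpen V ∧ p ∈ V ∧ ∃ N', s.Conditions V N' ∧
        ∀ j ∈ over1 V, M j = N' j.1 := by
      intro p hp
      obtain ⟨V, hV, hpV, hVW, hL⟩ := hloc p hp
      exact ⟨V, hV, hpV, hL.exists_conditions (hs.mono hVW) hV⟩
    -- Restricting M to zero derivatives defines N on all of `W` at once. Nearby it agrees with each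
    -- locally found matrix, so nothing has to be glued.
    refine ⟨fun z => M (z, 0, 0), fun j hj => ?_, fun z hz => hdet _ hz,
      conditions_of_local fun p hp => ?_⟩
    · obtain ⟨V, -, hp, N', -, hM⟩ := key j.1 hj
      rw [hM j hp]
      exact (hM (j.1, 0, 0) hp).symm
    · obtain ⟨V, hV, hpV, N', hN', hM⟩ := key p hp
      exact ⟨V, hV, hpV, N', hN', fun z hz => hM (z, 0, 0) hz⟩
  · rintro ⟨N, hM, hdet, hN⟩
    refine ⟨fun j hj => by rw [hM j hj]; exact hdet _ hj, fun p hp => ?_⟩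
    obtain ⟨V, hV, hpV, hVW, hc⟩ := exists_convex_nhd hW hp
    exact ⟨V, hV, hpV, hVW, ((hN.mono hVW).hasLagrangian (hs.mono hVW) hV hc).congr
      fun j hj => hM j (hVW hj)⟩

theorem locallyHasClosedForm_iff (hs : s.SmoothOn W) (hW : IsOpen W) {k : ℕ}
    (M : EqJet m k → Matrix (Fin m) (Fin m) ℝ) : s.LocallyHasClosedForm W M ↔
      ∃ N : J0 m → Matrix (Fin m) (Fin m) ℝ, (∀ q ∈ overEq k W, M q = N q.1) ∧
        s.Conditions W N := by
  constructor
  · intro hloc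
    have key : ∀ p ∈ W, ∃ V, IsOpen V ∧ p ∈ V ∧ ∃ N', s.Conditions V N' ∧
        ∀ q ∈ overEq k V, M q = N' q.1 := by
      intro p hp
      obtain ⟨V, hV, hpV, hVW, hω⟩ := hloc p hp
      exact ⟨V, hV, hpV, hω.exists_conditions (hs.mono hVW) hV⟩
    refine ⟨fun z => M (z, 0, 0), fun q hq => ?_, conditions_of_local fun p hp => ?_⟩
    · obtain ⟨V, -, hp, N', -, hM⟩ := key q.1 hq
      rw [hM q hp]
      exact (hM (q.1, 0, 0) hp).symm
    · obtain ⟨V, hV, hpV, N', hN', hM⟩ := key p hp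
      exact ⟨V, hV, hpV, N', hN', fun z hz => hM (z, 0, 0) hz⟩
  · rintro ⟨N, hM, hN⟩ p hp
    obtain ⟨V, hV, hpV, hVW, hc⟩ := exists_convex_nhd hW hp
    exact ⟨V, hV, hpV, hVW, (hN.mono hVW).hasClosedForm (hs.mono hVW) hV hc
      fun q hq => hM q (hVW hq)⟩

end System

end FGordon

end

theorem proposition2p2 (m : ℕ) (W : Set (FGordon.J0 m)) (hW : IsOpen W)
    (s : FGordon.System m) (hs : s.SmoothOn W) :
    (∀ M : FGordon.J1 m → Matrix (Fin m) (Fin m) ℝ,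
      (s.MultiplierVariational W M ↔
        ∃ N : FGordon.J0 m → Matrix (Fin m) (Fin m) ℝ,
          (∀ j ∈ FGordon.over1 W, M j = N j.1) ∧
          (∀ z ∈ W, (N z).det ≠ 0) ∧ s.Conditions W N) ∧
      (Convex ℝ W → s.MultiplierVariational W M → s.HasLagrangian W M)) ∧
    (∀ (k : ℕ) (M : FGordon.EqJet m k → Matrix (Fin m) (Fin m) ℝ),
      (s.LocallyHasClosedForm W M ↔
        ∃ N : FGordon.J0 m → Matrix (Fin m) (Fin m) ℝ,
          (∀ q ∈ FGordon.overEq k W, M q = N q.1) ∧ s.Conditions W N) ∧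
      (Convex ℝ W → s.LocallyHasClosedForm W M → s.HasClosedForm W M)) := by
  refine ⟨fun M => ⟨FGordon.System.multiplierVariational_iff hs hW M, fun hc hM => ?_⟩,
    fun k M => ⟨FGordon.System.locallyHasClosedForm_iff hs hW M, fun hc hM => ?_⟩⟩
  -- Local Lagrangians are not patched together: they give the conditions on all of `W`, from which
  -- a Lagrangian is constructed afresh.
  · obtain ⟨N, hN, -, h⟩ := (FGordon.System.multiplierVariational_iff hs hW M).1 hM
    exact (h.hasLagrangian hs hW hc).congr hN
  · obtain ⟨N, hN, h⟩ := (FGordon.System.locallyHasClosedForm_iff hs hW M).1 hM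
    exact h.hasClosedForm hs hW hc hN
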